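/- Let $p$ be an odd prime and $k$ a number field whose class number is prime to $p$. Fix algebraic closures and write $G_F$ for the absolute Galois group of a field $F$. Let $S$ be a finite set of places of $k$ containing all infinite places and all places above $p$. Let $\mathcal{O}\subset\overline{\mathbb{Q}}_p$ be a complete discrete valuation ring with maximal ideal $\mathfrak{m}$ and residue characteristic $p$, and let $T$ be a free $\mathcal{O}$-module of finite rank with a continuous ($\mathcal{O}$-linear, $\mathfrak m$-adic) action of $G_{k,S}=\mathrm{Gal}(k_S/k)$, where $k_S$ is the maximal extension of $k$ unramified outside $S$; assume $H^0(G_{k,S},T/\mathfrak{m}T)=0$. Let $k_\infty/k$ be a $\mathbb{Z}_p^r$-extension with $r\ge 1$ in which no (finite) prime of $k$ splits completely. Let $\mathcal{K}/k$ be a pro-$p$ abelian extension unramified at all places in $S$, and let $\Omega$ be the set of finite subextensions $K/k$ of $\mathcal{K}/k$. For $K\in\Omega$ put $\Lambda_K=\mathcal{O}[[\mathrm{Gal}(k_\infty K/k)]]$ and $\mathbb{T}_K=T\otimes_{\mathcal{O}}\Lambda_K^{\iota}$, where $\Lambda_K$ acts by multiplication on the second factor and $g\in G_k$ acts by $t\otimes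 x\mapsto gt\otimes [g|_{k_\infty K}]^{-1}x$. Identify $\mathrm{Gal}(k_\infty K/k)=\mathrm{Gal}(k_\infty/k)\times\mathrm{Gal}(K/k)$, and for a character $\psi:\mathrm{Gal}(K/k)\to\overline{\mathbb{Q}}_p^{\times}$ put $e_{K,\psi}=[K:k]^{-1}\sum_{g\in\mathrm{Gal}(K/k)}\psi(g)g^{-1}\in\Lambda_K\otimes_{\mathcal{O}}\overline{\mathbb{Q}}_p$. For a prime $\mathfrak q\notin S$ of $k$ let $\mathrm{Fr}_{\mathfrak q}\in G_k$ be a lift of the arithmetic Frobenius at $\mathfrak q$, let $P_{\mathfrak q}(x)=\det(1-x\,\mathrm{Fr}_{\mathfrak q}\mid T)\in\mathcal{O}[x]$, let $\mathcal{I}_{K,\mathfrak q}\subset\mathrm{Gal}(K/k)$ be the inertia group at $\mathfrak q$, and let $f_{K,\mathfrak q}$ be the element of $\Lambda_K\otimes_{\mathcal{O}}\overline{\mathbb{Q}}_p$ such that for every $\psi$ $$f_{K,\mathfrak q}\,e_{K,\psi}=\begin{cases} e_{K,\psi} & \text{if }\psi(\mathcal{I}_{K,\mathfrak q})\ne 1,\\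 P_{\mathfrak q}(\mathrm{Fr}_{\mathfrak q}^{-1})\,e_{K,\psi} & \text{if }\psi(\mathcal{I}_{K,\mathfrak q})=1.\end{cases}$$ For a commutative ring $R$ write $N^*=\mathrm{Hom}_R(N,R)$ and $\bigcap_R^s N=(\bigwedge_R^s N^*)^*$. For a finitely generated $R$-module $M$ and an exact sequence $0\to N\to R^s\to M\to 0$ with $s\ge 1$, the characteristic ideal is $\mathrm{char}_R(M)=\mathrm{im}\big(\bigcap_R^s N\to\bigcap_R^s R^s=R\big)$. Then for every $K\in\Omega$ and every prime $\mathfrak q\notin S$ of $k$ the element $f_{K,\mathfrak q}$ is well defined and lies in $\Lambda_K[1/p]$, the continuous cohomology group $H^1(G_{k_{\mathfrak q}},\mathbb{T}_K)$ is a finitely generated $\Lambda_K$-module, and (for every choice of the exact sequence defining the characteristic ideal) $$\mathrm{char}_{\Lambda_K}\big(H^1(G_{k_{\mathfrak q}},\mathbb{T}_K)\big)\,\Lambda_K[1/p]=f_{K,\mathfrak q}\,\Lambda_K[1/p].$$ -/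

import Mathlib

open scoped TensorProduct nonZeroDivisors Polynomial

noncomputable section

namespace IwasawaLocal

section CompletedGroupAlgebra

/-! ### The completed group algebra `O[[G]]` of an abelian profinite group -/

variable (O : Type*) [CommRing O] (G : Type*) [CommGroup G] [TopologicalSpace G]

/-- The transition map `O[G/U] → O[G/V]` for open subgroups `U ≤ V`. -/
def transition {U V : OpenSubgroup G} (h : U ≤ V) :
    MonoidAlgebra O (G ⧸ (U : Subgroup G)) →ₐ[O] MonoidAlgebra O (G ⧸ (V : Subgroup G)) :=
  MonoidAlgebra.mapDomainAlgHom O O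
    (QuotientGroup.map (U : Subgroup G) (V : Subgroup G) (MonoidHom.id G) h)

/-- The compatible families in `∏_U O[G/U]`, where `U` runs over the open subgroups of `G`. -/
def compatibleFamilies :
    Subalgebra O (∀ U : OpenSubgroup G, MonoidAlgebra O (G ⧸ (U : Subgroup G))) where
  carrier := {x | ∀ (U V : OpenSubgroup G) (h : U ≤ V), transition O G h (x U) = x V}
  mul_mem' hx hy U V h := by
    rw [Pi.mul_apply, map_mul, hx U V h, hy U V h, Pi.mul_apply]
  add_mem' hx hy U V h := by
    rw [Pi.add_apply, map_add, hx U V h, hy U V h, Pi.add_apply]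
  algebraMap_mem' r U V h := by
    rw [Pi.algebraMap_apply, AlgHom.commutes, Pi.algebraMap_apply]

/-- `O[[G]] = lim_U O[G/U]`. -/
def CompletedGroupAlgebra : Type _ := compatibleFamilies O G

instance : CommRing (CompletedGroupAlgebra O G) :=
  inferInstanceAs (CommRing (compatibleFamilies O G))

instance : Algebra O (CompletedGroupAlgebra O G) :=
  inferInstanceAs (Algebra O (compatibleFamilies O G))

/-- The inverse limit topology, where `O[G/U]` carries the topology of pointwise convergence of
the coefficients (the product topology of `O^{G/U}` when `G/U` is finite). -/
instance [TopologicalSpace O] : TopologicalSpace (CompletedGroupAlgebra O G) :=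
  TopologicalSpace.induced
    (fun (x : compatibleFamilies O G) (U : OpenSubgroup G) (g : G ⧸ (U : Subgroup G)) =>
      (x.1 U).coeff g)
    inferInstance

/-- The canonical homomorphism `G → O[[G]]`, `g ↦ [g]`. -/
def groupElem : G →* CompletedGroupAlgebra O G where
  toFun g := (⟨fun U => MonoidAlgebra.single (QuotientGroup.mk g) 1, by
    intro U V h
    simp only [transition, MonoidAlgebra.mapDomainAlgHom_apply, MonoidAlgebra.mapDomain_single]
    rfl⟩ : compatibleFamilies O G)
  map_one' := rfl
  map_mul' g h := Subtype.ext <| funext fun U => by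
    have key := MonoidAlgebra.single_mul_single (QuotientGroup.mk g : G ⧸ (U : Subgroup G))
      (QuotientGroup.mk h) (1 : O) 1
    rw [one_mul] at key
    exact key.symm

end CompletedGroupAlgebra

section Cohomology

/-! ### The first continuous cohomology group -/

variable {R G M : Type*} [CommRing R] [TopologicalSpace R] [Group G] [TopologicalSpace G]
  [AddCommGroup M] [Module R M]

/-- Continuous inhomogeneous `1`-cocycles of `G` with values in `M`, where `M` carries the
`R`-module topology (the product topology of `R^n` when `M` is free of rank `n`). -/
def cocycles₁ (ρ : Representation R G M) : Submodule R (G → M) where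
  carrier := {c | @Continuous G M _ (moduleTopology R M) c ∧
    ∀ g h, c (g * h) = c g + ρ g (c h)}
  zero_mem' := by
    let _ : TopologicalSpace M := moduleTopology R M
    exact ⟨continuous_const, fun g h => by simp⟩
  add_mem' {c d} hc hd := by
    let _ : TopologicalSpace M := moduleTopology R M
    have := ModuleTopology.continuousAdd R M
    refine ⟨hc.1.add hd.1, fun g h => ?_⟩
    simp only [Pi.add_apply, hc.2 g h, hd.2 g h, map_add]
    abel
  smul_mem' r c hc := by
    let _ : TopologicalSpace M := moduleTopology R M
    have := ModuleTopology.continuousSMul R M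
    refine ⟨continuous_const.smul hc.1, fun g h => ?_⟩
    simp only [Pi.smul_apply, hc.2 g h, map_smul, smul_add]

/-- The map `M → (G → M)`, `m ↦ (g ↦ g m - m)`, whose image is the module of `1`-coboundaries. -/
def coboundaryMap (ρ : Representation R G M) : M →ₗ[R] (G → M) :=
  LinearMap.pi fun g => ρ g - LinearMap.id

/-- `H¹(G, M)`: continuous `1`-cocycles modulo (those which are) `1`-coboundaries. When `G` acts
continuously on `M`, every coboundary is a continuous cocycle. -/
abbrev H1 (ρ : Representation R G M) : Type _ :=
  cocycles₁ ρ ⧸ (LinearMap.range (coboundaryMap ρ)).submoduleOf (cocycles₁ ρ)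

end Cohomology

section CharacteristicIdeal

/-! ### Exterior bi-duals and characteristic ideals -/

variable (R : Type*) [CommRing R]

/-- The exterior bi-dual `⋂^s_R N = (⋀^s_R N^*)^*`. -/
abbrev ExteriorBidual (s : ℕ) (N : Type*) [AddCommGroup N] [Module R N] : Type _ :=
  Module.Dual R (⋀[R]^s (Module.Dual R N))

variable {R}

/-- The map `⋂^s_R N → ⋂^s_R N'` induced by a homomorphism `N → N'`. -/
def exteriorBidualMap (s : ℕ) {N N' : Type*} [AddCommGroup N] [Module R N] [AddCommGroup N']
    [Module R N'] (i : N →ₗ[R] N') : ExteriorBidual R s N →ₗ[R] ExteriorBidual R s N' :=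
  (exteriorPower.map s i.dualMap).dualMap

/-- The canonical identification `⋂^s_R R^s = R`: evaluation at `e₁^* ∧ ⋯ ∧ e_s^*`. -/
def exteriorBidualFree (s : ℕ) : ExteriorBidual R s (Fin s → R) →ₗ[R] R :=
  LinearMap.applyₗ (exteriorPower.ιMulti R s fun j : Fin s => LinearMap.proj j)

/-- The characteristic ideal of `M`, computed from the exact sequence `0 → N → R^s → M → 0` with
`N = ker φ`: the image of `⋂^s_R N → ⋂^s_R R^s = R`. -/
def charIdeal {M : Type*} [AddCommGroup M] [Module R M] {s : ℕ} (φ : (Fin s → R) →ₗ[R] M) :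
    Ideal R :=
  LinearMap.range (exteriorBidualFree s ∘ₗ exteriorBidualMap s (LinearMap.ker φ).subtype)

end CharacteristicIdeal

section Galois

/-! ### Galois groups, ramification and Frobenius elements -/

open NumberField IsDedekindDomain

variable {k : Type*} [Field k]

/-- Restriction `Gal(L/k) → Gal(E/k)` for intermediate fields `E ≤ L` of `k̄/k`, `E/k` normal. -/
def resGal {E L : IntermediateField k (AlgebraicClosure k)} (h : E ≤ L) [Normal k E] :
    Gal(L/k) →* Gal(E/k) :=
  letI := (IntermediateField.inclusion h).toRingHom.toAlgebra
  haveI : IsScalarTower k E L := IsScalarTower.of_algebraMap_eq' rfl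
  AlgEquiv.restrictNormalHom E

lemma inclusion_resGal {E L : IntermediateField k (AlgebraicClosure k)} (h : E ≤ L) [Normal k E]
    (σ : Gal(L/k)) (x : E) :
    IntermediateField.inclusion h (resGal h σ x) = σ (IntermediateField.inclusion h x) :=
  letI := (IntermediateField.inclusion h).toRingHom.toAlgebra
  haveI : IsScalarTower k E L := IsScalarTower.of_algebraMap_eq' rfl
  AlgEquiv.restrictNormal_commutes σ E x

/-- Restriction `G_k = Gal(k̄/k) → Gal(E/k)`. -/
abbrev resAbs (E : IntermediateField k (AlgebraicClosure k)) [Normal k E] :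
    Gal(AlgebraicClosure k/k) →* Gal(E/k) :=
  AlgEquiv.restrictNormalHom E

/-- The homomorphism `G_F → G_k` induced by a field extension `F/k` and a `k`-embedding
`j : k̄ → F̄`. -/
def resLocal {F : Type*} [Field F] [Algebra k F]
    (j : AlgebraicClosure k →ₐ[k] AlgebraicClosure F) :
    Gal(AlgebraicClosure F/F) →* Gal(AlgebraicClosure k/k) :=
  letI := j.toRingHom.toAlgebra
  haveI : IsScalarTower k (AlgebraicClosure k) (AlgebraicClosure F) :=
    IsScalarTower.of_algebraMap_eq' j.comp_algebraMap.symm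
  (AlgEquiv.restrictNormalHom (AlgebraicClosure k)).comp (AlgEquiv.restrictScalarsHom k)

lemma apply_resLocal {F : Type*} [Field F] [Algebra k F]
    (j : AlgebraicClosure k →ₐ[k] AlgebraicClosure F) (σ : Gal(AlgebraicClosure F/F))
    (x : AlgebraicClosure k) : j (resLocal j σ x) = σ (j x) :=
  letI := j.toRingHom.toAlgebra
  haveI : IsScalarTower k (AlgebraicClosure k) (AlgebraicClosure F) :=
    IsScalarTower.of_algebraMap_eq' j.comp_algebraMap.symm
  AlgEquiv.restrictNormal_commutes (σ.restrictScalars k) (AlgebraicClosure k) x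

lemma resGal_ext {L₁ L₂ : IntermediateField k (AlgebraicClosure k)} [Normal k L₁] [Normal k L₂]
    {σ τ : Gal(↥(L₁ ⊔ L₂)/k)} (h₁ : resGal le_sup_left σ = resGal le_sup_left τ)
    (h₂ : resGal le_sup_right σ = resGal le_sup_right τ) : σ = τ := by
  obtain ⟨s, rfl⟩ := AlgEquiv.restrictNormalHom_surjective (AlgebraicClosure k) σ
  obtain ⟨t, rfl⟩ := AlgEquiv.restrictNormalHom_surjective (AlgebraicClosure k) τ
  have key : ∀ (E : IntermediateField k (AlgebraicClosure k)) [Normal k E] (hE : E ≤ L₁ ⊔ L₂),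
      resGal hE (AlgEquiv.restrictNormalHom ↥(L₁ ⊔ L₂) s) =
        resGal hE (AlgEquiv.restrictNormalHom ↥(L₁ ⊔ L₂) t) → t⁻¹ * s ∈ E.fixingSubgroup := by
    intro E _ hE h
    rw [IntermediateField.mem_fixingSubgroup_iff]
    intro x hx
    have hx' := congrArg (fun y => (IntermediateField.inclusion hE y : AlgebraicClosure k))
      (DFunLike.congr_fun h ⟨x, hx⟩)
    simp only [inclusion_resGal, AlgEquiv.restrictNormalHom_apply] at hx'
    change t⁻¹ (s x) = x
    have : s x = t x := hx'
    rw [this]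
    exact t.symm_apply_apply x
  have hmem : t⁻¹ * s ∈ (L₁ ⊔ L₂).fixingSubgroup := by
    rw [IntermediateField.fixingSubgroup_sup]
    exact ⟨key L₁ le_sup_left h₁, key L₂ le_sup_right h₂⟩
  rw [IntermediateField.mem_fixingSubgroup_iff] at hmem
  ext x
  rw [AlgEquiv.restrictNormalHom_apply, AlgEquiv.restrictNormalHom_apply]
  have := congrArg t (hmem x x.2)
  rw [AlgEquiv.mul_apply] at this
  exact (t.apply_symm_apply _).symm.trans this

/-- A compositum of two abelian extensions is abelian. -/
instance isAbelianGalois_sup (L₁ L₂ : IntermediateField k (AlgebraicClosure k))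
    [IsAbelianGalois k L₁] [IsAbelianGalois k L₂] :
    IsAbelianGalois k ↥(L₁ ⊔ L₂) where
  is_comm.comm σ τ := by
    apply resGal_ext <;> rw [map_mul, map_mul] <;> exact Std.Commutative.comm _ _

variable [NumberField k]

instance : SMulCommClass Gal(AlgebraicClosure k/k) (𝓞 k) (𝓞 (AlgebraicClosure k)) where
  smul_comm σ a x := RingOfIntegers.ext <| by
    have h : σ • algebraMap (𝓞 k) (𝓞 (AlgebraicClosure k)) a =
        algebraMap (𝓞 k) (𝓞 (AlgebraicClosure k)) a := RingOfIntegers.ext (σ.commutes (a : k))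
    simp only [Algebra.smul_def, smul_mul', h]

/-- The primes of `k̄` above the prime `v` of `k`. -/
def PrimesAbove (v : HeightOneSpectrum (𝓞 k)) : Set (Ideal (𝓞 (AlgebraicClosure k))) :=
  {Q | Q.IsPrime ∧ Q.under (𝓞 k) = v.asIdeal}

/-- The inertia subgroup of `G_k` at a prime `Q` of `k̄`. -/
abbrev inertiaAt (Q : Ideal (𝓞 (AlgebraicClosure k))) : Subgroup Gal(AlgebraicClosure k/k) :=
  Q.toAddSubgroup.inertia Gal(AlgebraicClosure k/k)

/-- `L/k` is unramified at `v`: the inertia groups of all primes of `k̄` above `v` fix `L`. -/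
def UnramifiedAt (v : HeightOneSpectrum (𝓞 k)) (L : IntermediateField k (AlgebraicClosure k)) :
    Prop :=
  ∀ Q ∈ PrimesAbove v, inertiaAt Q ≤ L.fixingSubgroup

open scoped Pointwise in
/-- `v` splits completely in `L/k`: the decomposition groups of all primes of `k̄` above `v`
fix `L`. -/
def SplitsCompletely (v : HeightOneSpectrum (𝓞 k))
    (L : IntermediateField k (AlgebraicClosure k)) : Prop :=
  ∀ Q ∈ PrimesAbove v, MulAction.stabilizer Gal(AlgebraicClosure k/k) Q ≤ L.fixingSubgroup

/-- `k_S`, the maximal extension of `k` in `k̄` unramified outside `S` and the infinite places. -/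
def maxUnramifiedOutside (S : Finset (HeightOneSpectrum (𝓞 k))) :
    IntermediateField k (AlgebraicClosure k) :=
  sSup {L | ∀ v ∉ S, UnramifiedAt v L}

/-- `σ ∈ G_k` is a lift of the arithmetic Frobenius at the prime `Q` of `k̄`. -/
abbrev IsFrobenius (Q : Ideal (𝓞 (AlgebraicClosure k))) (σ : Gal(AlgebraicClosure k/k)) : Prop :=
  IsArithFrobAt (𝓞 k) σ Q

end Galois

section Iwasawa

open NumberField

variable {k : Type*} [Field k]

open scoped IsMulCommutative in
/-- `O[[Gal(L/k)]]` for an abelian extension `L/k`. -/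
abbrev IwasawaAlgebra (O : Type*) [CommRing O] (L : IntermediateField k (AlgebraicClosure k))
    [IsAbelianGalois k L] : Type _ :=
  CompletedGroupAlgebra O Gal(L/k)

open scoped IsMulCommutative in
/-- `γ ↦ [γ]`, from `Gal(L/k)` to `O[[Gal(L/k)]]`. -/
def galElem (O : Type*) [CommRing O] (L : IntermediateField k (AlgebraicClosure k))
    [IsAbelianGalois k L] : Gal(L/k) →* IwasawaAlgebra O L :=
  groupElem O Gal(L/k)

variable {O : Type*} [CommRing O] {T : Type*} [AddCommGroup T] [Module O T]

/-- The `G_k`-module `T ⊗_O O[[Gal(L/k)]]^ι`: the ring `O[[Gal(L/k)]]` acts by multiplication on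
the second factor (written on the left here), and `g ∈ G_k` acts by `t ⊗ x ↦ g t ⊗ [g|_L]⁻¹ x`. -/
def iwasawaRep (ρ : Representation O Gal(AlgebraicClosure k/k) T)
    (L : IntermediateField k (AlgebraicClosure k)) [IsAbelianGalois k L] :
    Representation (IwasawaAlgebra O L) Gal(AlgebraicClosure k/k) (IwasawaAlgebra O L ⊗[O] T) where
  toFun g := galElem O L (resAbs L g)⁻¹ • (ρ g).baseChange (IwasawaAlgebra O L)
  map_one' := by
    simp [Module.End.one_eq_id]
  map_mul' g h := by
    rw [map_mul, map_mul, mul_inv_rev, map_mul, mul_comm (galElem O L _), Module.End.mul_eq_comp,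
      LinearMap.baseChange_comp, Module.End.mul_eq_comp, LinearMap.smul_comp, LinearMap.comp_smul,
      smul_smul]

/-- `det(1 - x f | T) ∈ O[x]`. -/
def frobPoly (f : T →ₗ[O] T) : O[X] :=
  LinearMap.det ((1 : Module.End O[X] (O[X] ⊗[O] T)) - (Polynomial.X : O[X]) • f.baseChange O[X])

variable (p : ℕ) [Fact p.Prime] (O) [Algebra O (PadicAlgCl p)]

/-- The ring `O[[Gal(L/k)]] ⊗_O ℚ̄_p`. -/
abbrev IwasawaAlgebraQpBar (L : IntermediateField k (AlgebraicClosure k)) [IsAbelianGalois k L] :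
    Type _ :=
  PadicAlgCl p ⊗[O] IwasawaAlgebra O L

/-- The ring `O[[Gal(L/k)]][1/p]`. -/
abbrev IwasawaAlgebraInv (L : IntermediateField k (AlgebraicClosure k)) [IsAbelianGalois k L] :
    Type _ :=
  Localization.Away (p : IwasawaAlgebra O L)

/-- The canonical map `O[[Gal(L/k)]] → O[[Gal(L/k)]] ⊗_O ℚ̄_p`. -/
def toQpBar (L : IntermediateField k (AlgebraicClosure k)) [IsAbelianGalois k L] :
    IwasawaAlgebra O L →+* IwasawaAlgebraQpBar O p L :=
  (Algebra.TensorProduct.includeRight : IwasawaAlgebra O L →ₐ[O] _).toRingHom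

lemma isUnit_toQpBar (L : IntermediateField k (AlgebraicClosure k)) [IsAbelianGalois k L] :
    IsUnit (toQpBar O p L (p : IwasawaAlgebra O L)) := by
  have h : IsUnit (p : PadicAlgCl p) :=
    (Nat.cast_ne_zero.mpr (Fact.out : p.Prime).ne_zero).isUnit
  have := h.map (algebraMap (PadicAlgCl p) (IwasawaAlgebraQpBar O p L))
  rwa [map_natCast] at this ⊢

/-- The canonical map `O[[Gal(L/k)]][1/p] → O[[Gal(L/k)]] ⊗_O ℚ̄_p`. -/
def invToQpBar (L : IntermediateField k (AlgebraicClosure k)) [IsAbelianGalois k L] :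
    IwasawaAlgebraInv O p L →+* IwasawaAlgebraQpBar O p L :=
  IsLocalization.Away.lift (p : IwasawaAlgebra O L) (isUnit_toQpBar O p L)

variable (kinf K : IntermediateField k (AlgebraicClosure k)) [IsAbelianGalois k kinf]
  [IsAbelianGalois k K]

/-- The subgroup `Gal(k_∞K/k_∞)` of `Gal(k_∞K/k)`. If `k_∞ ∩ K = k` this is the copy
`1 × Gal(K/k)` of `Gal(K/k)` in `Gal(k_∞K/k) = Gal(k_∞/k) × Gal(K/k)`. -/
abbrev galOver : Subgroup Gal(↥(kinf ⊔ K)/k) :=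
  (resGal (le_sup_left : kinf ≤ kinf ⊔ K)).ker

lemma finite_galOver [FiniteDimensional k K] : Finite (galOver kinf K) :=
  Finite.of_injective
    (fun γ : galOver kinf K => resGal (le_sup_right : K ≤ kinf ⊔ K) γ.1) fun γ δ h =>
      Subtype.ext (resGal_ext (γ.2.trans δ.2.symm) h)

/-- The element `e_{K,ψ} = [K:k]⁻¹ ∑_g ψ(g) g⁻¹` of `Λ_K ⊗_O ℚ̄_p`, the group `Gal(K/k)` being
identified with the (finite) group `Gal(k_∞K/k_∞)` by restriction to `K`. -/
def charIdempotent (ψ : Gal(K/k) →* (PadicAlgCl p)ˣ) : IwasawaAlgebraQpBar O p (kinf ⊔ K) :=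
  ((Module.finrank k K : PadicAlgCl p)⁻¹) •
    ∑ᶠ γ : galOver kinf K,
      (ψ (resGal (le_sup_right : K ≤ kinf ⊔ K) γ.1) : PadicAlgCl p) ⊗ₜ[O]
        galElem O (kinf ⊔ K) γ.1⁻¹

variable {O} [NumberField k]

open scoped Classical in
/-- The defining property of `f_{K,q} ∈ Λ_K ⊗_O ℚ̄_p`, where `Q` is a prime of `k̄` above `q` and
`Fr ∈ G_k` a lift of the arithmetic Frobenius at `q`: for every character `ψ` of `Gal(K/k)`,
`f e_{K,ψ} = e_{K,ψ}` if `ψ` is non-trivial on the inertia group of `Gal(K/k)` at `q`, and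
`f e_{K,ψ} = P_q(Fr⁻¹) e_{K,ψ}` otherwise. -/
def IsLocalFactor (ρ : Representation O Gal(AlgebraicClosure k/k) T)
    (Q : Ideal (𝓞 (AlgebraicClosure k))) (Fr : Gal(AlgebraicClosure k/k))
    (f : IwasawaAlgebraQpBar O p (kinf ⊔ K)) : Prop :=
  ∀ ψ : Gal(K/k) →* (PadicAlgCl p)ˣ,
    f * charIdempotent O p kinf K ψ =
      if (inertiaAt Q).map (resAbs K) ≤ ψ.ker then
        toQpBar O p (kinf ⊔ K)
          (Polynomial.aeval (galElem O (kinf ⊔ K) (resAbs (kinf ⊔ K) Fr)⁻¹) (frobPoly (ρ Fr))) *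
        charIdempotent O p kinf K ψ
      else charIdempotent O p kinf K ψ

end Iwasawa

end IwasawaLocal

end

/-! Write `Λ` for `Λ_K`, `M = Λ ⊗ T`, `I` for the inertia group at `q`, `σ` for a Frobenius lift,
`N` for the order of the residue field and `γ` for the image of `σ` in `Gal(k_∞K/k)`. As `q ∉ S`,
the prime `q` does not divide `p` and `I` acts trivially on `T`. The tame relation `σtσ⁻¹ ≡ t^N`
modulo wild inertia forces `I` to die in the torsion-free abelian group `Gal(k_∞/k)`, so `I` acts on
`M` through a finite group `H ⊂ Gal(k_∞K/k_∞)`. Its order `n` divides `[K:k]`, a power of `p`. Since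
`q` does not split completely in `k_∞`, the element `γ` has infinite order.

Cohomology. On the kernel of `I → H` a cocycle is a homomorphism killed by wild inertia, so the tame
relation gives `σ c(t) = N c(t)`. By Cayley–Hamilton a nonzero polynomial in `[γ]` kills `c(t)`, and
such polynomials are non-zero-divisors in `Λ` (`eq_zero_of_aeval_groupElem_mul_eq_zero`). So `c`
comes from `H`. Since `M` is induced as an `H`-module (`exists_sum_groupElem_mul`), `c` can be made
to vanish on `I`, and `M^I = νM` for the norm element `ν` of `H`. Hence `H¹ = νM / (σ - 1)νM`
(`TameAction.exists_surjective_H1`).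

Determinant. After inverting `p`, the element `ν/n` is an idempotent and `H¹` is the cokernel of the
operator equal to `1 - σ` on its component and to `1` on the complement. The determinant is `f = (ν
P(γ⁻¹) + (n - ν))/n`, where `P` is the Frobenius polynomial. The proof stays integral: a square
matrix `A` presents `H¹` up to powers of `n`, and `det_mem_charIdeal` and `pow_mul_mem_span_det`
show that the characteristic ideal of any presentation is then generated by `det A` up to powers of
`n`.

Interpolation. `ν e_ψ` is `n e_ψ` or `0` according to whether `ψ` is trivial on inertia, so `f` has
the defining property of the local factor. Uniqueness follows from `∑ e_ψ = 1`. -/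

noncomputable section

namespace IwasawaLocal

section

open NumberField IsDedekindDomain

/-! ### The absolute value on an algebraic closure of `k_q`. -/

section AbsVal
variable {k : Type*} [Field k] [NumberField k] (q : HeightOneSpectrum (𝓞 k))

/-- The norm of `k_q`, with a proof that it is nontrivial. -/
@[reducible] def completionNontriviallyNormedField :
    NontriviallyNormedField (q.adicCompletion k) :=
  NontriviallyNormedField.ofNormNeOne (by
    obtain ⟨x, hx, h0⟩ := Submodule.exists_mem_ne_zero_of_ne_bot q.ne_bot
    refine ⟨FinitePlace.embedding q (algebraMap (𝓞 k) k x), ?_, ?_⟩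
    · simpa using h0
    · exact ((FinitePlace.norm_lt_one_iff_mem k q x).2 hx).ne)

/-- The absolute value on an algebraic closure of the completion `k_q`. -/
def locAbs : AbsoluteValue (AlgebraicClosure (q.adicCompletion k)) ℝ :=
  letI := completionNontriviallyNormedField q
  { toFun := spectralMulAlgNorm (q.adicCompletion k) (AlgebraicClosure (q.adicCompletion k))
    map_mul' := map_mul _
    nonneg' := fun _ => apply_nonneg _ _
    eq_zero' := fun _ => map_eq_zero_iff_eq_zero _
    add_le' := fun _ _ => map_add_le_add _ _ _ }

lemma locAbs_apply (x) : locAbs q x = spectralNorm (q.adicCompletion k) _ x := rfl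

lemma locAbs_algebraMap (x : q.adicCompletion k) : locAbs q (algebraMap _ _ x) = ‖x‖ := by
  rw [locAbs_apply, spectralNorm_extends]

lemma locAbs_isNonarchimedean : IsNonarchimedean (locAbs q) := by
  have : IsUltrametricDist (q.adicCompletion k) := inferInstance
  exact isNonarchimedean_spectralNorm

lemma locAbs_algEquiv (σ : Gal(AlgebraicClosure (q.adicCompletion k)/q.adicCompletion k)) (x) :
    locAbs q (σ x) = locAbs q x := (spectralNorm_eq_of_equiv σ x).symm

lemma locAbs_le_one_of_aeval_eq_zero {f : (q.adicCompletion k)[X]} (hf : f.Monic)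
    (h : ∀ n, ‖f.coeff n‖ ≤ 1) {x : AlgebraicClosure (q.adicCompletion k)}
    (hx : Polynomial.aeval x f = 0) : locAbs q x ≤ 1 := by
  have : IsUltrametricDist (q.adicCompletion k) := inferInstance
  let _ := completionNontriviallyNormedField q
  exact (norm_root_le_spectralValue (f := spectralAlgNorm (q.adicCompletion k)
    (AlgebraicClosure (q.adicCompletion k))) spectralAlgNorm_isPowMul
    isNonarchimedean_spectralNorm hf hx).trans ((spectralValue_le_one_iff hf).2 h)

lemma norm_coeff_minpoly_le_one {x : AlgebraicClosure (q.adicCompletion k)}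
    (hx : locAbs q x ≤ 1) (n : ℕ) : ‖(minpoly (q.adicCompletion k) x).coeff n‖ ≤ 1 :=
  (spectralValue_le_one_iff (minpoly.monic (Algebra.IsIntegral.isIntegral x))).1 hx n

lemma norm_algebraMap_le_one (x : 𝓞 k) :
    ‖algebraMap k (q.adicCompletion k) (x : k)‖ ≤ 1 := FinitePlace.norm_le_one k q x

lemma norm_algebraMap_lt_one_iff (x : 𝓞 k) :
    ‖algebraMap k (q.adicCompletion k) (x : k)‖ < 1 ↔ x ∈ q.asIdeal :=
  FinitePlace.norm_lt_one_iff_mem k q x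

lemma exists_norm_sub_lt (y : q.adicCompletion k) {ε : ℝ} (hε : 0 < ε) :
    ∃ x : k, ‖y - algebraMap k (q.adicCompletion k) x‖ < ε := by
  have := (HeightOneSpectrum.denseRange_algebraMap k q) y
  obtain ⟨x, ⟨z, rfl⟩, hx⟩ := Metric.mem_closure_iff.1 this ε hε
  exact ⟨z, by rwa [dist_eq_norm] at hx⟩

lemma norm_sub_lt_of_ultrametric {E : Type*} [SeminormedAddCommGroup E] [IsUltrametricDist E]
    {x y z : E} {ε : ℝ} (h₁ : ‖x - y‖ < ε) (h₂ : ‖y - z‖ < ε) : ‖x - z‖ < ε := by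
  have := IsUltrametricDist.norm_add_le_max (x - y) (y - z)
  rw [sub_add_sub_cancel] at this
  exact this.trans_lt (max_lt h₁ h₂)

lemma norm_algebraMap_completion (x : k) : ‖algebraMap k (q.adicCompletion k) x‖ =
    WithZeroMulInt.toNNReal (NumberField.HeightOneSpectrum.absNorm_ne_zero q)
      (q.valuation k x) := FinitePlace.norm_embedding' q x

/-- Surjectivity of `𝓞 k` onto the residue field of `k_q`: approximate by `k` using density, then
use that an element of `k` integral at `q` is congruent to a global integer. -/
lemma exists_norm_sub_lt_one (y : q.adicCompletion k) (hy : ‖y‖ ≤ 1) :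
    ∃ x : 𝓞 k, ‖y - algebraMap k (q.adicCompletion k) x‖ < 1 := by
  have he := NumberField.HeightOneSpectrum.one_lt_absNorm_nnreal q
  obtain ⟨x, hx⟩ := exists_norm_sub_lt q y one_pos
  have hx1 : ‖algebraMap k (q.adicCompletion k) x‖ ≤ 1 := by
    have h := IsUltrametricDist.norm_add_le_max y (-(y - algebraMap k (q.adicCompletion k) x))
    rw [neg_sub, add_sub_cancel, ← norm_neg (_ - y), neg_sub] at h
    exact h.trans (max_le hy hx.le)
  have hv : q.valuation k x ≤ 1 := by
    rw [norm_algebraMap_completion] at hx1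
    exact (WithZeroMulInt.toNNReal_le_one_iff he).1 (mod_cast hx1)
  obtain ⟨z, hz⟩ := q.exists_valuation_sub_lt_of_integer hv (γ := 1)
  refine ⟨z, norm_sub_lt_of_ultrametric hx ?_⟩
  rw [← map_sub, ← norm_neg, ← map_neg, neg_sub, norm_algebraMap_completion]
  exact_mod_cast (WithZeroMulInt.toNNReal_lt_one_iff he).2 hz
end AbsVal

/-! ### Embeddings of `k̄` into `k̄_q`: the induced prime and its residue field. -/

section Approximation

/-- A root of a monic polynomial over a nonarchimedean field is congruent to a root of any monic
polynomial with congruent coefficients. -/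
lemma exists_root_near_root {A C E : Type*} [CommRing A] [Nontrivial A] [Field C] [IsAlgClosed C]
    [Field E] {v : AbsoluteValue E ℝ} (hv : IsNonarchimedean v) {i : A →+* E} {ι : A →+* C}
    {j : C →+* E} (hj : ∀ a, j (ι a) = i a) {m : E[X]} (hm : m.Monic) {x : E}
    (h0 : m.eval x = 0) (ha : ∀ n, ∃ a, v (m.coeff n - i a) < 1) (hx : v x ≤ 1) :
    ∃ f : A[X], f.Monic ∧ ∃ y : C, f.eval₂ ι y = 0 ∧ v (x - j y) < 1 := by
  choose a ha using ha
  set n := m.natDegree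
  let f : A[X] := Polynomial.X ^ n + ∑ i : Fin n, Polynomial.C (a i) * Polynomial.X ^ (i : ℕ)
  have hf : f.Monic := Polynomial.monic_X_pow_add (Polynomial.degree_sum_fin_lt _)
  -- As `m(x) = 0` and the leading terms cancel, `f(x)` is the sum of the coefficient errors times
  -- powers of `x`.
  have hfx : v (f.eval₂ i x) < 1 := by
    have hm' : m = Polynomial.X ^ n + ∑ i : Fin n, Polynomial.C (m.coeff i) *
        Polynomial.X ^ (i : ℕ) := by
      rw [Fin.sum_univ_eq_sum_range (fun i => Polynomial.C (m.coeff i) * Polynomial.X ^ i)]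
      exact hm.as_sum
    have h1 : f.eval₂ i x = ∑ l : Fin n, (i (a l) - m.coeff l) * x ^ (l : ℕ) := by
      have h2 : m.eval x = x ^ n + ∑ l : Fin n, m.coeff l * x ^ (l : ℕ) := by
        conv_lhs => rw [hm']
        simp [Polynomial.eval_finsetSum]
      rw [← sub_zero (f.eval₂ _ _), ← h0, h2]
      simp only [f, Polynomial.eval₂_add, Polynomial.eval₂_finsetSum, Polynomial.eval₂_mul,
        Polynomial.eval₂_C, Polynomial.eval₂_X_pow, add_sub_add_left_eq_sub,
        ← Finset.sum_sub_distrib, ← sub_mul]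
    rw [h1]
    refine Finset.sum_induction _ (fun z => v z < 1)
      (fun _ _ h h' => (hv _ _).trans_lt (max_lt h h')) (by simp) fun l _ => ?_
    rw [map_mul, map_pow, ← map_neg_eq_map v (_ - _), neg_sub]
    exact mul_lt_one_of_nonneg_of_lt_one_left (v.nonneg _) (ha l) (pow_le_one₀ (v.nonneg _) hx)
  have hprod := (IsAlgClosed.splits (f.map ι)).eq_prod_roots_of_monic (hf.map _)
  have hev : f.eval₂ i x = ((f.map ι).roots.map fun y => x - j y).prod := by
    have h2 : f.eval₂ i x = (f.map ι).eval₂ j x := by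
      rw [Polynomial.eval₂_map]
      congr 1
      ext y
      exact (hj y).symm
    rw [h2]
    conv_lhs => rw [hprod]
    rw [Polynomial.eval₂_multiset_prod, Multiset.map_map]
    simp
  -- `f(x)` is the product of the `x - j y` over the roots `y`, so the factors cannot all have
  -- absolute value at least 1.
  have key : ∃ y ∈ (f.map ι).roots, v (x - j y) < 1 := by
    by_contra! hc
    rw [hev] at hfx
    refine hfx.not_ge ?_
    rw [map_multiset_prod, Multiset.map_map]
    refine Multiset.prod_induction (fun z : ℝ => 1 ≤ z) _
      (fun _ _ => one_le_mul_of_one_le_of_one_le) le_rfl fun z hz => ?_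
    obtain ⟨y, hy, rfl⟩ := Multiset.mem_map.1 hz
    exact hc y hy
  obtain ⟨y, hy, hlt⟩ := key
  refine ⟨f, hf, y, ?_, hlt⟩
  rw [← Polynomial.eval_map]
  exact (Polynomial.mem_roots'.1 hy).2

end Approximation

section Embedding

variable {k : Type*} [Field k] [NumberField k] (q : HeightOneSpectrum (𝓞 k))
  (j : AlgebraicClosure k →ₐ[k] AlgebraicClosure (q.adicCompletion k))

lemma locAbs_algebraMap_base (x : k) :
    locAbs q (algebraMap k _ x) = ‖algebraMap k (q.adicCompletion k) x‖ := by
  rw [IsScalarTower.algebraMap_apply k (q.adicCompletion k), locAbs_algebraMap]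

lemma locAbs_le_one_of_isIntegral {x : AlgebraicClosure (q.adicCompletion k)}
    (hx : IsIntegral (𝓞 k) x) : locAbs q x ≤ 1 := by
  obtain ⟨f, hf, h0⟩ := hx
  refine locAbs_le_one_of_aeval_eq_zero q (f := f.map (algebraMap (𝓞 k) (q.adicCompletion k)))
    (hf.map _) (fun n => ?_) ?_
  · rw [Polynomial.coeff_map]
    exact norm_algebraMap_le_one q _
  · rwa [Polynomial.aeval_def, Polynomial.eval₂_map]

lemma locAbs_embedding_le_one (x : 𝓞 (AlgebraicClosure k)) :
    locAbs q (j (x : AlgebraicClosure k)) ≤ 1 := by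
  have h : IsIntegral ℤ (j (x : AlgebraicClosure k)) :=
    (RingOfIntegers.isIntegral_coe x).map (j.restrictScalars ℤ)
  exact locAbs_le_one_of_isIntegral q h.tower_top

lemma locAbs_add_lt_one {x y : AlgebraicClosure (q.adicCompletion k)} (hx : locAbs q x < 1)
    (hy : locAbs q y < 1) : locAbs q (x + y) < 1 :=
  (locAbs_isNonarchimedean q x y).trans_lt (max_lt hx hy)

/-- The prime of `k̄` determined by an embedding `k̄ → k̄_q`. -/
def primeOfEmbedding : Ideal (𝓞 (AlgebraicClosure k)) where
  carrier := {x | locAbs q (j (x : AlgebraicClosure k)) < 1}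
  zero_mem' := by simp
  add_mem' {x y} hx hy := by
    simpa using locAbs_add_lt_one q hx hy
  smul_mem' c x hx := by
    have hx' : locAbs q (j (x : AlgebraicClosure k)) < 1 := hx
    have := mul_lt_one_of_nonneg_of_lt_one_right (locAbs_embedding_le_one q j c)
      ((locAbs q).nonneg _) hx'
    simpa using this

lemma mem_primeOfEmbedding {x : 𝓞 (AlgebraicClosure k)} :
    x ∈ primeOfEmbedding q j ↔ locAbs q (j (x : AlgebraicClosure k)) < 1 := Iff.rfl

lemma locAbs_eq_one_of_notMem {x : 𝓞 (AlgebraicClosure k)} (hx : x ∉ primeOfEmbedding q j) :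
    locAbs q (j (x : AlgebraicClosure k)) = 1 :=
  (locAbs_embedding_le_one q j x).antisymm (not_lt.1 hx)

lemma primeOfEmbedding_mem : primeOfEmbedding q j ∈ PrimesAbove q := by
  refine ⟨⟨?_, fun {x y} h => ?_⟩, ?_⟩
  · rw [Ideal.ne_top_iff_one, mem_primeOfEmbedding]
    simp
  · by_contra! hxy
    rw [mem_primeOfEmbedding] at h
    simp [locAbs_eq_one_of_notMem q j hxy.1, locAbs_eq_one_of_notMem q j hxy.2] at h
  · ext x
    rw [Ideal.mem_comap, mem_primeOfEmbedding, ← norm_algebraMap_lt_one_iff,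
      ← locAbs_algebraMap_base, ← j.commutes]
    rfl

/-- The residue field of `k̄_q` is the residue field of the prime of `k̄` below it. -/
lemma exists_locAbs_sub_lt_one {x : AlgebraicClosure (q.adicCompletion k)}
    (hx : locAbs q x ≤ 1) :
    ∃ y : 𝓞 (AlgebraicClosure k), locAbs q (x - j (y : AlgebraicClosure k)) < 1 := by
  have hm := minpoly.monic (Algebra.IsIntegral.isIntegral (R := q.adicCompletion k) x)
  obtain ⟨f, hf, y, hy, hlt⟩ := exists_root_near_root (locAbs_isNonarchimedean q)
    (i := algebraMap (𝓞 k) _) (ι := algebraMap (𝓞 k) (AlgebraicClosure k))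
    (j := (j : AlgebraicClosure k →+* _)) (fun y => j.commutes (y : k)) (hm.map (algebraMap _ _))
    (by rw [Polynomial.eval_map]; exact minpoly.aeval _ x)
    (fun n => by
      obtain ⟨a, ha⟩ := exists_norm_sub_lt_one q _ (norm_coeff_minpoly_le_one q hx n)
      refine ⟨a, ?_⟩
      rw [← locAbs_algebraMap, map_sub, ← IsScalarTower.algebraMap_apply] at ha
      rwa [Polynomial.coeff_map]) hx
  have hyint : IsIntegral ℤ y := isIntegral_trans (R := ℤ) (A := 𝓞 k) y ⟨f, hf, hy⟩
  exact ⟨⟨y, hyint⟩, hlt⟩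

end Embedding

end

/-! ### The decomposition group as the image of the local Galois group. -/

section

open NumberField IsDedekindDomain
open scoped Pointwise

/-- Fixing a finite subextension amounts to fixing a basis, so the Krull topology can be tested on
finitely many elements. -/
lemma exists_finset_of_mem_nhds_one {K L : Type*} [Field K] [Field L] [Algebra K L]
    {s : Set Gal(L/K)} (hs : s ∈ nhds 1) :
    ∃ t : Finset L, ∀ g : Gal(L/K), (∀ x ∈ t, g x = x) → g ∈ s := by
  classical
  obtain ⟨E, hE, hEs⟩ := (krullTopology_mem_nhds_one_iff K L s).1 hs
  let b := Module.finBasis K E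
  refine ⟨Finset.univ.image fun i => (b i : L), fun g hg => hEs ?_⟩
  rw [SetLike.mem_coe, IntermediateField.mem_fixingSubgroup_iff]
  have h : (g.toLinearMap.comp E.val.toLinearMap) = E.val.toLinearMap :=
    b.ext fun i => hg _ (Finset.mem_image_of_mem _ (Finset.mem_univ i))
  exact fun x hx => DFunLike.congr_fun h ⟨x, hx⟩

section Embedding

variable {k : Type*} [Field k] [NumberField k] (q : HeightOneSpectrum (𝓞 k))
  (j : AlgebraicClosure k →ₐ[k] AlgebraicClosure (q.adicCompletion k))

/-- Induction on the degree. The product `a` of `x` with the leading coefficient is integral. If the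
leading coefficient lies outside the prime, this is the quotient sought. Otherwise `a` lies in the
prime too, and replacing the leading term by `a X^n` lowers the degree, keeps `x` as a root and
keeps some coefficient outside the prime. -/
lemma exists_integral_quotient_aux (n : ℕ) : ∀ (f : (𝓞 (AlgebraicClosure k))[X]),
    f.natDegree ≤ n → (∃ i, f.coeff i ∉ primeOfEmbedding q j) → ∀ x : AlgebraicClosure k,
    Polynomial.aeval x f = 0 → locAbs q (j x) ≤ 1 →
    ∃ a b : 𝓞 (AlgebraicClosure k), b ∉ primeOfEmbedding q j ∧ (b : AlgebraicClosure k) * x = a := by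
  have hprime := (primeOfEmbedding_mem q j).1
  induction n with
  | zero =>
    intro f hf ⟨i, hi⟩ x hx _
    exfalso
    rw [Polynomial.eq_C_of_natDegree_le_zero hf] at hi hx
    rw [Polynomial.aeval_C, map_eq_zero_iff _ (FaithfulSMul.algebraMap_injective _ _)] at hx
    rw [hx] at hi
    simp at hi
  | succ n ih =>
    intro f hf ⟨i, hi⟩ x hx hv
    rcases hf.lt_or_eq with hlt | heq
    · exact ih f (by omega) ⟨i, hi⟩ x hx hv
    have hint : IsIntegral (𝓞 (AlgebraicClosure k)) (f.leadingCoeff • x) :=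
      isIntegral_leadingCoeff_smul f x hx
    obtain ⟨a, ha⟩ : ∃ a : 𝓞 (AlgebraicClosure k),
        (f.leadingCoeff : AlgebraicClosure k) * x = a := by
      have : IsIntegral ℤ (f.leadingCoeff • x) := isIntegral_trans _ hint
      exact ⟨⟨_, this⟩, Algebra.smul_def f.leadingCoeff x ▸ rfl⟩
    by_cases hl : f.leadingCoeff ∈ primeOfEmbedding q j
    swap
    · exact ⟨a, f.leadingCoeff, hl, ha⟩
    have haQ : a ∈ primeOfEmbedding q j := by
      rw [mem_primeOfEmbedding, ← ha, map_mul, map_mul]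
      exact mul_lt_one_of_nonneg_of_lt_one_left ((locAbs q).nonneg _) hl hv
    refine ih (f.eraseLead + Polynomial.monomial n a) ?_ ⟨i, ?_⟩ x ?_ hv
    · refine (Polynomial.natDegree_add_le _ _).trans (max_le ?_ (Polynomial.natDegree_monomial_le _))
      have := f.eraseLead_natDegree_le
      omega
    · have hne : i ≠ f.natDegree := by
        rintro rfl
        exact hi hl
      rw [Polynomial.coeff_add, Polynomial.eraseLead_coeff_of_ne _ hne, Polynomial.coeff_monomial]
      split_ifs
      · rwa [Ideal.add_mem_iff_left _ haQ]
      · rwa [add_zero]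
    · have h1 := f.eraseLead_add_monomial_natDegree_leadingCoeff
      rw [← h1, map_add, Polynomial.aeval_monomial, heq, pow_succ'] at hx
      rw [map_add, Polynomial.aeval_monomial, ← hx]
      congr 1
      rw [← mul_assoc]
      congr 1
      exact ha.symm

/-- The valuation ring of `k̄` determined by `j` is the localization of the integers. -/
lemma exists_integral_quotient {x : AlgebraicClosure k} (hx : locAbs q (j x) ≤ 1) :
    ∃ a b : 𝓞 (AlgebraicClosure k), b ∉ primeOfEmbedding q j ∧
      (b : AlgebraicClosure k) * x = a := by
  have hprime := (primeOfEmbedding_mem q j).1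
  have halg : IsAlgebraic ℤ x := by
    have : Algebra.IsAlgebraic ℚ (AlgebraicClosure k) := Algebra.IsAlgebraic.trans ℚ k _
    have h1 : IsAlgebraic ℚ x := Algebra.IsAlgebraic.isAlgebraic x
    exact (IsFractionRing.isAlgebraic_iff ℤ ℚ _).2 h1
  obtain ⟨f, hf0, hf⟩ := halg
  have hf' : Polynomial.aeval x f.primPart = 0 := Polynomial.aeval_primPart_eq_zero hf0 hf
  refine exists_integral_quotient_aux q j _ (f.primPart.map (algebraMap ℤ _)) le_rfl ?_ x
    (by rwa [Polynomial.aeval_map_algebraMap]) hx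
  -- A primitive polynomial over `ℤ` has coefficients generating the unit ideal, so they cannot all
  -- lie in the prime.
  by_contra! hc
  refine hprime.ne_top ?_
  have hle : f.primPart.contentIdeal ≤ (primeOfEmbedding q j).comap (algebraMap ℤ _) := by
    refine Ideal.span_le.2 fun c hc' => ?_
    obtain ⟨n, _, rfl⟩ := Polynomial.mem_coeffs_iff.1 hc'
    have := hc n
    rwa [Polynomial.coeff_map] at this
  have htop : f.primPart.contentIdeal = ⊤ :=
    (Submodule.IsPrincipal.isPrimitive_iff_contentIdeal_eq_top
      (IsPrincipalIdealRing.principal _)).1 f.isPrimitive_primPart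
  rw [htop, top_le_iff, Ideal.comap_eq_top_iff] at hle
  exact hle

/-- The valuation ring is the localization of the integers at the prime, so whatever stabilizes the
prime preserves the valuation ring. -/
lemma locAbs_apply_le_one_of_mem_stabilizer {g : Gal(AlgebraicClosure k/k)}
    (hg : g ∈ MulAction.stabilizer Gal(AlgebraicClosure k/k) (primeOfEmbedding q j))
    {x : AlgebraicClosure k} (hx : locAbs q (j x) ≤ 1) : locAbs q (j (g x)) ≤ 1 := by
  obtain ⟨a, b, hb, hab⟩ := exists_integral_quotient q j hx
  have hgb : g • b ∉ primeOfEmbedding q j := by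
    have h : g • primeOfEmbedding q j = primeOfEmbedding q j := hg
    rw [← h]
    rwa [Ideal.smul_mem_pointwise_smul_iff]
  have h1 := locAbs_eq_one_of_notMem q j hgb
  have h2 := locAbs_embedding_le_one q j (g • a)
  have h3 : ((g • b : 𝓞 (AlgebraicClosure k)) : AlgebraicClosure k) * g x =
      (g • a : 𝓞 (AlgebraicClosure k)) := by
    have : g ((b : AlgebraicClosure k) * x) = g a := by rw [hab]
    rwa [map_mul] at this
  rw [← h3, map_mul, map_mul, h1, one_mul] at h2
  exact h2

/-- This is `q`-adic continuity of `g`. Approximate `x` by `z ∈ k` to within `r^m`, where `r = |ϖ|`.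
Then `(x - z)/ϖ^m` is in the valuation ring, which `g` preserves, and `g` fixes `ϖ` and `z`. So `|g
x - x| ≤ r^m` for every `m`. -/
lemma apply_eq_self_of_mem_stabilizer {g : Gal(AlgebraicClosure k/k)}
    (hg : g ∈ MulAction.stabilizer Gal(AlgebraicClosure k/k) (primeOfEmbedding q j))
    {x : AlgebraicClosure k} (hx : j x ∈ Set.range (algebraMap (q.adicCompletion k) _)) :
    g x = x := by
  obtain ⟨y, hy⟩ := hx
  obtain ⟨ϖ, hϖ, hϖ0⟩ := Submodule.exists_mem_ne_zero_of_ne_bot q.ne_bot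
  set r := ‖algebraMap k (q.adicCompletion k) ϖ‖ with hr
  have hr1 : r < 1 := (norm_algebraMap_lt_one_iff q ϖ).2 hϖ
  have hr0 : 0 < r := by simpa [hr] using hϖ0
  have key (m : ℕ) : locAbs q (j (g x) - j x) ≤ r ^ m := by
    obtain ⟨z, hz⟩ := exists_norm_sub_lt q y (pow_pos hr0 m)
    have h1 : locAbs q (j (x - algebraMap k _ z)) < r ^ m := by
      rwa [map_sub, ← hy, j.commutes, IsScalarTower.algebraMap_apply k (q.adicCompletion k),
        ← map_sub, locAbs_algebraMap]
    have hϖm : locAbs q (j (algebraMap k _ ((ϖ : k) ^ m))) = r ^ m := by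
      rw [j.commutes, map_pow, map_pow, locAbs_algebraMap_base]
    have hne : algebraMap k (AlgebraicClosure k) ((ϖ : k) ^ m) ≠ 0 := by simpa using fun h => absurd h hϖ0
    have h2 : locAbs q (j (g (x - algebraMap k _ z))) ≤ r ^ m := by
      have := locAbs_apply_le_one_of_mem_stabilizer q j hg
        (x := (x - algebraMap k _ z) / algebraMap k _ ((ϖ : k) ^ m)) (by
          rw [map_div₀, map_div₀, hϖm]
          exact div_le_one_of_le₀ h1.le (by positivity))
      rw [map_div₀, map_div₀, map_div₀, g.commutes, hϖm] at this
      exact (div_le_one (by positivity)).1 this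
    have h3 : j (g x) - j x = j (g (x - algebraMap k _ z)) + -j (x - algebraMap k _ z) := by
      simp only [map_sub, AlgEquiv.commutes]
      ring
    rw [h3]
    refine (locAbs_isNonarchimedean q _ _).trans (max_le h2 ?_)
    rw [map_neg_eq_map]
    exact h1.le
  have h0 : locAbs q (j (g x) - j x) ≤ 0 :=
    ge_of_tendsto' (tendsto_pow_atTop_nhds_zero_of_lt_one hr0.le hr1) key
  have h0' := (locAbs q).eq_zero.1 (h0.antisymm ((locAbs q).nonneg _))
  exact j.injective (sub_eq_zero.1 h0')

instance charZero_adicCompletion : CharZero (q.adicCompletion k) :=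
  charZero_of_injective_algebraMap (algebraMap k (q.adicCompletion k)).injective

lemma continuous_resLocal : Continuous (resLocal j) := by
  refine continuous_of_continuousAt_one _ ?_
  rw [ContinuousAt, map_one, Filter.tendsto_def]
  intro s hs
  obtain ⟨t, ht⟩ := exists_finset_of_mem_nhds_one hs
  have hopen : IsOpen (⋂ x ∈ t, {σ : Gal(AlgebraicClosure (q.adicCompletion k)/q.adicCompletion k) |
      σ (j x) = j x}) :=
    isOpen_biInter_finset fun x _ => stabilizer_isOpen_of_isIntegral (j x)
  refine Filter.mem_of_superset (hopen.mem_nhds ?_) fun σ hσ => ht _ fun x hx => ?_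
  · simp
  · refine j.injective ((apply_resLocal j σ x).trans ?_)
    exact Set.mem_iInter₂.1 hσ x hx

/-- The local Galois group surjects onto the decomposition group. -/
lemma exists_resLocal_eq {g : Gal(AlgebraicClosure k/k)}
    (hg : g ∈ MulAction.stabilizer Gal(AlgebraicClosure k/k) (primeOfEmbedding q j)) :
    ∃ σ, resLocal j σ = g := by
  -- The image is compact, hence closed, so it contains every element fixing its fixed field. That
  -- field is carried by `j` into `k_q`, and the stabilizer fixes it by
  -- `apply_eq_self_of_mem_stabilizer`.
  let H : ClosedSubgroup Gal(AlgebraicClosure k/k) :=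
    { (resLocal j).range with
      isClosed' := by
        have := (isCompact_range (continuous_resLocal q j)).isClosed
        exact this }
  have h1 := InfiniteGalois.fixingSubgroup_fixedField H
  have h2 : g ∈ (IntermediateField.fixedField H.1).fixingSubgroup := by
    rw [IntermediateField.mem_fixingSubgroup_iff]
    intro x hx
    refine apply_eq_self_of_mem_stabilizer q j hg ?_
    rw [InfiniteGalois.mem_range_algebraMap_iff_fixed]
    intro σ
    rw [← apply_resLocal]
    congr 1
    exact (IntermediateField.mem_fixedField_iff _ _).1 hx _ ⟨σ, rfl⟩
  rw [h1] at h2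
  exact h2

lemma resLocal_mem_stabilizer (σ) : resLocal j σ ∈
    MulAction.stabilizer Gal(AlgebraicClosure k/k) (primeOfEmbedding q j) := by
  rw [MulAction.mem_stabilizer_iff]
  ext x
  rw [Ideal.mem_pointwise_smul_iff_inv_smul_mem, mem_primeOfEmbedding, mem_primeOfEmbedding,
    ← map_inv]
  change locAbs q (j (resLocal j σ⁻¹ (x : AlgebraicClosure k))) < 1 ↔ _
  rw [apply_resLocal, locAbs_algEquiv]

end Embedding

/-! ### Wild elements and the tame relation. -/

section Tame

variable {k : Type*} [Field k] [NumberField k] (q : HeightOneSpectrum (𝓞 k))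
  (j : AlgebraicClosure k →ₐ[k] AlgebraicClosure (q.adicCompletion k))

/-- The inertia subgroup of `G_{k_q}`. -/
def localInertia : Subgroup Gal(AlgebraicClosure (q.adicCompletion k)/q.adicCompletion k) :=
  (inertiaAt (primeOfEmbedding q j)).comap (resLocal j)

variable {q j}

lemma mem_localInertia {σ} :
    σ ∈ localInertia q j ↔ resLocal j σ ∈ inertiaAt (primeOfEmbedding q j) := Iff.rfl

/-- Inertia is defined by its action on the integers of `k̄`. It controls `k̄_q` because every
integral element there is congruent to an integer of `k̄`. -/
lemma locAbs_sub_lt_one_of_mem_localInertia {σ} (hσ : σ ∈ localInertia q j)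
    {x : AlgebraicClosure (q.adicCompletion k)} (hx : locAbs q x ≤ 1) :
    locAbs q (σ x - x) < 1 := by
  obtain ⟨y, hy⟩ := exists_locAbs_sub_lt_one q j hx
  have h1 : locAbs q (σ (j y) - j y) < 1 := by
    have : locAbs q (j (resLocal j σ (y : AlgebraicClosure k) - y)) < 1 := hσ y
    rwa [map_sub, apply_resLocal] at this
  have h2 : σ x - x = σ (x - j y) + ((σ (j y) - j y) + -(x - j y)) := by
    rw [map_sub]; ring
  rw [h2]
  refine locAbs_add_lt_one q (by rwa [locAbs_algEquiv]) (locAbs_add_lt_one q h1 ?_)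
  rwa [map_neg_eq_map]

lemma locAbs_pow_sub_pow_lt_one {x y : AlgebraicClosure (q.adicCompletion k)}
    (hx : locAbs q x ≤ 1) (hy : locAbs q y ≤ 1) (h : locAbs q (x - y) < 1) (n : ℕ) :
    locAbs q (x ^ n - y ^ n) < 1 := by
  induction n with
  | zero => simp
  | succ n ih =>
    have h2 : x ^ (n + 1) - y ^ (n + 1) = x * (x ^ n - y ^ n) + (x - y) * y ^ n := by ring
    rw [h2]
    refine locAbs_add_lt_one q ?_ ?_
    · rw [map_mul]
      exact mul_lt_one_of_nonneg_of_lt_one_right hx ((locAbs q).nonneg _) ih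
    · rw [map_mul, map_pow]
      exact mul_lt_one_of_nonneg_of_lt_one_left ((locAbs q).nonneg _) h
        (pow_le_one₀ ((locAbs q).nonneg _) hy)

lemma locAbs_sub_pow_lt_one_of_isFrobenius {σ}
    (hσ : IsFrobenius (primeOfEmbedding q j) (resLocal j σ))
    {x : AlgebraicClosure (q.adicCompletion k)} (hx : locAbs q x ≤ 1) :
    locAbs q (σ x - x ^ Nat.card (𝓞 k ⧸ q.asIdeal)) < 1 := by
  obtain ⟨y, hy⟩ := exists_locAbs_sub_lt_one q j hx
  set N := Nat.card (𝓞 k ⧸ q.asIdeal) with hN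
  have h1 : locAbs q (σ (j y) - j y ^ N) < 1 := by
    have : locAbs q (j (resLocal j σ (y : AlgebraicClosure k) -
        (y : AlgebraicClosure k) ^ Nat.card (𝓞 k ⧸ (primeOfEmbedding q j).under (𝓞 k)))) < 1 := hσ y
    rwa [(primeOfEmbedding_mem q j).2, ← hN, map_sub, map_pow, apply_resLocal] at this
  have h2 : σ x - x ^ N = σ (x - j y) + ((σ (j y) - j y ^ N) + -(x ^ N - j y ^ N)) := by
    rw [map_sub]; ring
  rw [h2]
  refine locAbs_add_lt_one q (by rwa [locAbs_algEquiv]) (locAbs_add_lt_one q h1 ?_)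
  rw [map_neg_eq_map]
  exact locAbs_pow_sub_pow_lt_one hx (locAbs_embedding_le_one q j y) hy N

variable (q) in
/-- An element of `G_{k_q}` is wild if it acts trivially on all graded pieces of `k̄_q`. -/
def IsWild (w : Gal(AlgebraicClosure (q.adicCompletion k)/q.adicCompletion k)) : Prop :=
  ∀ x, x ≠ 0 → locAbs q (w x - x) < locAbs q x

lemma IsWild.pow {w} (hw : IsWild q w) (n : ℕ) : IsWild q (w ^ n) := by
  intro x hx
  induction n with
  | zero => simpa using hx
  | succ n ih =>
    have h1 : (w ^ (n + 1)) x - x = (w ^ n) (w x - x) + ((w ^ n) x - x) := by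
      rw [pow_succ, AlgEquiv.mul_apply, map_sub]; ring
    rw [h1]
    refine (locAbs_isNonarchimedean q _ _).trans_lt (max_lt ?_ ih)
    rw [locAbs_algEquiv]
    exact hw x hx

/-- Averaging argument. The orbit sum `S` is fixed by `w`, and `z = n x - S` has orbit sum zero. So
`n z = ∑ (z - w^i z)`, whose terms are all smaller than `z` unless `z = 0`; but `|n z| = |z|`. Hence
`n x = S` is fixed. -/
lemma IsWild.apply_eq_self {w} (hw : IsWild q w) {n : ℕ}
    (hn : locAbs q (n : AlgebraicClosure (q.adicCompletion k)) = 1) {x} (hx : (w ^ n) x = x) :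
    w x = x := by
  have hn0 : (n : AlgebraicClosure (q.adicCompletion k)) ≠ 0 := by
    intro h
    rw [h, map_zero] at hn
    exact zero_ne_one hn
  set S := ∑ i ∈ Finset.range n, (w ^ i) x with hS
  have hwS : w S = S := by
    have h1 : w S + x = S + (w ^ n) x := by
      rw [hS, ← Finset.sum_range_succ, Finset.sum_range_succ', map_sum]
      simp [pow_succ', AlgEquiv.mul_apply]
    rw [hx] at h1
    exact add_right_cancel h1
  have hwS' (i : ℕ) : (w ^ i) S = S := by
    induction i with
    | zero => simp
    | succ i ih => rw [pow_succ, AlgEquiv.mul_apply, hwS, ih]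
  have hz : (n : AlgebraicClosure (q.adicCompletion k)) * x - S = 0 := by
    by_contra hz
    set z := (n : AlgebraicClosure (q.adicCompletion k)) * x - S
    have h2 : ∑ i ∈ Finset.range n, (w ^ i) z = 0 := by
      simp only [z, map_sub, map_mul, map_natCast, hwS', Finset.sum_sub_distrib, ← Finset.mul_sum,
        ← hS, Finset.sum_const, Finset.card_range, nsmul_eq_mul, sub_self]
    have h3 : (n : AlgebraicClosure (q.adicCompletion k)) * z =
        ∑ i ∈ Finset.range n, (z - (w ^ i) z) := by
      rw [Finset.sum_sub_distrib, h2, Finset.sum_const, Finset.card_range, nsmul_eq_mul, sub_zero]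
    have h4 : locAbs q (∑ i ∈ Finset.range n, (z - (w ^ i) z)) < locAbs q z := by
      refine Finset.sum_induction _ (fun y => locAbs q y < locAbs q z)
        (fun _ _ h h' => (locAbs_isNonarchimedean q _ _).trans_lt (max_lt h h'))
        (by simpa using hz) fun i _ => ?_
      rw [← map_neg_eq_map, neg_sub]
      exact hw.pow i z hz
    rw [← h3, map_mul, hn, one_mul] at h4
    exact lt_irrefl _ h4
  have h5 : (n : AlgebraicClosure (q.adicCompletion k)) * w x = n * x := by
    rw [sub_eq_zero.1 hz, ← hwS, ← sub_eq_zero.1 hz, map_mul, map_natCast]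
  exact mul_left_cancel₀ hn0 h5

lemma locAbs_natCast_eq_one {p : ℕ} (hp : (p : 𝓞 k) ∉ q.asIdeal) :
    locAbs q (p : AlgebraicClosure (q.adicCompletion k)) = 1 := by
  have h1 := locAbs_algebraMap_base q ((p : 𝓞 k) : k)
  have h2 := (norm_algebraMap_le_one q p).antisymm
    (not_lt.1 ((norm_algebraMap_lt_one_iff q (p : 𝓞 k)).not.2 hp))
  rw [h2] at h1
  simpa using h1

lemma exists_pow_apply_eq_self
    (w : Gal(AlgebraicClosure (q.adicCompletion k)/q.adicCompletion k)) (x) : ∃ n, 0 < n ∧ (w ^ n) x = x := by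
  have hopen := stabilizer_isOpen_of_isIntegral (K := q.adicCompletion k) x
  have hfin := Subgroup.quotient_finite_of_isOpen _ hopen
  obtain ⟨n, hn0, _, hn⟩ := Subgroup.exists_pow_mem_of_index_ne_zero
    (H := MulAction.stabilizer _ x) (Subgroup.index_ne_zero_of_finite) w
  exact ⟨n, hn0, hn⟩

lemma pow_apply_eq_self {K L : Type*} [Field K] [Field L] [Algebra K L] {w : Gal(L/K)} {x : L}
    (h : w x = x) (n : ℕ) : (w ^ n) x = x := by
  induction n with
  | zero => simp
  | succ n ih => rw [pow_succ, AlgEquiv.mul_apply, h, ih]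

/-- A substitute for the fact that wild inertia is pro-`ℓ` with `ℓ ≠ p`: the `p`-part of the period
of any `x` drops out by `IsWild.apply_eq_self`, and finitely many `x` determine a neighbourhood of
`1`. -/
lemma IsWild.exists_pow_mem {p : ℕ} (hpp : p.Prime) (hp : (p : 𝓞 k) ∉ q.asIdeal) {w}
    (hw : IsWild q w) {s : Set _} (hs : s ∈ nhds 1) : ∃ m : ℕ, p.Coprime m ∧ w ^ m ∈ s := by
  obtain ⟨t, ht⟩ := exists_finset_of_mem_nhds_one hs
  have h1 (x) : ∃ m : ℕ, p.Coprime m ∧ (w ^ m) x = x := by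
    obtain ⟨n, hn0, hn⟩ := exists_pow_apply_eq_self w x
    obtain ⟨b, m, hm, rfl⟩ := Nat.exists_eq_pow_mul_and_not_dvd hn0.ne' p hpp.ne_one
    refine ⟨m, (Nat.Prime.coprime_iff_not_dvd hpp).2 hm, (hw.pow m).apply_eq_self (n := p ^ b) ?_ ?_⟩
    · rw [Nat.cast_pow, map_pow, locAbs_natCast_eq_one hp, one_pow]
    · rwa [← pow_mul, mul_comm]
  have h2 : ∃ m : ℕ, p.Coprime m ∧ ∀ x ∈ t, (w ^ m) x = x := by
    classical
    clear ht
    induction t using Finset.induction_on with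
    | empty => exact ⟨1, Nat.coprime_one_right p, by simp⟩
    | insert a t _ ih =>
      obtain ⟨m, hm, h⟩ := ih
      obtain ⟨n, hn, h'⟩ := h1 a
      refine ⟨m * n, hm.mul_right hn, fun x hx => ?_⟩
      rcases Finset.mem_insert.1 hx with rfl | hx
      · rw [mul_comm, pow_mul]
        exact pow_apply_eq_self h' m
      · rw [pow_mul]
        exact pow_apply_eq_self (h x hx) n
  obtain ⟨m, hm, h⟩ := h2
  exact ⟨m, hm, ht _ h⟩

/-- The tame relation `σ τ σ⁻¹ ≡ τ^N` between inertia and a Frobenius lift. -/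
lemma isWild_of_mem_localInertia {σ τ} (hσ : IsFrobenius (primeOfEmbedding q j) (resLocal j σ))
    (hτ : τ ∈ localInertia q j) :
    IsWild q (σ * τ * σ⁻¹ * (τ ^ Nat.card (𝓞 k ⧸ q.asIdeal))⁻¹) := by
  set N := Nat.card (𝓞 k ⧸ q.asIdeal) with hN
  have hne {x : AlgebraicClosure (q.adicCompletion k)} (hx : x ≠ 0) : locAbs q x ≠ 0 :=
    (locAbs q).ne_zero hx
  have hu (g : Gal(AlgebraicClosure (q.adicCompletion k)/q.adicCompletion k)) {x}
      (hx : x ≠ 0) : locAbs q (g x / x) = 1 := by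
    rw [map_div₀, locAbs_algEquiv, div_self (hne hx)]
  have hmul {a b a' b' : AlgebraicClosure (q.adicCompletion k)} (h : locAbs q (a - a') < 1)
      (h' : locAbs q (b - b') < 1) (ha' : locAbs q a' ≤ 1) (hb : locAbs q b ≤ 1) :
      locAbs q (a * b - a' * b') < 1 := by
    have : a * b - a' * b' = (a - a') * b + a' * (b - b') := by ring
    rw [this]
    refine locAbs_add_lt_one q ?_ ?_ <;> rw [map_mul]
    · exact mul_lt_one_of_nonneg_of_lt_one_left ((locAbs q).nonneg _) h hb
    · exact mul_lt_one_of_nonneg_of_lt_one_right ha' ((locAbs q).nonneg _) h'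
  -- `x ↦ τ x / x` modulo the maximal ideal only depends on `x` up to units
  have hpow {x} (hx : x ≠ 0) (n : ℕ) : locAbs q ((τ ^ n) x / x - (τ x / x) ^ n) < 1 := by
    induction n with
    | zero => simp [hx]
    | succ n ih =>
      have h1 : (τ ^ (n + 1)) x / x = τ ((τ ^ n) x / x) * (τ x / x) := by
        have : τ x ≠ 0 := by simpa using hx
        rw [pow_succ', AlgEquiv.mul_apply, map_div₀]
        field_simp
      rw [h1, pow_succ]
      refine hmul ?_ (by simp) (by rw [map_pow, hu τ hx, one_pow]) (hu τ hx).le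
      have := locAbs_add_lt_one q (locAbs_sub_lt_one_of_mem_localInertia hτ (hu (τ ^ n) hx).le) ih
      rwa [sub_add_sub_cancel] at this
  -- With `y = σ⁻¹ x` the quotient is `σ(τy/y)`, congruent to `(τy/y)^N`. Since `y/x` is a unit, on
  -- which inertia acts trivially modulo the maximal ideal, `τy/y` may be replaced by `τx/x`.
  have hconj {x} (hx : x ≠ 0) : locAbs q ((σ * τ * σ⁻¹) x / x - (τ x / x) ^ N) < 1 := by
    set y := σ⁻¹ x with hy
    have hy0 : y ≠ 0 := by simpa [hy] using hx
    have hx' : x = σ y := by rw [hy, ← AlgEquiv.mul_apply, mul_inv_cancel, AlgEquiv.one_apply]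
    have hτx : τ x ≠ 0 := by simpa using hx
    have hτy : τ y ≠ 0 := by simpa using hy0
    have h1 : (σ * τ * σ⁻¹) x / x = σ (τ y / y) := by
      rw [AlgEquiv.mul_apply, AlgEquiv.mul_apply, ← hy, map_div₀, ← hx']
    have h2 := locAbs_sub_pow_lt_one_of_isFrobenius hσ (hu τ hy0).le
    have h3 : locAbs q (τ y / y - τ x / x) < 1 := by
      have h4 := locAbs_sub_lt_one_of_mem_localInertia hτ (x := y / x)
        (by rw [hy]; exact (hu σ⁻¹ hx).le)
      have h5 : τ y / y - τ x / x = (τ (y / x) - y / x) * (τ x / y) := by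
        rw [map_div₀]; field_simp
      have h6 : locAbs q (τ x / y) = 1 := by
        rw [map_div₀, locAbs_algEquiv, ← locAbs_algEquiv q σ⁻¹ x, div_self (hne hy0)]
      rwa [h5, map_mul, h6, mul_one]
    rw [h1, ← sub_add_sub_cancel _ ((τ y / y) ^ N)]
    exact locAbs_add_lt_one q h2 (locAbs_pow_sub_pow_lt_one (hu τ hy0).le (hu τ hx).le h3 N)
  intro x hx
  -- Both `στσ⁻¹` and `τ^N` multiply `z` by `(τz/z)^N` up to elements of smaller absolute value. At
  -- this `z` their comparison is the wildness estimate at `x = τ^N z`.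
  set z := (τ ^ N)⁻¹ x with hz
  have hz0 : z ≠ 0 := by simpa [hz] using hx
  have hx' : x = (τ ^ N) z := by
    rw [hz, ← AlgEquiv.mul_apply, mul_inv_cancel, AlgEquiv.one_apply]
  have h2 : locAbs q (((σ * τ * σ⁻¹) z - (τ ^ N) z) / z) < 1 := by
    have h3 := hpow hz0 N
    rw [← map_neg_eq_map, neg_sub] at h3
    have := locAbs_add_lt_one q (hconj hz0) h3
    rwa [sub_add_sub_cancel, ← sub_div] at this
  rw [map_div₀, div_lt_one ((locAbs q).pos hz0)] at h2
  rw [AlgEquiv.mul_apply, ← hz]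
  have hv : locAbs q x = locAbs q z := by rw [hx', locAbs_algEquiv]
  rw [hv]
  rwa [← hx'] at h2

end Tame

/-! ### Frobenius in the Galois group of an algebraically closed residue field. -/

section FrobeniusGenerates

variable {κ₀ κ G : Type*} [Field κ₀] [Finite κ₀] [Field κ] [Algebra κ₀ κ]
  [Algebra.IsAlgebraic κ₀ κ] [Group G] [TopologicalSpace G]
  {π : G →* Gal(κ/κ₀)} {σ : G}

omit [Finite κ₀] [Algebra.IsAlgebraic κ₀ κ] [TopologicalSpace G] in
lemma apply_frobenius_pow (hσ : ∀ x, π σ x = x ^ Nat.card κ₀) (a : ℕ) (x : κ) :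
    (π σ ^ a) x = x ^ (Nat.card κ₀ ^ a) := by
  induction a with
  | zero => simp
  | succ a ih => rw [pow_succ', AlgEquiv.mul_apply, hσ, ih, ← pow_mul, pow_succ]

/-- The image of the complement of `W` is compact and misses `1`, so `W` contains the preimage of
the automorphisms fixing some finite extension `E`. Every automorphism of a finite field is a power
of Frobenius. -/
lemma exists_pow_inv_mul_mem [IsAlgClosed κ] [CompactSpace G] (hπ : Continuous π)
    (hσ : ∀ x, π σ x = x ^ Nat.card κ₀) {W : Subgroup G} (hW : IsOpen (W : Set G))
    (hker : π.ker ≤ W) (g : G) : ∃ a : ℕ, (σ ^ a)⁻¹ * g ∈ W := by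
  have : Fintype κ₀ := Fintype.ofFinite κ₀
  have : IsAlgClosure κ₀ κ := ⟨inferInstance, inferInstance⟩
  have : IsGalois κ₀ κ := { to_normal := IsAlgClosure.normal κ₀ κ }
  have hclosed : IsClosed (π '' (W : Set G)ᶜ) := (hW.isClosed_compl.isCompact.image hπ).isClosed
  have h1 : (π '' (W : Set G)ᶜ)ᶜ ∈ nhds (1 : Gal(κ/κ₀)) := by
    refine hclosed.isOpen_compl.mem_nhds ?_
    rintro ⟨g, hg, hg1⟩
    exact hg (hker hg1)
  obtain ⟨E, hE, hEn, hEs⟩ := (krullTopology_mem_nhds_one_iff_of_normal κ₀ κ _).1 h1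
  have : Finite E := Module.finite_of_finite κ₀
  obtain ⟨a, ha⟩ := (FiniteField.bijective_frobeniusAlgEquivOfAlgebraic_pow κ₀ E).2
    ((π g).restrictNormal E)
  refine ⟨a, ?_⟩
  by_contra hc
  refine hEs (a := π ((σ ^ (a : ℕ))⁻¹ * g)) ?_ ⟨_, hc, rfl⟩
  rw [SetLike.mem_coe, IntermediateField.mem_fixingSubgroup_iff]
  intro x hx
  have h2 : π g x = x ^ (Nat.card κ₀ ^ (a : ℕ)) := by
    have h3 := AlgEquiv.restrictNormal_commutes (π g) E ⟨x, hx⟩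
    have h4 : ((FiniteField.frobeniusAlgEquivOfAlgebraic κ₀ E) ^ (a : ℕ)) ⟨x, hx⟩ =
        (⟨x, hx⟩ : E) ^ (Nat.card κ₀ ^ (a : ℕ)) := by
      rw [AlgEquiv.coe_pow, FiniteField.coe_frobeniusAlgEquivOfAlgebraic_iterate,
        Nat.card_eq_fintype_card]
    rw [← ha] at h3
    change _ = π g x at h3
    rw [← h3]
    exact congrArg (algebraMap E κ) h4
  rw [map_mul, map_inv, map_pow, AlgEquiv.mul_apply, h2, ← apply_frobenius_pow hσ,
    ← AlgEquiv.mul_apply, inv_mul_cancel, AlgEquiv.one_apply]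

/-- Adjoin a primitive root of unity `ζ` of order `N^n - 1`. If `σ^a` fixes `ζ`, then `N^n - 1`
divides `N^a - 1`, and `gcd(N^n - 1, N^a - 1) = N^gcd(n,a) - 1` gives `n ∣ a`. -/
lemma exists_open_normal_dvd [IsAlgClosed κ] (hπ : Continuous π)
    (hσ : ∀ x, π σ x = x ^ Nat.card κ₀) {n : ℕ} (hn : 0 < n) :
    ∃ V : Subgroup G, V.Normal ∧ IsOpen (V : Set G) ∧ π.ker ≤ V ∧
      ∀ a : ℕ, σ ^ a ∈ V → n ∣ a := by
  have : Fintype κ₀ := Fintype.ofFinite κ₀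
  have : IsAlgClosure κ₀ κ := ⟨inferInstance, inferInstance⟩
  have : IsGalois κ₀ κ := { to_normal := IsAlgClosure.normal κ₀ κ }
  set N := Nat.card κ₀ with hN
  have hN1 : 1 < N := Finite.one_lt_card
  have hNn : 1 ≤ N ^ n := Nat.one_le_pow _ _ (by omega)
  have h0 : ((N : ℕ) : κ) = 0 := by
    rw [hN, Nat.card_eq_fintype_card, ← map_natCast (algebraMap κ₀ κ), FiniteField.cast_card_eq_zero,
      map_zero]
  have : NeZero ((N ^ n - 1 : ℕ) : κ) := ⟨by
    rw [Nat.cast_sub hNn, Nat.cast_pow, h0, zero_pow hn.ne']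
    simp⟩
  obtain ⟨ζ, hζ⟩ := HasEnoughRootsOfUnity.exists_primitiveRoot κ (N ^ n - 1)
  let E : IntermediateField κ₀ κ := IntermediateField.adjoin κ₀ {ζ}
  have hE : FiniteDimensional κ₀ E :=
    IntermediateField.adjoin.finiteDimensional (Algebra.IsIntegral.isIntegral ζ)
  have : Finite E := Module.finite_of_finite κ₀
  have hnormal : E.fixingSubgroup.Normal := by
    infer_instance
  refine ⟨E.fixingSubgroup.comap π, inferInstance, E.fixingSubgroup_isOpen.preimage hπ,
    fun g hg => ?_, fun a ha => ?_⟩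
  · rw [Subgroup.mem_comap, MonoidHom.mem_ker.1 hg]
    exact one_mem _
  · rw [Subgroup.mem_comap, map_pow, IntermediateField.mem_fixingSubgroup_iff] at ha
    have h1 := ha ζ (IntermediateField.mem_adjoin_simple_self κ₀ ζ)
    rw [apply_frobenius_pow hσ] at h1
    have hNa : 1 ≤ N ^ a := Nat.one_le_pow _ _ (by omega)
    have h2 : N ^ n - 1 ∣ N ^ a - 1 := by
      rw [← hζ.pow_eq_one_iff_dvd]
      refine mul_right_cancel₀ (hζ.ne_zero fun h =>
        NeZero.ne ((N ^ n - 1 : ℕ) : κ) (by rw [h, Nat.cast_zero])) ?_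
      rw [← pow_succ, Nat.sub_add_cancel hNa, one_mul]
      exact h1
    have h3 := Nat.gcd_eq_left h2
    rw [Nat.pow_sub_one_gcd_pow_sub_one] at h3
    have h4 : N ^ n.gcd a = N ^ n := by
      have := Nat.one_le_pow (n.gcd a) N (by omega)
      omega
    have h5 := Nat.pow_right_injective hN1 h4
    rw [← h5]
    exact Nat.gcd_dvd_right n a

end FrobeniusGenerates

/-! ### The residue field of `k̄` at a prime and the local Frobenius. -/

section Residue

variable {k : Type*} [Field k] [NumberField k] (q : HeightOneSpectrum (𝓞 k))
  (Q : Ideal (𝓞 (AlgebraicClosure k)))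

instance isIntegral_ringOfIntegers_algebraicClosure :
    Algebra.IsIntegral (𝓞 k) (𝓞 (AlgebraicClosure k)) :=
  ⟨fun x => IsIntegral.tower_top (R := ℤ) (Algebra.IsIntegral.isIntegral x)⟩

variable {Q q}

lemma isMaximal_of_mem_primesAbove (hQ : Q ∈ PrimesAbove q) : Q.IsMaximal := by
  have := hQ.1
  have : (Q.under (𝓞 k)).IsMaximal := hQ.2 ▸ q.isMaximal
  exact Ideal.isMaximal_of_isIntegral_of_isMaximal_comap Q this

omit [NumberField k] in
lemma liesOver_of_mem_primesAbove (hQ : Q ∈ PrimesAbove q) : Q.LiesOver q.asIdeal := ⟨hQ.2.symm⟩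

omit [NumberField k] in
lemma exists_root_ringOfIntegers (f : (𝓞 (AlgebraicClosure k))[X]) (hf : f.Monic)
    (hd : f.degree ≠ 0) : ∃ x, f.eval x = 0 := by
  obtain ⟨x, hx⟩ := IsAlgClosed.exists_root (f.map (algebraMap _ (AlgebraicClosure k)))
    (by rwa [hf.degree_map])
  have hx' : Polynomial.aeval x f = 0 := by
    rwa [Polynomial.IsRoot.def, Polynomial.eval_map_algebraMap] at hx
  have hint : IsIntegral ℤ x := isIntegral_trans (A := 𝓞 (AlgebraicClosure k)) x ⟨f, hf, hx'⟩
  let y : 𝓞 (AlgebraicClosure k) := ⟨x, hint⟩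
  refine ⟨y, RingOfIntegers.ext ?_⟩
  have h := Polynomial.aeval_algebraMap_apply (AlgebraicClosure k) y f
  rw [Polynomial.coe_aeval_eq_eval] at h
  exact h.symm.trans hx'

open Ideal.Quotient in
lemma isAlgClosed_residueField (hQ : Q ∈ PrimesAbove q) :
    letI := isMaximal_of_mem_primesAbove hQ
    letI := Ideal.Quotient.field Q
    IsAlgClosed (𝓞 (AlgebraicClosure k) ⧸ Q) := by
  let _ := isMaximal_of_mem_primesAbove hQ
  let _ := Ideal.Quotient.field Q
  refine IsAlgClosed.of_exists_root _ fun f hf hirr => ?_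
  obtain ⟨g, rfl, hdeg, hg⟩ := Polynomial.lifts_and_degree_eq_and_monic
    (f := Ideal.Quotient.mk Q) ((Polynomial.lifts_iff_coeff_lifts f).2 fun n =>
      Ideal.Quotient.mk_surjective _) hf
  obtain ⟨x, hx⟩ := exists_root_ringOfIntegers g hg (by rw [hdeg]; exact hirr.degree_pos.ne')
  exact ⟨Ideal.Quotient.mk Q x, by rw [Polynomial.eval_map_apply, hx, map_zero]⟩

end Residue

section LocalFrobenius

variable {k : Type*} [Field k] [NumberField k] {q : HeightOneSpectrum (𝓞 k)}
  {j : AlgebraicClosure k →ₐ[k] AlgebraicClosure (q.adicCompletion k)}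

variable (q j) in
/-- The action of `G_{k_q}` on the residue field. -/
def residueHom [Q : (primeOfEmbedding q j).LiesOver q.asIdeal] :
    Gal(AlgebraicClosure (q.adicCompletion k)/q.adicCompletion k) →*
      ((𝓞 (AlgebraicClosure k) ⧸ primeOfEmbedding q j) ≃ₐ[𝓞 k ⧸ q.asIdeal]
        (𝓞 (AlgebraicClosure k) ⧸ primeOfEmbedding q j)) :=
  (Ideal.Quotient.stabilizerHom (primeOfEmbedding q j) q.asIdeal
    Gal(AlgebraicClosure k/k)).comp
      ((resLocal j).codRestrict _ (resLocal_mem_stabilizer q j))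

instance liesOver_primeOfEmbedding : (primeOfEmbedding q j).LiesOver q.asIdeal :=
  liesOver_of_mem_primesAbove (primeOfEmbedding_mem q j)

lemma residueHom_mk (σ) (x : 𝓞 (AlgebraicClosure k)) :
    residueHom q j σ (Ideal.Quotient.mk _ x) = Ideal.Quotient.mk _ (resLocal j σ • x) := rfl

lemma ker_residueHom : (residueHom q j).ker = localInertia q j := by
  ext σ
  rw [MonoidHom.mem_ker, mem_localInertia]
  constructor
  · intro h x
    have := DFunLike.congr_fun h (Ideal.Quotient.mk _ x)
    rw [residueHom_mk] at this
    exact Ideal.Quotient.eq.1 this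
  · intro h
    ext x
    obtain ⟨x, rfl⟩ := Ideal.Quotient.mk_surjective x
    rw [residueHom_mk]
    exact Ideal.Quotient.eq.2 (h x)

attribute [local instance] Ideal.Quotient.field

instance isMaximal_primeOfEmbedding : (primeOfEmbedding q j).IsMaximal :=
  isMaximal_of_mem_primesAbove (primeOfEmbedding_mem q j)

instance isMaximal_heightOneSpectrum : q.asIdeal.IsMaximal := q.isMaximal

lemma continuous_residueHom : Continuous (residueHom q j) := by
  refine continuous_of_continuousAt_one _ ?_
  rw [ContinuousAt, map_one, Filter.tendsto_def]
  intro s hs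
  obtain ⟨t, ht⟩ := exists_finset_of_mem_nhds_one hs
  choose f hf using Ideal.Quotient.mk_surjective (I := primeOfEmbedding q j)
  have hopen : IsOpen (⋂ x ∈ t, {σ : Gal(AlgebraicClosure (q.adicCompletion k)/q.adicCompletion k) |
      σ (j (f x : AlgebraicClosure k)) = j (f x : AlgebraicClosure k)}) :=
    isOpen_biInter_finset fun x _ => stabilizer_isOpen_of_isIntegral (j (f x : AlgebraicClosure k))
  refine Filter.mem_of_superset (hopen.mem_nhds (by simp)) fun σ hσ => ht _ fun x hx => ?_
  rw [← hf x, residueHom_mk]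
  congr 1
  refine RingOfIntegers.ext (j.injective ((apply_resLocal j σ _).trans ?_))
  exact Set.mem_iInter₂.1 hσ x hx

variable {σ : Gal(AlgebraicClosure (q.adicCompletion k)/q.adicCompletion k)}

lemma residueHom_apply_of_isFrobenius (hσ : IsFrobenius (primeOfEmbedding q j) (resLocal j σ))
    (x : 𝓞 (AlgebraicClosure k) ⧸ primeOfEmbedding q j) :
    residueHom q j σ x = x ^ Nat.card (𝓞 k ⧸ q.asIdeal) := by
  obtain ⟨x, rfl⟩ := Ideal.Quotient.mk_surjective x
  rw [residueHom_mk, ← map_pow, Ideal.Quotient.eq, ← (primeOfEmbedding_mem q j).2]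
  exact hσ x

lemma finite_residueField : Finite (𝓞 k ⧸ q.asIdeal) :=
  q.asIdeal.finiteQuotientOfFreeOfNeBot q.ne_bot

/-- `G_{k_q}` is topologically generated by inertia and a Frobenius lift. -/
lemma exists_frobenius_pow_inv_mul_mem
    (hσ : IsFrobenius (primeOfEmbedding q j) (resLocal j σ)) {W : Subgroup _}
    (hW : IsOpen (W : Set Gal(AlgebraicClosure (q.adicCompletion k)/q.adicCompletion k)))
    (hI : localInertia q j ≤ W) (g) : ∃ a : ℕ, (σ ^ a)⁻¹ * g ∈ W := by
  have := finite_residueField (q := q)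
  have := isAlgClosed_residueField (primeOfEmbedding_mem q j)
  have : Algebra.IsAlgebraic (𝓞 k ⧸ q.asIdeal) (𝓞 (AlgebraicClosure k) ⧸ primeOfEmbedding q j) :=
    inferInstance
  exact exists_pow_inv_mul_mem continuous_residueHom (residueHom_apply_of_isFrobenius hσ) hW
    (ker_residueHom.trans_le hI) g

/-- `G_{k_q}` has unramified quotients in which a Frobenius lift has order divisible by `n`. -/
lemma exists_open_normal_frobenius_dvd
    (hσ : IsFrobenius (primeOfEmbedding q j) (resLocal j σ)) {n : ℕ} (hn : 0 < n) :
    ∃ V : Subgroup Gal(AlgebraicClosure (q.adicCompletion k)/q.adicCompletion k), V.Normal ∧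
      IsOpen (V : Set Gal(AlgebraicClosure (q.adicCompletion k)/q.adicCompletion k)) ∧
      localInertia q j ≤ V ∧ ∀ a : ℕ, σ ^ a ∈ V → n ∣ a := by
  have := finite_residueField (q := q)
  have := isAlgClosed_residueField (primeOfEmbedding_mem q j)
  rw [← ker_residueHom]
  exact exists_open_normal_dvd continuous_residueHom (residueHom_apply_of_isFrobenius hσ) hn

lemma exists_smul_eq_of_mem_primesAbove {Q Q' : Ideal (𝓞 (AlgebraicClosure k))}
    (hQ : Q ∈ PrimesAbove q) (hQ' : Q' ∈ PrimesAbove q) :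
    ∃ τ : Gal(AlgebraicClosure k/k), Q' = τ • Q := by
  have := hQ.1
  have := hQ'.1
  -- Transitivity on primes for a profinite group needs a continuous action on a discrete ring;
  -- stabilizers of algebraic elements are open.
  let _ : TopologicalSpace (𝓞 (AlgebraicClosure k)) := ⊥
  have : DiscreteTopology (𝓞 (AlgebraicClosure k)) := ⟨rfl⟩
  have : ContinuousSMul Gal(AlgebraicClosure k/k) (𝓞 (AlgebraicClosure k)) := by
    refine continuousSMul_iff_stabilizer_isOpen.2 fun x => ?_
    convert! stabilizer_isOpen_of_isIntegral (K := k) (x : AlgebraicClosure k) using 1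
    ext g
    exact RingOfIntegers.ext_iff
  have : Algebra.IsInvariant (𝓞 k) (𝓞 (AlgebraicClosure k)) Gal(AlgebraicClosure k/k) := by
    refine ⟨fun b hb => ?_⟩
    obtain ⟨c, hc⟩ := (InfiniteGalois.mem_range_algebraMap_iff_fixed (k := k)
      (b : AlgebraicClosure k)).2 fun g => RingOfIntegers.ext_iff.1 (hb g)
    have hint : IsIntegral ℤ c := by
      rw [← isIntegral_algebraMap_iff (algebraMap k (AlgebraicClosure k)).injective, hc]
      exact RingOfIntegers.isIntegral_coe b
    exact ⟨⟨c, hint⟩, RingOfIntegers.ext hc⟩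
  exact Algebra.IsInvariant.exists_smul_of_under_eq_of_profinite (A := 𝓞 k) Q Q'
    (hQ.2.trans hQ'.2.symm)

omit [NumberField k] in
lemma inertiaAt_smul (Q : Ideal (𝓞 (AlgebraicClosure k))) (τ g : Gal(AlgebraicClosure k/k)) :
    g ∈ inertiaAt (τ • Q) ↔ τ⁻¹ * g * τ ∈ inertiaAt Q := by
  change (∀ x, g • x - x ∈ τ • Q) ↔ ∀ x, (τ⁻¹ * g * τ) • x - x ∈ Q
  rw [(MulAction.surjective τ).forall]
  refine forall_congr' fun x => ?_
  rw [Ideal.mem_pointwise_smul_iff_inv_smul_mem, smul_sub, inv_smul_smul, mul_smul, mul_smul]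

lemma exists_resLocal_of_mem_inertiaAt {g} (hg : g ∈ inertiaAt (primeOfEmbedding q j)) :
    ∃ σ ∈ localInertia q j, resLocal j σ = g := by
  obtain ⟨σ, rfl⟩ := exists_resLocal_eq q j (Ideal.inertia_le_stabilizer _ hg)
  exact ⟨σ, hg, rfl⟩

end LocalFrobenius

end

/-! ### First cohomology of an abstract tame action. -/

section TameCohomology

variable {R G M : Type*} [CommRing R] [TopologicalSpace R] [Group G] [TopologicalSpace G]
  [AddCommGroup M] [Module R M]

/-- A group `G` with an "inertia" subgroup `I` and a "Frobenius" `σ` as in a local Galois group,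
acting on a linearly topologized complete module on which inertia acts through a finite quotient
`Ib`. The submodules `W i` are a fundamental system of neighbourhoods of `0`. -/
structure TameAction (p N : ℕ) (ρ : Representation R G M) (I : Subgroup G) (σ : G) {ι : Type*}
    (W : ι → Submodule R M) {Ib : Type*} [Group Ib] [Fintype Ib] (χ : I →* Ib)
    (E : Representation R Ib M) (θ : M →+ M) : Prop where
  continuous_iff : ∀ c : G → M, (∀ g h, c (g * h) = c g + ρ g (c h)) →
    (@Continuous G M _ (moduleTopology R M) c ↔
      ∀ i, ∃ V : Subgroup G, IsOpen (V : Set G) ∧ ∀ v ∈ V, c v ∈ W i)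
  stable : ∀ i g, ∀ x ∈ W i, ρ g x ∈ W i
  trivial_mod : ∀ i, ∃ V : Subgroup G, IsOpen (V : Set G) ∧ ∀ v ∈ V, ∀ x, ρ v x - x ∈ W i
  eq_zero : ∀ x, (∀ i, x ∈ W i) → x = 0
  pow_smul_mem : ∀ i, ∃ n : ℕ, ∀ x : M, (p ^ n) • x ∈ W i
  complete : ∀ y : ι → M, (∀ i k, W k ≤ W i → y k - y i ∈ W i) → ∃ x, ∀ i, y i - x ∈ W i
  normal : I.Normal
  generate : ∀ V : Subgroup G, IsOpen (V : Set G) → I ≤ V → ∀ g, ∃ a : ℕ, (σ ^ a)⁻¹ * g ∈ V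
  dvd : ∀ n : ℕ, 0 < n → ∃ V : Subgroup G, V.Normal ∧ IsOpen (V : Set G) ∧ I ≤ V ∧
    ∀ a : ℕ, σ ^ a ∈ V → n ∣ a
  -- `w` is the wild error term in the tame relation; powers of it prime to `p` come arbitrarily
  -- close to `1`.
  tame : ∀ t : I, χ t = 1 → ∃ w : I, χ w = 1 ∧ σ * t * σ⁻¹ = w * t ^ N ∧
    ∀ V : Subgroup G, IsOpen (V : Set G) → ∃ m : ℕ, p.Coprime m ∧ (w : G) ^ m ∈ V
  pos : 0 < p
  injective : ∀ x, ρ σ x = N • x → x = 0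
  surjective : Function.Surjective χ
  apply_inertia : ∀ t : I, ρ t = E (χ t)
  -- The identity is a trace over `Ib`, as for an induced module. This is what kills the higher
  -- cohomology of `Ib` and makes every invariant a norm.
  sum_conj : ∀ x, ∑ h, E h (θ (E h⁻¹ x)) = x

namespace TameAction

variable {p N : ℕ} {ρ : Representation R G M} {I : Subgroup G} {σ : G} {ι : Type*}
    {W : ι → Submodule R M} {Ib : Type*} [Group Ib] [Fintype Ib] {χ : I →* Ib}
    {E : Representation R Ib M} {θ : M →+ M}

omit [TopologicalSpace R] [TopologicalSpace G] in
lemma cocycle_one {c : G → M} (hc : ∀ g h, c (g * h) = c g + ρ g (c h)) : c 1 = 0 := by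
  have := hc 1 1
  simpa using this

omit [TopologicalSpace R] [TopologicalSpace G] in
lemma cocycle_pow {c : G → M} (hc : ∀ g h, c (g * h) = c g + ρ g (c h)) {g : G}
    (hg : ρ g = 1) (n : ℕ) : c (g ^ n) = n • c g := by
  induction n with
  | zero => simpa using cocycle_one hc
  | succ n ih =>
    rw [pow_succ', hc, hg, ih, Module.End.one_apply, succ_nsmul']

omit [TopologicalSpace R] in
lemma mem_of_coprime {S : Submodule R M} {x : M} {a b : ℕ} (h : a.Coprime b) (ha : a • x ∈ S)
    (hb : b • x ∈ S) : x ∈ S := by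
  have h1 := Nat.gcd_eq_gcd_ab a b
  rw [h] at h1
  have h2 : x = (a.gcdA b) • (a • x) + (a.gcdB b) • (b • x) := by
    rw [← natCast_zsmul, ← natCast_zsmul, smul_smul, smul_smul, ← add_smul, mul_comm, mul_comm (a.gcdB b),
      ← h1, Nat.cast_one, one_smul]
  rw [h2]
  exact S.add_mem (S.toAddSubgroup.zsmul_mem ha _) (S.toAddSubgroup.zsmul_mem hb _)

variable (H : TameAction p N ρ I σ W χ E θ)
include H

/-- The action of `ker χ` is trivial, so `c` is additive there. By continuity `c(w)` is brought into
each `W i` both by a power of `p` and by an integer prime to `p`, hence `c(w) = 0`. The tame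
relation then reads `σ c(t) = N c(t)`. -/
lemma cocycle_eq_zero_of_apply_eq_one {c : G → M} (hc : c ∈ cocycles₁ ρ) (t : I)
    (ht : χ t = 1) : c t = 0 := by
  have htriv (t : I) (ht : χ t = 1) : ρ t = 1 := by rw [H.apply_inertia, ht, map_one]
  obtain ⟨w, hw, hrel, hV⟩ := H.tame t ht
  have hcw : c w = 0 := by
    refine H.eq_zero _ fun i => ?_
    obtain ⟨V, hVo, hVc⟩ := (H.continuous_iff c hc.2).1 hc.1 i
    obtain ⟨m, hm, hmem⟩ := hV V hVo
    obtain ⟨n, hn⟩ := H.pow_smul_mem i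
    refine mem_of_coprime (hm.pow_left n) (hn _) ?_
    rw [← cocycle_pow hc.2 (htriv w hw)]
    exact hVc _ hmem
  refine H.injective _ ?_
  have h1 : c (σ * t * σ⁻¹) = ρ σ (c t) := by
    have h2 := hc.2 σ σ⁻¹
    rw [mul_inv_cancel, cocycle_one hc.2] at h2
    rw [hc.2, hc.2, map_mul, htriv t ht, mul_one, add_right_comm, ← h2, zero_add]
  rw [← h1, hrel, hc.2, hcw, zero_add, htriv w hw, Module.End.one_apply,
    cocycle_pow hc.2 (htriv t ht)]

lemma coboundaryMap_mem (y : M) : coboundaryMap ρ y ∈ cocycles₁ ρ := by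
  have h2 : ∀ g h, coboundaryMap ρ y (g * h) = coboundaryMap ρ y g + ρ g (coboundaryMap ρ y h) := by
    intro g h
    simp [coboundaryMap]
  refine ⟨(H.continuous_iff _ h2).2 fun i => ?_, h2⟩
  obtain ⟨V, hV, hVy⟩ := H.trivial_mod i
  exact ⟨V, hV, fun v hv => hVy v hv y⟩

/-- By the vanishing on `ker χ`, the restriction of `c` to inertia is a cocycle `a` of `Ib`. For `y
= ∑ h θ(h⁻¹ a(h))`, the identity `g a(h) = a(gh) - a(g)` and reindexing give `g y = y - a(g)`. -/
lemma exists_add_coboundary_eq_zero {c : G → M} (hc : c ∈ cocycles₁ ρ) :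
    ∃ y, ∀ t ∈ I, c t + coboundaryMap ρ y t = 0 := by
  choose s hs using H.surjective
  have key (t : I) : c t = c (s (χ t)) := by
    have h1 : χ ((s (χ t))⁻¹ * t) = 1 := by rw [map_mul, map_inv, hs, inv_mul_cancel]
    have h2 := H.cocycle_eq_zero_of_apply_eq_one hc _ h1
    have h3 := hc.2 (s (χ t)) ((s (χ t))⁻¹ * t)
    rw [← Subgroup.coe_mul, ← Subgroup.coe_mul, mul_inv_cancel_left] at h3
    rw [h3, h2, map_zero, add_zero]
  set a : Ib → M := fun h => c (s h) with ha
  have hmul (g h : Ib) : a (g * h) = a g + E g (a h) := by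
    have h1 := key (s g * s h)
    rw [map_mul, hs, hs, Subgroup.coe_mul, hc.2, H.apply_inertia, hs] at h1
    exact h1.symm
  refine ⟨∑ h, E h (θ (E h⁻¹ (a h))), fun t ht => ?_⟩
  have h1 : c t = a (χ ⟨t, ht⟩) := key ⟨t, ht⟩
  set g := χ ⟨t, ht⟩
  have h2 : ρ t = E g := H.apply_inertia ⟨t, ht⟩
  have e1 : a g = ∑ h, E (g * h) (θ (E (g * h)⁻¹ (a g))) :=
    ((Equiv.sum_comp (Equiv.mulLeft g) fun h => E h (θ (E h⁻¹ (a g)))).trans (H.sum_conj _)).symm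
  have e2 : ∑ h, E h (θ (E h⁻¹ (a h))) = ∑ h, E (g * h) (θ (E (g * h)⁻¹ (a (g * h)))) :=
    (Equiv.sum_comp (Equiv.mulLeft g) fun h => E h (θ (E h⁻¹ (a h)))).symm
  have h3 : E g (∑ h, E h (θ (E h⁻¹ (a h)))) = ∑ h, E h (θ (E h⁻¹ (a h))) - a g := by
    refine Eq.trans ?_ (congrArg₂ (· - ·) e2.symm e1.symm)
    rw [← Finset.sum_sub_distrib, map_sum]
    refine Finset.sum_congr rfl fun h _ => ?_
    rw [← map_sub, ← map_sub, ← map_sub, hmul, add_sub_cancel_left, ← Module.End.mul_apply (E _),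
      ← map_mul, ← Module.End.mul_apply (E _) (E g), ← map_mul, mul_inv_rev, inv_mul_cancel_right]
  change c t + (ρ t (∑ h, E h (θ (E h⁻¹ (a h)))) - (∑ h, E h (θ (E h⁻¹ (a h))))) = 0
  rw [h1, h2, h3]
  abel

omit [TopologicalSpace R] [TopologicalSpace G] H in
lemma sum_range_add_pow (ρ : Representation R G M) (σ : G) (m : M) (a b : ℕ) :
    ∑ l ∈ Finset.range (a + b), ρ (σ ^ l) m =
      ∑ l ∈ Finset.range a, ρ (σ ^ l) m + ρ (σ ^ a) (∑ l ∈ Finset.range b, ρ (σ ^ l) m) := by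
  rw [Finset.sum_range_add, map_sum]
  simp only [pow_add, map_mul, Module.End.mul_apply]

variable [IsTopologicalGroup G] [CompactSpace G]

/-- The partial sums `X a = m + σm + ⋯ + σ^(a-1)m` are periodic modulo `W i`: if `σ^A` acts
trivially modulo `W i` and `p^n M ⊂ W i`, then `X(A p^n) ≡ p^n X(A) ≡ 0`. Take `V` detecting
divisibility by `A p^n`. -/
lemma exists_open_normal_sub_mem (m : M) (i : ι) : ∃ V : Subgroup G, V.Normal ∧
    IsOpen (V : Set G) ∧ I ≤ V ∧ ∀ (g : G) (a b : ℕ), (σ ^ a)⁻¹ * g ∈ V → (σ ^ b)⁻¹ * g ∈ V →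
      ∑ l ∈ Finset.range a, ρ (σ ^ l) m - ∑ l ∈ Finset.range b, ρ (σ ^ l) m ∈ W i := by
  set X : ℕ → M := fun a => ∑ l ∈ Finset.range a, ρ (σ ^ l) m with hX
  have hadd (a b : ℕ) : X (a + b) = X a + ρ (σ ^ a) (X b) := sum_range_add_pow ρ σ m a b
  obtain ⟨V₀, hV₀, hV₀W⟩ := H.trivial_mod i
  have := Subgroup.quotient_finite_of_isOpen V₀ hV₀
  obtain ⟨A, hA, -, hAV⟩ := Subgroup.exists_pow_mem_of_index_ne_zero
    (Subgroup.index_ne_zero_of_finite (H := V₀)) σ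
  obtain ⟨n, hn⟩ := H.pow_smul_mem i
  have h1 (l : ℕ) : X (A * l) - l • X A ∈ W i := by
    induction l with
    | zero => simp [hX]
    | succ l ih =>
      have h2 := hV₀W _ (V₀.pow_mem hAV l) (X A)
      rw [← pow_mul] at h2
      have h3 : X (A * (l + 1)) - (l + 1) • X A =
          (X (A * l) - l • X A) + (ρ (σ ^ (A * l)) (X A) - X A) := by
        rw [mul_add_one, hadd, succ_nsmul]
        abel
      rw [h3]
      exact add_mem ih h2
  have h2 : X (A * p ^ n) ∈ W i := by
    have := add_mem (h1 (p ^ n)) (hn (X A))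
    rwa [sub_add_cancel] at this
  have h3 (l : ℕ) : X (A * p ^ n * l) ∈ W i := by
    induction l with
    | zero => simp [hX]
    | succ l ih =>
      rw [mul_add_one, hadd]
      exact add_mem ih (H.stable i _ _ h2)
  obtain ⟨V, hVn, hVo, hVI, hV⟩ := H.dvd (A * p ^ n) (Nat.mul_pos hA (pow_pos H.pos n))
  refine ⟨V, hVn, hVo, hVI, fun g => ?_⟩
  have key (a b : ℕ) (hba : b ≤ a) (ha : (σ ^ a)⁻¹ * g ∈ V) (hb : (σ ^ b)⁻¹ * g ∈ V) :
      X a - X b ∈ W i := by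
    obtain ⟨d, rfl⟩ := Nat.exists_eq_add_of_le hba
    have h4 := V.mul_mem hb (V.inv_mem ha)
    rw [mul_inv_rev, inv_inv, mul_assoc, mul_inv_cancel_left, pow_add, inv_mul_cancel_left] at h4
    obtain ⟨l, rfl⟩ := hV d h4
    rw [hadd, add_sub_cancel_left]
    exact H.stable i _ _ (h3 l)
  intro a b ha hb
  rcases le_total b a with h | h
  · exact key a b h ha hb
  · rw [← neg_mem_iff, neg_sub]
    exact key b a h hb ha

/-- A continuous cocycle which vanishes on inertia, with a given inertia-invariant value at the
Frobenius. -/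
lemma exists_cocycle {m : M} (hm : ∀ t ∈ I, ρ t m = m) :
    ∃ c ∈ cocycles₁ ρ, c σ = m ∧ ∀ t ∈ I, c t = 0 := by
  set X : ℕ → M := fun a => ∑ l ∈ Finset.range a, ρ (σ ^ l) m with hX
  have hadd (a b : ℕ) : X (a + b) = X a + ρ (σ ^ a) (X b) := sum_range_add_pow ρ σ m a b
  choose V hVn hVo hVI hV using H.exists_open_normal_sub_mem m
  have hinter (V V' : Subgroup G) (h : IsOpen (V : Set G)) (h' : IsOpen (V' : Set G)) :
      IsOpen ((V ⊓ V' : Subgroup G) : Set G) := h.inter h'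
  -- `c(g)` is the limit of `X a` as `σ^a` approaches `g` modulo inertia.
  have hlim (g : G) : ∃ y, ∀ i, ∀ a : ℕ, (σ ^ a)⁻¹ * g ∈ V i → X a - y ∈ W i := by
    choose a ha using fun i => H.generate (V i) (hVo i) (hVI i) g
    obtain ⟨y, hy⟩ := H.complete (fun i => X (a i)) fun i l hl => by
      obtain ⟨b, hb⟩ := H.generate (V i ⊓ V l) (hinter _ _ (hVo i) (hVo l))
        (le_inf (hVI i) (hVI l)) g
      have h1 := hV l g _ _ (ha l) hb.2
      have h2 := hV i g _ _ hb.1 (ha i)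
      have := add_mem (hl h1) h2
      rwa [sub_add_sub_cancel] at this
    refine ⟨y, fun i b hb => ?_⟩
    have := add_mem (hV i g _ _ hb (ha i)) (hy i)
    rwa [sub_add_sub_cancel] at this
  choose c hc using hlim
  have hXI (a : ℕ) : ∀ t ∈ I, ρ t (X a) = X a := by
    intro t ht
    simp only [hX, map_sum]
    refine Finset.sum_congr rfl fun l _ => ?_
    have h1 := H.normal.conj_mem t ht (σ ^ l)⁻¹
    rw [inv_inv] at h1
    have h2 : t * σ ^ l = σ ^ l * ((σ ^ l)⁻¹ * t * σ ^ l) := by group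
    rw [← Module.End.mul_apply, ← map_mul, h2, map_mul, Module.End.mul_apply, hm _ h1]
  have hcI (t : G) (ht : t ∈ I) : c t = 0 := by
    refine H.eq_zero _ fun i => ?_
    have := hc t i 0 (by simpa using hVI i ht)
    simpa [hX] using this
  have hcocycle : ∀ g h, c (g * h) = c g + ρ g (c h) := by
    intro g h
    rw [← sub_eq_zero]
    refine H.eq_zero _ fun i => ?_
    obtain ⟨V₀, hV₀, hV₀W⟩ := H.trivial_mod i
    obtain ⟨b, hb⟩ := H.generate (V i) (hVo i) (hVI i) h
    -- The cocycle identity is the limit of `X(a+b) = X a + σ^a X b`. Replacing `σ^a` by `g` in the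
    -- last term needs `(σ^a)⁻¹ g` to fix `X b` modulo `W i`; the subgroup doing so contains
    -- inertia, because `X b` is inertia-invariant.
    let V' : Subgroup G :=
      { carrier := {v | ρ v (X b) - X b ∈ W i}
        one_mem' := by simp
        mul_mem' := fun {v w} hv hw => by
          have h1 := add_mem (H.stable i v _ hw) hv
          rwa [map_sub, sub_add_sub_cancel, ← Module.End.mul_apply, ← map_mul] at h1
        inv_mem' := fun {v} hv => by
          have h1 := neg_mem (H.stable i v⁻¹ _ hv)
          rwa [map_sub, ← Module.End.mul_apply, ← map_mul, inv_mul_cancel, map_one,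
            Module.End.one_apply, neg_sub] at h1 }
    have hV' : IsOpen (V' : Set G) := Subgroup.isOpen_mono (H₁ := V₀) (fun v hv => hV₀W v hv _) hV₀
    obtain ⟨a, ha⟩ := H.generate (V i ⊓ V') (hinter _ _ (hVo i) hV')
      (le_inf (hVI i) fun t ht => by
        change ρ t (X b) - X b ∈ W i
        rw [hXI b t ht, sub_self]
        exact zero_mem _) g
    have h1 := hc g i a ha.1
    have h2 := hc h i b hb
    have h3 : (σ ^ (a + b))⁻¹ * (g * h) ∈ V i := by
      have h4 : (σ ^ (a + b))⁻¹ * (g * h) =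
          (σ ^ b)⁻¹ * ((σ ^ a)⁻¹ * g) * (σ ^ b)⁻¹⁻¹ * ((σ ^ b)⁻¹ * h) := by
        rw [pow_add]; group
      rw [h4]
      exact mul_mem ((hVn i).conj_mem _ ha.1 _) hb
    have h4 := hc (g * h) i (a + b) h3
    have h5 : ρ g (X b) - ρ (σ ^ a) (X b) ∈ W i := by
      have h6 : ρ ((σ ^ a)⁻¹ * g) (X b) - X b ∈ W i := ha.2
      have h7 := H.stable i (σ ^ a) _ h6
      rwa [map_sub, ← Module.End.mul_apply, ← map_mul, mul_inv_cancel_left] at h7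
    have h6 := H.stable i g _ h2
    rw [map_sub] at h6
    have h7 : c (g * h) - (c g + ρ g (c h)) =
        (X a - c g) + (ρ g (X b) - ρ g (c h)) - (ρ g (X b) - ρ (σ ^ a) (X b)) -
          (X (a + b) - c (g * h)) := by
      rw [hadd]; abel
    rw [h7]
    exact sub_mem (sub_mem (add_mem h1 h6) h5) h4
  refine ⟨c, ⟨(H.continuous_iff c hcocycle).2 fun i => ⟨V i, hVo i, fun v hv => ?_⟩, hcocycle⟩,
    ?_, hcI⟩
  · have := hc v i 0 (by simpa using hv)
    simpa [hX] using this
  · rw [eq_comm, ← sub_eq_zero]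
    refine H.eq_zero _ fun i => ?_
    have := hc σ i 1 (by simp)
    simpa [hX] using this

-- The elements at which the difference of the two cocycles lies in `W i` form an open subgroup
-- containing inertia and `σ`, hence everything.
omit [CompactSpace G] in
lemma cocycle_ext {c d : G → M} (hc : c ∈ cocycles₁ ρ) (hd : d ∈ cocycles₁ ρ)
    (hσ : c σ = d σ) (hI : ∀ t ∈ I, c t = d t) : c = d := by
  have he := (cocycles₁ ρ).sub_mem hc hd
  set e := c - d
  have he' := he.2
  have heσ : e σ = 0 := sub_eq_zero.2 hσ
  have heI : ∀ t ∈ I, e t = 0 := fun t ht => sub_eq_zero.2 (hI t ht)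
  rw [← sub_eq_zero]
  funext g
  refine H.eq_zero _ fun i => ?_
  let V : Subgroup G :=
    { carrier := {g | e g ∈ W i}
      one_mem' := by rw [Set.mem_ofPred, cocycle_one he']; exact zero_mem _
      mul_mem' := fun {g h} hg hh => by
        rw [Set.mem_ofPred, he']
        exact add_mem hg (H.stable i g _ hh)
      inv_mem' := fun {g} hg => by
        have h1 := he' g⁻¹ g
        rw [inv_mul_cancel, cocycle_one he', eq_comm, add_eq_zero_iff_eq_neg] at h1
        rw [Set.mem_ofPred, h1]
        exact neg_mem (H.stable i _ _ hg) }
  obtain ⟨V', hV', hV'e⟩ := (H.continuous_iff e he').1 he.1 i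
  have hV : IsOpen (V : Set G) := Subgroup.isOpen_mono (H₁ := V') hV'e hV'
  obtain ⟨a, ha⟩ := H.generate V hV (fun t ht => by
    change e t ∈ W i
    rw [heI t ht]
    exact zero_mem _) g
  have hσV : σ ∈ V := by
    change e σ ∈ W i
    rw [heσ]
    exact zero_mem _
  have := V.mul_mem (V.pow_mem hσV a) ha
  rwa [mul_inv_cancel_left] at this

-- Invariants are norms: for invariant `m` the formula `m = ∑ h θ(h⁻¹ m)` becomes `m = ∑ h θ(m)`.
omit [IsTopologicalGroup G] [CompactSpace G] in
lemma exists_sum_eq_iff {m : M} : (∃ x, ∑ h, E h x = m) ↔ ∀ t ∈ I, ρ t m = m := by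
  constructor
  · rintro ⟨x, rfl⟩ t ht
    rw [H.apply_inertia ⟨t, ht⟩, map_sum]
    simp only [← Module.End.mul_apply, ← map_mul]
    exact Equiv.sum_comp (Equiv.mulLeft (χ ⟨t, ht⟩)) fun h => E h x
  · intro hm
    refine ⟨θ m, ?_⟩
    conv_rhs => rw [← H.sum_conj m]
    refine Finset.sum_congr rfl fun h _ => ?_
    obtain ⟨t, ht⟩ := H.surjective h⁻¹
    rw [← ht, ← H.apply_inertia, hm t t.2]

/-- The first cohomology group is the module of Frobenius coinvariants of the inertia invariants. -/
lemma exists_surjective_H1 : ∃ α : M →ₗ[R] H1 ρ, Function.Surjective α ∧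
    ∀ x, α x = 0 ↔ ∃ y, ∑ h, E h x = ρ σ (∑ h, E h y) - ∑ h, E h y := by
  choose c hc hcσ hcI using fun x => H.exists_cocycle (H.exists_sum_eq_iff.1 ⟨x, rfl⟩)
  let α : M →ₗ[R] cocycles₁ ρ :=
    { toFun := fun x => ⟨c x, hc x⟩
      map_add' := fun x y => Subtype.ext <| H.cocycle_ext (hc _)
        ((cocycles₁ ρ).add_mem (hc x) (hc y))
        (by simp [hcσ, Finset.sum_add_distrib]) (fun t ht => by simp [hcI _ t ht])
      map_smul' := fun r x => Subtype.ext <| H.cocycle_ext (hc _)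
        ((cocycles₁ ρ).smul_mem r (hc x))
        (by simp [hcσ, Finset.smul_sum]) (fun t ht => by simp [hcI _ t ht]) }
  refine ⟨(Submodule.mkQ _).comp α, fun z => ?_, fun x => ?_⟩
  · obtain ⟨⟨d, hd⟩, rfl⟩ := Submodule.mkQ_surjective _ z
    obtain ⟨y, hy⟩ := H.exists_add_coboundary_eq_zero hd
    set e := d + coboundaryMap ρ y with he
    have hemem : e ∈ cocycles₁ ρ := add_mem hd (H.coboundaryMap_mem y)
    -- Computing `e(tσ) = e(σ · σ⁻¹tσ)` in two ways shows that `e(σ)` is inertia-invariant, hence a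
    -- norm.
    obtain ⟨x, hx⟩ := (H.exists_sum_eq_iff (m := e σ)).2 fun t ht => by
      have h1 := hemem.2 t σ
      have h2 := hemem.2 σ (σ⁻¹ * t * σ)
      have h3 := H.normal.conj_mem t ht σ⁻¹
      rw [inv_inv] at h3
      have h4 : σ * (σ⁻¹ * t * σ) = t * σ := by group
      have h6 : e t = 0 := hy t ht
      rw [h4, h1, h6, zero_add] at h2
      have h5 : e (σ⁻¹ * t * σ) = 0 := hy _ h3
      rwa [h5, map_zero, add_zero] at h2
    refine ⟨x, ?_⟩
    have hce : c x = e := H.cocycle_ext (hc x) hemem ((hcσ x).trans hx)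
      fun t ht => (hcI x t ht).trans (hy t ht).symm
    rw [LinearMap.comp_apply, Submodule.mkQ_apply, Submodule.mkQ_apply, Submodule.Quotient.eq]
    refine ⟨y, ?_⟩
    change coboundaryMap ρ y = c x - d
    rw [hce, he, add_sub_cancel_left]
  · rw [LinearMap.comp_apply, Submodule.mkQ_apply, Submodule.Quotient.mk_eq_zero]
    constructor
    · rintro ⟨z, hz⟩
      replace hz : coboundaryMap ρ z = c x := hz
      obtain ⟨y, rfl⟩ := (H.exists_sum_eq_iff (m := z)).2 fun t ht => by
        have h1 := congrFun hz t
        rw [hcI x t ht] at h1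
        exact sub_eq_zero.1 h1
      refine ⟨y, ?_⟩
      rw [← hcσ x, ← hz]
      rfl
    · rintro ⟨y, hy⟩
      refine ⟨∑ h, E h y, H.cocycle_ext (H.coboundaryMap_mem _) (hc x) ?_ fun t ht => ?_⟩
      · change _ = c x σ
        rw [hcσ, hy]
        rfl
      · change _ = c x t
        rw [hcI x t ht]
        exact sub_eq_zero.2 (H.exists_sum_eq_iff.1 ⟨y, rfl⟩ t ht)

end TameAction
end TameCohomology

/-! ### Topology and completeness of `O[[G]]`. -/

namespace CompletedGroupAlgebra

variable {O : Type*} [CommRing O] {G : Type*} [CommGroup G] [TopologicalSpace G]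

/-- The projection `O[[G]] → O[G/U]`. -/
def level (U : OpenSubgroup G) :
    CompletedGroupAlgebra O G →ₐ[O] MonoidAlgebra O (G ⧸ (U : Subgroup G)) :=
  ((Pi.evalAlgHom O (fun U : OpenSubgroup G => MonoidAlgebra O (G ⧸ (U : Subgroup G))) U).comp
    (compatibleFamilies O G).val : compatibleFamilies O G →ₐ[O] _)

lemma transition_level {U V : OpenSubgroup G} (h : U ≤ V) (x : CompletedGroupAlgebra O G) :
    transition O G h (level U x) = level V x :=
  x.2 U V h

@[ext]
lemma ext {x y : CompletedGroupAlgebra O G} (h : ∀ U, level U x = level U y) : x = y :=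
  Subtype.ext (funext h)

/-- The element of `O[[G]]` given by a compatible family. -/
def ofCompatible (y : ∀ U : OpenSubgroup G, MonoidAlgebra O (G ⧸ (U : Subgroup G)))
    (hy : ∀ U V (h : U ≤ V), transition O G h (y U) = y V) : CompletedGroupAlgebra O G :=
  (⟨y, hy⟩ : compatibleFamilies O G)

lemma level_ofCompatible (y : ∀ U : OpenSubgroup G, MonoidAlgebra O (G ⧸ (U : Subgroup G)))
    (hy : ∀ U V (h : U ≤ V), transition O G h (y U) = y V) (U : OpenSubgroup G) :
    level U (ofCompatible y hy) = y U :=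
  rfl

lemma level_groupElem (U : OpenSubgroup G) (g : G) :
    level U (groupElem O G g) = MonoidAlgebra.single (QuotientGroup.mk g) 1 :=
  rfl

lemma transition_single {U V : OpenSubgroup G} (h : U ≤ V) (g : G) (a : O) :
    transition O G h (MonoidAlgebra.single (QuotientGroup.mk g) a) =
      MonoidAlgebra.single (QuotientGroup.mk g) a := by
  simp only [transition, MonoidAlgebra.mapDomainAlgHom_apply, MonoidAlgebra.mapDomain_single]
  rfl

lemma transition_transition {U V W : OpenSubgroup G} (h : U ≤ V) (h' : V ≤ W)
    (x : MonoidAlgebra O (G ⧸ (U : Subgroup G))) :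
    transition O G h' (transition O G h x) = transition O G (h.trans h') x := by
  induction x using MonoidAlgebra.induction_linear with
  | zero => simp only [map_zero]
  | add x y hx hy => simp only [map_add, hx, hy]
  | single g a =>
    obtain ⟨g, rfl⟩ := QuotientGroup.mk_surjective g
    simp only [transition_single]

/-- The ideal of elements of `O[[G]]` all of whose coefficients at level `U` lie in `𝔞`. -/
def levelIdeal (𝔞 : Ideal O) (U : OpenSubgroup G) : Ideal (CompletedGroupAlgebra O G) :=
  RingHom.ker ((MonoidAlgebra.mapRingHom (G ⧸ (U : Subgroup G)) (Ideal.Quotient.mk 𝔞)).comp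
    (level U : CompletedGroupAlgebra O G →ₐ[O] _).toRingHom)

lemma mem_levelIdeal {𝔞 : Ideal O} {U : OpenSubgroup G} {x : CompletedGroupAlgebra O G} :
    x ∈ levelIdeal 𝔞 U ↔ ∀ g, (level U x).coeff g ∈ 𝔞 := by
  rw [levelIdeal, RingHom.mem_ker, ← MonoidAlgebra.coeff_inj, DFunLike.ext_iff]
  refine forall_congr' fun g => ?_
  rw [RingHom.comp_apply, MonoidAlgebra.coeff_mapRingHom, MonoidAlgebra.coeff_zero]
  exact Ideal.Quotient.eq_zero_iff_mem

lemma levelIdeal_mono {𝔞 𝔟 : Ideal O} (h : 𝔞 ≤ 𝔟) {U V : OpenSubgroup G} (hUV : U ≤ V) :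
    levelIdeal 𝔞 U ≤ levelIdeal 𝔟 V := by
  intro x hx
  rw [levelIdeal, RingHom.mem_ker] at hx ⊢
  have key (y : MonoidAlgebra O (G ⧸ (U : Subgroup G)))
      (hy : MonoidAlgebra.mapRingHom _ (Ideal.Quotient.mk 𝔞) y = 0) :
      MonoidAlgebra.mapRingHom (G ⧸ (V : Subgroup G)) (Ideal.Quotient.mk 𝔟)
        (transition O G hUV y) = 0 := by
    have h1 : (MonoidAlgebra.mapRingHom (G ⧸ (V : Subgroup G)) (Ideal.Quotient.mk 𝔟)).comp
        (transition O G hUV).toRingHom = ((MonoidAlgebra.mapDomainRingHom (O ⧸ 𝔟)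
          (QuotientGroup.map (U : Subgroup G) (V : Subgroup G) (MonoidHom.id G) hUV)).comp
          (MonoidAlgebra.mapRingHom _ (Ideal.Quotient.factor h))).comp
          (MonoidAlgebra.mapRingHom _ (Ideal.Quotient.mk 𝔞)) := by
      ext <;> simp [transition]
    have h2 := RingHom.congr_fun h1 y
    rw [RingHom.comp_apply, RingHom.comp_apply, hy, map_zero] at h2
    exact h2
  have := key (level U x) hx
  rwa [transition_level] at this

section Topology

variable [TopologicalSpace O]

lemma isInducing_coeff : Topology.IsInducing
    fun (x : CompletedGroupAlgebra O G) (U : OpenSubgroup G) (g : G ⧸ (U : Subgroup G)) =>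
      (level U x).coeff g :=
  ⟨rfl⟩

variable [IsTopologicalRing O]

instance : IsTopologicalAddGroup (CompletedGroupAlgebra O G) := by
  let f : CompletedGroupAlgebra O G →+
      (∀ (U : OpenSubgroup G) (_ : G ⧸ (U : Subgroup G)), O) :=
    { toFun := fun x U g => (level U x).coeff g
      map_zero' := by
        funext U g
        rw [map_zero]
        rfl
      map_add' := fun x y => by
        funext U g
        rw [map_add]
        rfl }
  exact topologicalAddGroup_induced f

-- Coefficients at level `U` are sums of coefficients at any smaller level, so finitely many
-- conditions follow from one at the intersection of the levels with the largest exponent.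
omit [IsTopologicalRing O] in
lemma hasBasis_nhds_zero [IsTopologicalGroup G] [CompactSpace G] {𝔪 : Ideal O} (hO : IsAdic 𝔪) :
    (nhds (0 : CompletedGroupAlgebra O G)).HasBasis (fun _ : OpenSubgroup G × ℕ => True)
      fun i => levelIdeal (𝔪 ^ i.2) i.1 := by
  refine ⟨fun s => ⟨fun hs => ?_, ?_⟩⟩
  · rw [isInducing_coeff.nhds_eq_comap, Filter.mem_comap] at hs
    obtain ⟨t, ht, hts⟩ := hs
    simp only [nhds_pi, Filter.mem_pi] at ht
    obtain ⟨I, hI, t', ht', htt'⟩ := ht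
    choose J hJ t'' ht'' htt'' using ht'
    simp only [map_zero, MonoidAlgebra.coeff_zero, Finsupp.coe_zero, Pi.zero_apply,
      hO.hasBasis_nhds_zero.mem_iff, true_and] at ht''
    choose n hn using ht''
    let U₀ : OpenSubgroup G := hI.toFinset.inf id
    have hU₀ : ∀ U ∈ I, U₀ ≤ U := fun U hU => Finset.inf_le (f := id) (hI.mem_toFinset.2 hU)
    let N : ℕ := hI.toFinset.sup fun U => (hJ U).toFinset.sup (n U)
    have hN : ∀ U ∈ I, ∀ g ∈ J U, n U g ≤ N := fun U hU g hg =>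
      (Finset.le_sup (f := n U) ((hJ U).mem_toFinset.2 hg)).trans
        (Finset.le_sup (f := fun U => (hJ U).toFinset.sup (n U)) (hI.mem_toFinset.2 hU))
    refine ⟨(U₀, N), trivial, fun x hx => hts (htt' fun U hU => htt'' U fun g hg => ?_)⟩
    have := mem_levelIdeal.1 (levelIdeal_mono le_rfl (hU₀ U hU) hx) g
    exact hn U g (Ideal.pow_le_pow_right (hN U hU g hg) this)
  · rintro ⟨⟨U, n⟩, -, hs⟩
    refine Filter.mem_of_superset ?_ hs
    have : Finite (G ⧸ (U : Subgroup G)) := Subgroup.quotient_finite_of_isOpen _ U.isOpen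
    have h1 : (levelIdeal (𝔪 ^ n) U : Set (CompletedGroupAlgebra O G)) =
        ⋂ g, (fun x => (level U x).coeff g) ⁻¹' (𝔪 ^ n : Ideal O) := by
      ext x
      simp [mem_levelIdeal]
    dsimp only
    rw [h1]
    refine (Filter.iInter_mem).2 fun g => ?_
    have hc : Continuous fun x : CompletedGroupAlgebra O G => (level U x).coeff g :=
      (continuous_apply g).comp ((continuous_apply U).comp isInducing_coeff.continuous)
    refine hc.continuousAt.preimage_mem_nhds ?_
    rw [map_zero]
    exact hO.hasBasis_nhds_zero.mem_of_mem trivial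

lemma isTopologicalRing [IsTopologicalGroup G] [CompactSpace G] {𝔪 : Ideal O} (hO : IsAdic 𝔪) :
    IsTopologicalRing (CompletedGroupAlgebra O G) := by
  have hb := hasBasis_nhds_zero (G := G) hO
  refine IsTopologicalRing.of_addGroup_of_nhds_zero ?_ ?_ ?_
  · exact ((hb.prod_self).tendsto_iff hb).2 fun i _ =>
      ⟨i, trivial, fun x hx => Ideal.mul_mem_left _ _ hx.2⟩
  · exact fun x => (hb.tendsto_iff hb).2 fun i _ => ⟨i, trivial, fun y hy => Ideal.mul_mem_left _ _ hy⟩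
  · exact fun x => (hb.tendsto_iff hb).2 fun i _ => ⟨i, trivial, fun y hy => Ideal.mul_mem_right _ _ hy⟩

end Topology

end CompletedGroupAlgebra

namespace CompletedGroupAlgebra

variable {O : Type*} [CommRing O] {G : Type*} [CommGroup G] [TopologicalSpace G]

lemma coeff_transition {U V : OpenSubgroup G} (h : U ≤ V) [Fintype (G ⧸ (U : Subgroup G))]
    [DecidableEq (G ⧸ (V : Subgroup G))]
    (x : MonoidAlgebra O (G ⧸ (U : Subgroup G))) (g : G ⧸ (V : Subgroup G)) :
    (transition O G h x).coeff g =
      ∑ y with QuotientGroup.map (U : Subgroup G) (V : Subgroup G) (MonoidHom.id G) h y = g,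
        x.coeff y := by
  classical
  induction x using MonoidAlgebra.induction_linear with
  | zero => simp
  | add x y hx hy => simp only [map_add, MonoidAlgebra.coeff_add, Finsupp.add_apply, hx, hy,
      Finset.sum_add_distrib]
  | single a r =>
    rw [transition, MonoidAlgebra.mapDomainAlgHom_apply, MonoidAlgebra.mapDomain_single,
      MonoidAlgebra.coeff_single, Finsupp.single_apply]
    simp only [MonoidAlgebra.coeff_single, Finsupp.single_apply]
    rw [Finset.sum_ite_eq]
    simp

lemma level_groupElem_mul_coeff (U : OpenSubgroup G) (g : G) (x : CompletedGroupAlgebra O G)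
    (h : G) : (level U (groupElem O G g * x)).coeff (QuotientGroup.mk h) =
      (level U x).coeff (QuotientGroup.mk (g⁻¹ * h)) := by
  rw [map_mul, level_groupElem, MonoidAlgebra.coeff_single_mul_apply, one_mul]
  rfl

section Complete

variable {𝔪 : Ideal O}

lemma eq_zero_of_forall_mem_levelIdeal [IsHausdorff 𝔪 O] {x : CompletedGroupAlgebra O G}
    (hx : ∀ U n, x ∈ levelIdeal (𝔪 ^ n) U) : x = 0 := by
  refine CompletedGroupAlgebra.ext fun U => ?_
  rw [map_zero]
  ext g
  refine IsHausdorff.haus inferInstance (I := 𝔪) _ fun n => ?_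
  rw [SModEq.zero, smul_eq_mul, Ideal.mul_top]
  exact mem_levelIdeal.1 (hx U n) g

lemma exists_sub_mem_levelIdeal [IsTopologicalGroup G] [CompactSpace G] [IsAdicComplete 𝔪 O]
    (y : OpenSubgroup G × ℕ → CompletedGroupAlgebra O G)
    (hy : ∀ i k, k.1 ≤ i.1 → i.2 ≤ k.2 → y k - y i ∈ levelIdeal (𝔪 ^ i.2) i.1) :
    ∃ x, ∀ i, y i - x ∈ levelIdeal (𝔪 ^ i.2) i.1 := by
  classical
  have hsub (U : OpenSubgroup G) (x z : CompletedGroupAlgebra O G) (g) :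
      (level U (x - z)).coeff g = (level U x).coeff g - (level U z).coeff g := by
    rw [map_sub, MonoidAlgebra.coeff_sub, Finsupp.sub_apply]
  have h1 (U : OpenSubgroup G) (g : G ⧸ (U : Subgroup G)) :
      ∃ L : O, ∀ n, (level U (y (U, n))).coeff g - L ∈ 𝔪 ^ n := by
    obtain ⟨L, hL⟩ := IsPrecomplete.prec (I := 𝔪) (M := O) inferInstance
      (f := fun n => (level U (y (U, n))).coeff g) fun {m n} hmn => by
        rw [SModEq.sub_mem, smul_eq_mul, Ideal.mul_top, ← hsub, ← neg_mem_iff, ← Finsupp.neg_apply,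
          ← MonoidAlgebra.coeff_neg, ← map_neg, neg_sub]
        exact mem_levelIdeal.1 (hy (U, m) (U, n) le_rfl hmn) g
    refine ⟨L, fun n => ?_⟩
    have := hL n
    rwa [SModEq.sub_mem, smul_eq_mul, Ideal.mul_top] at this
  choose L hL using h1
  have hfin (U : OpenSubgroup G) : Finite (G ⧸ (U : Subgroup G)) :=
    Subgroup.quotient_finite_of_isOpen _ U.isOpen
  let x (U : OpenSubgroup G) : MonoidAlgebra O (G ⧸ (U : Subgroup G)) :=
    .ofCoeff (Finsupp.equivFunOnFinite.symm (L U))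
  have hx (U : OpenSubgroup G) (g) : (x U).coeff g = L U g := rfl
  refine ⟨ofCompatible x fun U V h => ?_, fun i => mem_levelIdeal.2 fun g => ?_⟩
  · ext g
    have := Fintype.ofFinite (G ⧸ (U : Subgroup G))
    rw [coeff_transition, hx, ← sub_eq_zero]
    refine IsHausdorff.haus inferInstance (I := 𝔪) _ fun n => ?_
    rw [SModEq.zero, smul_eq_mul, Ideal.mul_top]
    have h2 := mem_levelIdeal.1 (hy (V, n) (U, n) h le_rfl) g
    dsimp only at h2
    rw [hsub, ← transition_level h, coeff_transition] at h2
    have h3 : ∑ z with QuotientGroup.map (U : Subgroup G) (V : Subgroup G) (MonoidHom.id G) h z = g,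
        ((level U (y (U, n))).coeff z - L U z) ∈ 𝔪 ^ n := sum_mem fun z _ => hL U z n
    rw [Finset.sum_sub_distrib] at h3
    have h4 := add_mem (sub_mem h2 h3) (hL V g n)
    simp only [hx]
    convert h4 using 1
    ring
  · rw [hsub, level_ofCompatible, hx]
    exact hL i.1 g i.2

end Complete

/-! ### Non-zero-divisors in `O[[G]]`. -/

section Torsion

variable [IsDomain O]

-- Over the fraction field, `gcd(g, X^(p^a) - 1)` grows with `a` but divides `g`, so it is constant
-- from some `a₀` on and divides `X^(p^a₀) - 1`. Bézout and clearing denominators give the identity;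
-- the point is that `a₀` does not depend on `a`.
omit [IsDomain O] in
lemma _root_.Polynomial.exists_C_mul_X_pow_sub_one_eq [IsDomain O] {g : O[X]} (hg : g ≠ 0) (p : ℕ) :
    ∃ a₀ : ℕ, ∀ a, a₀ ≤ a → ∃ r : O, r ≠ 0 ∧ ∃ u v : O[X],
      Polynomial.C r * (Polynomial.X ^ p ^ a₀ - 1) = g * u + (Polynomial.X ^ p ^ a - 1) * v := by
  classical
  let F := FractionRing O
  let i : O[X] →+* F[X] := Polynomial.mapRingHom (algebraMap O F)
  have hi : Function.Injective i :=
    Polynomial.map_injective _ (FaithfulSMul.algebraMap_injective O F)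
  have hig : i g ≠ 0 := (map_ne_zero_iff i hi).2 hg
  let Y (a : ℕ) : F[X] := Polynomial.X ^ p ^ a - 1
  let E (a : ℕ) : F[X] := EuclideanDomain.gcd (i g) (Y a)
  have hEg (a : ℕ) : E a ∣ i g := EuclideanDomain.gcd_dvd_left _ _
  have hE0 (a : ℕ) : E a ≠ 0 := ne_zero_of_dvd_ne_zero hig (hEg a)
  have hmono {a b : ℕ} (hab : a ≤ b) : E a ∣ E b := by
    refine EuclideanDomain.dvd_gcd (hEg a) ((EuclideanDomain.gcd_dvd_right _ _).trans ?_)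
    obtain ⟨c, rfl⟩ := Nat.exists_eq_add_of_le hab
    have := sub_dvd_pow_sub_pow (Polynomial.X ^ p ^ a : F[X]) 1 (p ^ c)
    rwa [one_pow, ← pow_mul, ← pow_add] at this
  have hbdd : ∃ n, ∀ a, (E a).natDegree ≤ n :=
    ⟨_, fun a => Polynomial.natDegree_le_of_dvd (hEg a) hig⟩
  have hbdd' : BddAbove (Set.range fun a => (E a).natDegree) :=
    hbdd.imp fun n hn => by rintro _ ⟨a, rfl⟩; exact hn a
  obtain ⟨a₀, ha₀⟩ := Nat.sSup_mem (Set.range_nonempty _) hbdd'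
  refine ⟨a₀, fun a ha => ?_⟩
  have h1 : (E a).natDegree ≤ (E a₀).natDegree := by
    change (E a₀).natDegree = _ at ha₀
    rw [ha₀]
    exact le_csSup hbdd' ⟨a, rfl⟩
  have h2 : E a ∣ E a₀ := (Polynomial.associated_of_dvd_of_natDegree_le (hmono ha) (hE0 a) h1).symm.dvd
  obtain ⟨t, ht⟩ := h2.trans (EuclideanDomain.gcd_dvd_right (i g) (Y a₀))
  obtain ⟨A, B, h3⟩ : ∃ A B, E a = i g * A + Y a * B :=
    ⟨_, _, EuclideanDomain.gcd_eq_gcd_ab (i g) (Y a)⟩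
  have hint (P : F[X]) : ∃ b : O, b ≠ 0 ∧ ∃ Q, i Q = i (Polynomial.C b) * P := by
    obtain ⟨b, hb, hP⟩ := IsLocalization.integerNormalization_spec (nonZeroDivisors O) P
    refine ⟨b, nonZeroDivisors.ne_zero hb, _, hP.trans ?_⟩
    rw [Polynomial.coe_mapRingHom, Polynomial.map_C, ← Polynomial.smul_eq_C_mul]
    exact (algebraMap_smul F b _).symm
  obtain ⟨b, hb, A', hA⟩ := hint (A * t)
  obtain ⟨c, hc, B', hB⟩ := hint (B * t)
  refine ⟨b * c, mul_ne_zero hb hc, Polynomial.C c * A', Polynomial.C b * B', hi ?_⟩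
  have hiY (a : ℕ) : i (Polynomial.X ^ p ^ a - 1) = Y a := by simp [i, Y]
  simp only [map_add, map_mul, hA, hB, hiY, ht, h3]
  ring

lemma level_eq_zero_of_smul {a : O} (ha : a ≠ 0) {U : OpenSubgroup G}
    {x : CompletedGroupAlgebra O G} (hx : level U (a • x) = 0) : level U x = 0 := by
  ext g
  have h1 := congrArg (fun z => z.coeff g) hx
  simp only [map_smul, MonoidAlgebra.coeff_smul_apply, MonoidAlgebra.coeff_zero,
    Finsupp.coe_zero, Pi.zero_apply, smul_eq_mul, mul_eq_zero] at h1
  exact h1.resolve_left ha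

lemma eq_zero_of_smul_eq_zero {a : O} (ha : a ≠ 0) {x : CompletedGroupAlgebra O G}
    (hx : a • x = 0) : x = 0 :=
  CompletedGroupAlgebra.ext fun U => by
    rw [map_zero]
    exact level_eq_zero_of_smul ha (by rw [hx, map_zero])

omit [IsDomain O] in
/-- An element killed by `[δ] - 1` is zero if `δ` generates a pro-`p` subgroup of infinite order. -/
lemma eq_zero_of_groupElem_mul_eq [IsTopologicalGroup G] [CompactSpace G] {𝔪 : Ideal O}
    [IsHausdorff 𝔪 O] {p : ℕ} (hp : p.Prime) (hpm : (p : O) ∈ 𝔪) {δ : G}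
    (h1 : ∀ V : OpenSubgroup G, ∃ a : ℕ, δ ^ p ^ a ∈ V)
    (h2 : ∀ b : ℕ, ∃ V : OpenSubgroup G, δ ^ p ^ b ∉ V)
    {x : CompletedGroupAlgebra O G} (hx : groupElem O G δ * x = x) : x = 0 := by
  classical
  refine eq_zero_of_forall_mem_levelIdeal (𝔪 := 𝔪) fun V b => mem_levelIdeal.2 fun g => ?_
  obtain ⟨c, hc⟩ := h1 V
  let S : Subgroup G :=
    { carrier := {w | groupElem O G w * x = x}
      one_mem' := by rw [Set.mem_ofPred, map_one, one_mul]
      mul_mem' := fun {v w} hv hw => by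
        rw [Set.mem_ofPred] at hv hw ⊢
        rw [map_mul, mul_assoc, hw, hv]
      inv_mem' := fun {v} hv => by
        rw [Set.mem_ofPred] at hv ⊢
        conv_lhs => rw [← hv]
        rw [← mul_assoc, ← map_mul, inv_mul_cancel, map_one, one_mul] }
  -- `ε` lies in `V` but `ε^(p^b)` does not lie in `U₀`. The coefficients of `x` at level `U` are
  -- constant on cosets of `⟨ε⟩`, whose order modulo `U` is divisible by `p^b`, so the coefficients
  -- at level `U' = U⟨ε⟩ ≤ V` are divisible by `p^b`.
  obtain ⟨U₀, hU₀⟩ := h2 (c + b)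
  set ε := δ ^ p ^ c with hε
  let U : OpenSubgroup G := U₀ ⊓ V
  let U' : OpenSubgroup G := ⟨(U : Subgroup G) ⊔ Subgroup.zpowers ε,
    Subgroup.isOpen_mono (H₁ := (U : Subgroup G)) le_sup_left U.isOpen⟩
  have hUU' : U ≤ U' := fun u hu => Subgroup.mem_sup_left (S := (U : Subgroup G)) hu
  have hU'V : U' ≤ V := by
    have : (U : Subgroup G) ⊔ Subgroup.zpowers ε ≤ (V : Subgroup G) :=
      sup_le (fun u hu => hu.2) (by rwa [Subgroup.zpowers_le])
    exact this
  have hmem : x ∈ levelIdeal (𝔪 ^ b) U' := by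
    refine mem_levelIdeal.2 fun g => ?_
    have : Finite (G ⧸ (U : Subgroup G)) := Subgroup.quotient_finite_of_isOpen _ U.isOpen
    have := Fintype.ofFinite (G ⧸ (U : Subgroup G))
    rw [← transition_level hUU', coeff_transition]
    set f := QuotientGroup.map (U : Subgroup G) (U' : Subgroup G) (MonoidHom.id G) hUU' with hf
    obtain ⟨g, rfl⟩ := QuotientGroup.mk_surjective g
    have hconst : ∀ z ∈ Finset.univ.filter (fun z => f z = QuotientGroup.mk g),
        (level U x).coeff z = (level U x).coeff (QuotientGroup.mk g) := by
      intro z hz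
      obtain ⟨z, rfl⟩ := QuotientGroup.mk_surjective z
      rw [Finset.mem_filter] at hz
      have h3 : z⁻¹ * g ∈ (U : Subgroup G) ⊔ Subgroup.zpowers ε := QuotientGroup.eq.1 hz.2
      obtain ⟨u, hu, v, hv, huv⟩ := Subgroup.mem_sup.1 h3
      have hvS : groupElem O G v⁻¹ * x = x :=
        S.inv_mem (Subgroup.zpowers_le.2 (S.pow_mem hx _) hv)
      rw [← hvS, level_groupElem_mul_coeff, hvS]
      refine congrArg _ (QuotientGroup.eq.2 ?_)
      rwa [inv_inv, mul_inv_rev, mul_right_comm, ← huv, mul_inv_cancel_right]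
    rw [Finset.sum_congr rfl hconst, Finset.sum_const, nsmul_eq_mul]
    refine Ideal.mul_mem_right _ _ ?_
    have h3 : p ^ b ∣ Nat.card f.ker := by
      have h4 : (QuotientGroup.mk ε : G ⧸ (U : Subgroup G)) ∈ f.ker :=
        (QuotientGroup.eq_one_iff _).2 (Subgroup.mem_sup_right (Subgroup.mem_zpowers ε))
      refine dvd_trans ?_ (Subgroup.orderOf_dvd_natCard _ h4)
      obtain ⟨a, ha⟩ := h1 U
      have h5 : (QuotientGroup.mk ε : G ⧸ (U : Subgroup G)) ^ p ^ a = 1 := by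
        rw [← QuotientGroup.mk_pow, QuotientGroup.eq_one_iff, hε, pow_right_comm]
        exact Subgroup.pow_mem _ ha _
      obtain ⟨e, -, he⟩ := (Nat.dvd_prime_pow hp).1 (orderOf_dvd_of_pow_eq_one h5)
      rw [he]
      refine pow_dvd_pow _ (le_of_not_gt fun hlt => hU₀ ?_)
      have h6 : (QuotientGroup.mk ε : G ⧸ (U : Subgroup G)) ^ p ^ b = 1 :=
        orderOf_dvd_iff_pow_eq_one.1 (he ▸ pow_dvd_pow _ hlt.le)
      rw [← QuotientGroup.mk_pow, QuotientGroup.eq_one_iff, hε, ← pow_mul, ← pow_add] at h6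
      exact h6.1
    have h4 : (Finset.univ.filter (fun z => f z = QuotientGroup.mk g)).card = Nat.card f.ker := by
      rw [MonoidHom.card_fiber_eq_of_mem_range f (x := QuotientGroup.mk g) (y := 1) ⟨QuotientGroup.mk g, rfl⟩
        ⟨1, map_one f⟩,
        Nat.card_eq_fintype_card, Fintype.card_subtype]
      simp only [MonoidHom.mem_ker]
    rw [h4]
    obtain ⟨d, hd⟩ := h3
    rw [hd, Nat.cast_mul, Nat.cast_pow]
    exact Ideal.mul_mem_right _ _ (Ideal.pow_mem_pow hpm b)
  exact mem_levelIdeal.1 (levelIdeal_mono le_rfl hU'V hmem) g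

/-- A non-zero polynomial in `[γ]` is a non-zero-divisor if `γ` generates a pro-`p` subgroup of
infinite order. -/
lemma eq_zero_of_aeval_groupElem_mul_eq_zero [IsTopologicalGroup G] [CompactSpace G] {𝔪 : Ideal O}
    [IsHausdorff 𝔪 O] {p : ℕ} (hp : p.Prime) (hpm : (p : O) ∈ 𝔪) {γ : G}
    (h1 : ∀ V : OpenSubgroup G, ∃ a : ℕ, γ ^ p ^ a ∈ V)
    (h2 : ∀ b : ℕ, ∃ V : OpenSubgroup G, γ ^ p ^ b ∉ V) {g : O[X]} (hg : g ≠ 0)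
    {x : CompletedGroupAlgebra O G} (hx : Polynomial.aeval (groupElem O G γ) g * x = 0) :
    x = 0 := by
  obtain ⟨a₀, ha₀⟩ := Polynomial.exists_C_mul_X_pow_sub_one_eq hg p
  -- At level `U` choose `a` with `γ^(p^a) ∈ U`. The polynomial identity, multiplied by `x`, shows
  -- that a nonzero scalar kills `([γ]^(p^a₀) - 1) x` at that level. As `a₀` is independent of `U`,
  -- the product vanishes.
  have key : (groupElem O G γ ^ p ^ a₀ - 1) * x = 0 := by
    refine CompletedGroupAlgebra.ext fun U => ?_
    obtain ⟨a, ha⟩ := h1 U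
    obtain ⟨r, hr, u, v, huv⟩ := ha₀ (a₀ + a) (Nat.le_add_right _ _)
    have h3 := congrArg (fun P => Polynomial.aeval (groupElem O G γ) P * x) huv
    simp only [map_mul, map_add, map_sub, map_pow, Polynomial.aeval_X, Polynomial.aeval_C,
      map_one, add_mul] at h3
    rw [mul_right_comm (Polynomial.aeval _ g), hx, zero_mul, zero_add] at h3
    have h4 : level U (groupElem O G γ ^ p ^ (a₀ + a) - 1) = 0 := by
      rw [← map_pow, map_sub, level_groupElem, map_one, sub_eq_zero, MonoidAlgebra.one_def]
      congr 1
      rw [QuotientGroup.eq_one_iff, add_comm, pow_add, pow_mul]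
      exact Subgroup.pow_mem _ ha _
    have h5 := congrArg (level U) h3
    rw [mul_assoc _ _ x, map_mul (level U) _ x, map_mul (level U) _ (Polynomial.aeval _ v), h4,
      zero_mul, zero_mul, ← Algebra.smul_def] at h5
    rw [map_zero]
    exact level_eq_zero_of_smul hr h5
  rw [sub_mul, one_mul, sub_eq_zero, ← map_pow] at key
  refine eq_zero_of_groupElem_mul_eq hp hpm (fun V => ?_) (fun b => ?_) key
  · obtain ⟨a, ha⟩ := h1 V
    exact ⟨a, by rw [pow_right_comm]; exact Subgroup.pow_mem _ ha _⟩
  · obtain ⟨V, hV⟩ := h2 (a₀ + b)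
    exact ⟨V, by rwa [← pow_mul, ← pow_add]⟩

end Torsion

end CompletedGroupAlgebra

/-! ### `O[[G]]` as an induced module over a finite subgroup. -/

namespace CompletedGroupAlgebra

variable {O : Type*} [CommRing O] {G : Type*} [CommGroup G] [TopologicalSpace G]

section Weight

variable {V : OpenSubgroup G} (ε : G ⧸ (V : Subgroup G) → O)

/-- Pointwise multiplication of an element of `O[G/U]` by a function on `G/V`, where `U ≤ V`. -/
def weightLevel {U : OpenSubgroup G} (h : U ≤ V) :
    MonoidAlgebra O (G ⧸ (U : Subgroup G)) →+ MonoidAlgebra O (G ⧸ (U : Subgroup G)) :=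
  (Finsupp.liftAddHom fun g => (MonoidAlgebra.singleAddHom g).comp (AddMonoidHom.mulLeft
    (ε (QuotientGroup.map (U : Subgroup G) (V : Subgroup G) (MonoidHom.id G) h g)))).comp
      MonoidAlgebra.coeffAddEquiv.toAddMonoidHom

lemma weightLevel_single {U : OpenSubgroup G} (h : U ≤ V) (g : G) (a : O) :
    weightLevel ε h (MonoidAlgebra.single (QuotientGroup.mk g) a) =
      MonoidAlgebra.single (QuotientGroup.mk g) (ε (QuotientGroup.mk g) * a) := by
  change Finsupp.liftAddHom _ (Finsupp.single _ a) = _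
  rw [Finsupp.liftAddHom_apply_single]
  rfl

lemma transition_weightLevel {U U' : OpenSubgroup G} (h : U ≤ U') (h' : U' ≤ V)
    (x : MonoidAlgebra O (G ⧸ (U : Subgroup G))) :
    transition O G h (weightLevel ε (h.trans h') x) = weightLevel ε h' (transition O G h x) := by
  induction x using MonoidAlgebra.induction_linear with
  | zero => simp only [map_zero]
  | add x y hx hy => simp only [map_add, hx, hy]
  | single g a =>
    obtain ⟨g, rfl⟩ := QuotientGroup.mk_surjective g
    simp only [transition_single, weightLevel_single]

/-- Pointwise multiplication of a measure on `G` by a function on `G/V`. -/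
def weight : CompletedGroupAlgebra O G →+ CompletedGroupAlgebra O G where
  toFun x := ofCompatible
    (fun U => transition O G inf_le_left
      (weightLevel ε (inf_le_right : U ⊓ V ≤ V) (level (U ⊓ V) x)))
    fun U U' h => by
      have h' : U ⊓ V ≤ U' ⊓ V := inf_le_inf_right V h
      rw [transition_transition, ← transition_level h' x, ← transition_weightLevel ε h',
        transition_transition]
  map_zero' := CompletedGroupAlgebra.ext fun U => by
    rw [level_ofCompatible]
    simp only [map_zero]
  map_add' x y := CompletedGroupAlgebra.ext fun U => by
    rw [map_add, level_ofCompatible, level_ofCompatible, level_ofCompatible]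
    simp only [map_add]

lemma level_weight (x : CompletedGroupAlgebra O G) (U : OpenSubgroup G) :
    level U (weight ε x) = transition O G inf_le_left
      (weightLevel ε (inf_le_right : U ⊓ V ≤ V) (level (U ⊓ V) x)) :=
  rfl

/-- On a group element `g` the sum is `∑ h⁻¹ ε(hg) hg = (∑ ε(hg)) g`. -/
lemma sum_groupElem_mul_weight {H : Type*} [Fintype H] [Group H] (i : H →* G)
    (hε : ∀ g : G, ∑ h : H, ε (QuotientGroup.mk (i h * g)) = 1) (x : CompletedGroupAlgebra O G) :
    ∑ h : H, groupElem O G (i h)⁻¹ * weight ε (groupElem O G (i h) * x) = x := by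
  refine CompletedGroupAlgebra.ext fun U => ?_
  rw [← transition_level (inf_le_left : U ⊓ V ≤ U) x, map_sum]
  simp only [map_mul, level_weight, level_groupElem]
  simp only [← transition_single (inf_le_left : U ⊓ V ≤ U), ← map_mul, ← map_sum]
  congr 1
  generalize level (U ⊓ V) x = y
  induction y using MonoidAlgebra.induction_linear with
  | zero => simp only [mul_zero, map_zero, Finset.sum_const_zero]
  | add x y hx hy => simp only [mul_add, map_add, Finset.sum_add_distrib, hx, hy]
  | single g a =>
    obtain ⟨g, rfl⟩ := QuotientGroup.mk_surjective g
    simp only [MonoidAlgebra.single_mul_single, one_mul, ← QuotientGroup.mk_mul,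
      weightLevel_single, inv_mul_cancel_left]
    have h1 : ∑ h : H, MonoidAlgebra.single (QuotientGroup.mk g : G ⧸ ((U ⊓ V : OpenSubgroup G) : Subgroup G))
        (ε (QuotientGroup.mk (i h * g)) * a) =
        MonoidAlgebra.single (QuotientGroup.mk g) (∑ h : H, ε (QuotientGroup.mk (i h * g)) * a) :=
      (map_sum (MonoidAlgebra.singleAddHom _) _ _).symm
    rw [h1, ← Finset.sum_mul, hε, one_mul]

end Weight

/-- For a finite subgroup `H` of a profinite group `G`, the `H`-module `O[[G]]` is induced. -/
lemma exists_sum_groupElem_mul [IsTopologicalGroup G] {H : Type*} [Fintype H] [Group H]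
    (i : H →* G) (V : OpenSubgroup G) (hV : ∀ h, i h ∈ V → h = 1) :
    ∃ θ : CompletedGroupAlgebra O G →+ CompletedGroupAlgebra O G, ∀ x,
      ∑ h : H, groupElem O G (i h)⁻¹ * θ (groupElem O G (i h) * x) = x := by
  classical
  let f : H →* G ⧸ (V : Subgroup G) := (QuotientGroup.mk' _).comp i
  have hf : Function.Injective f := (injective_iff_map_eq_one f).2 fun h hh =>
    hV h ((QuotientGroup.eq_one_iff _).1 hh)
  -- The weight is the indicator function of representatives for the cosets of `H` in `G/V`: for
  -- each `g` exactly one `h` brings `hg` into `S`.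
  obtain ⟨S, hS, -⟩ := f.range.exists_isComplement_right 1
  refine ⟨weight (V := V) (fun g => if g ∈ S then 1 else 0), sum_groupElem_mul_weight _ i fun g => ?_⟩
  obtain ⟨t, ⟨b, hb⟩, huniq⟩ :=
    Subgroup.isComplement_iff_existsUnique_mul_inv_mem.1 hS (QuotientGroup.mk g)
  have hmk (h : H) : (QuotientGroup.mk (i h * g) : G ⧸ (V : Subgroup G)) = f h * QuotientGroup.mk g :=
    rfl
  rw [Finset.sum_eq_single b⁻¹ (fun h _ hh => if_neg fun hmem => hh ?_)
    fun h => (h (Finset.mem_univ _)).elim]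
  · refine if_pos ?_
    rw [hmk, map_inv, hb, mul_inv_rev, inv_inv, inv_mul_cancel_right]
    exact t.2
  · rw [hmk] at hmem
    have h1 := congrArg Subtype.val (huniq ⟨_, hmem⟩ ⟨h⁻¹, by
      rw [map_inv, mul_inv_rev, mul_inv_cancel_left]⟩)
    apply hf
    rw [map_inv, hb, ← h1, mul_inv_rev, inv_inv]
    exact (mul_inv_cancel_right _ _).symm

end CompletedGroupAlgebra

/-! ### Linear topologies on free modules and continuity of cocycles. -/

section Coordinates

variable {R M κ : Type*} [CommRing R] [AddCommGroup M] [Module R M]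

/-- The submodule of elements all of whose coordinates lie in the ideal `J`. -/
def coordSubmodule (B : Module.Basis κ R M) (J : Ideal R) : Submodule R M where
  carrier := {x | ∀ l, B.repr x l ∈ J}
  zero_mem' l := by simp
  add_mem' hx hy l := by
    rw [map_add]
    exact J.add_mem (hx l) (hy l)
  smul_mem' r x hx l := by
    rw [map_smul]
    exact J.mul_mem_left _ (hx l)

variable (B : Module.Basis κ R M) {J : Ideal R}

lemma smul_mem_coordSubmodule {r : R} (hr : r ∈ J) (x : M) : r • x ∈ coordSubmodule B J := by
  intro l
  rw [map_smul]
  exact J.mul_mem_right _ hr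

lemma map_mem_coordSubmodule [Finite κ] (f : M →ₗ[R] M) {x : M} (hx : x ∈ coordSubmodule B J) :
    f x ∈ coordSubmodule B J := by
  have := Fintype.ofFinite κ
  rw [← B.sum_repr x, map_sum]
  refine sum_mem fun l _ => ?_
  rw [map_smul]
  exact smul_mem_coordSubmodule B (hx l) _

lemma hasBasis_moduleTopology [TopologicalSpace R] [IsTopologicalRing R] [Finite κ] {ι : Type*}
    {J : ι → Ideal R} (hJ : (nhds (0 : R)).HasBasis (fun _ => True) fun i => (J i : Set R)) :
    (@nhds M (moduleTopology R M) 0).HasBasis (fun _ => True)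
      fun i => (coordSubmodule B (J i) : Set M) := by
  have := Fintype.ofFinite κ
  let τ : TopologicalSpace M := TopologicalSpace.induced B.equivFun inferInstance
  let e : (κ → R) ≃L[R] M :=
    { B.equivFun.symm with
      continuous_toFun := continuous_induced_rng.2 (by
        have h : ⇑B.equivFun ∘ ⇑B.equivFun.symm = id :=
          funext fun x => B.equivFun.apply_symm_apply x
        exact h ▸ continuous_id)
      continuous_invFun := continuous_induced_dom }
  have hM : IsModuleTopology R M := IsModuleTopology.iso e
  rw [← eq_moduleTopology R M, nhds_induced, map_zero]
  have hb : (nhds (0 : κ → R)).HasBasis (fun _ => True)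
      fun i => {x : κ → R | ∀ l, x l ∈ J i} := by
    refine ⟨fun s => ⟨fun hs => ?_, ?_⟩⟩
    · rw [nhds_pi, Filter.mem_pi'] at hs
      obtain ⟨I, t, ht, hts⟩ := hs
      have h1 : ⋂ l, t l ∈ nhds (0 : R) := (Filter.iInter_mem).2 ht
      obtain ⟨i, -, hi⟩ := hJ.mem_iff.1 h1
      exact ⟨i, trivial, fun x hx => hts fun l _ => Set.mem_iInter.1 (hi (hx l)) l⟩
    · rintro ⟨i, -, hi⟩
      rw [nhds_pi]
      refine Filter.mem_of_superset (Filter.pi_mem_pi Set.finite_univ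
        fun l _ => hJ.mem_of_mem (i := i) trivial) ?_
      exact fun x hx => hi fun l => hx l trivial
  exact hb.comap _

/-- A cocycle with values in a linearly topologized module on which the group acts linearly is
continuous if and only if it is so at `1`. -/
lemma continuous_cocycle_iff {G : Type*} [Group G] [TopologicalSpace G] [IsTopologicalGroup G]
    [TopologicalSpace M] [IsTopologicalAddGroup M] {ι : Type*} {W : ι → Submodule R M}
    (hW : (nhds (0 : M)).HasBasis (fun _ => True) fun i => (W i : Set M))
    (ρ : Representation R G M) (hρ : ∀ i g, ∀ x ∈ W i, ρ g x ∈ W i) (c : G → M)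
    (hc : ∀ g h, c (g * h) = c g + ρ g (c h)) :
    Continuous c ↔ ∀ i, ∃ V : Subgroup G, IsOpen (V : Set G) ∧ ∀ v ∈ V, c v ∈ W i := by
  have hc1 := TameAction.cocycle_one hc
  constructor
  · intro h i
    let V : Subgroup G :=
      { carrier := {g | c g ∈ W i}
        one_mem' := by rw [Set.mem_ofPred, hc1]; exact zero_mem _
        mul_mem' := fun {g h} hg hh => by
          rw [Set.mem_ofPred, hc]
          exact add_mem hg (hρ i g _ hh)
        inv_mem' := fun {g} hg => by
          have h1 := hc g⁻¹ g
          rw [inv_mul_cancel, hc1, eq_comm, add_eq_zero_iff_eq_neg] at h1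
          rw [Set.mem_ofPred, h1]
          exact neg_mem (hρ i _ _ hg) }
    refine ⟨V, Subgroup.isOpen_of_mem_nhds (g := 1) V ?_, fun v hv => hv⟩
    refine h.continuousAt.preimage_mem_nhds ?_
    rw [hc1]
    exact hW.mem_of_mem trivial
  · intro h
    rw [continuous_iff_continuousAt]
    intro g
    have h1 : Filter.Tendsto c (nhds 1) (nhds 0) := by
      refine hW.tendsto_right_iff.2 fun i _ => ?_
      obtain ⟨V, hV, hVc⟩ := h i
      exact Filter.mem_of_superset (hV.mem_nhds V.one_mem) hVc
    have h2 : Filter.Tendsto (fun x => c g + ρ g (c (g⁻¹ * x))) (nhds g) (nhds (c g + 0)) := by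
      refine tendsto_const_nhds.add ?_
      have h3 : Filter.Tendsto (fun x => g⁻¹ * x) (nhds g) (nhds 1) := by
        have := (continuous_const_mul g⁻¹).tendsto g
        rwa [inv_mul_cancel] at this
      have h4 : Filter.Tendsto (ρ g) (nhds 0) (nhds 0) :=
        (hW.tendsto_iff hW).2 fun i _ => ⟨i, trivial, hρ i g⟩
      exact h4.comp (h1.comp h3)
    rw [add_zero] at h2
    refine h2.congr fun x => ?_
    rw [← hc, mul_inv_cancel_left]

end Coordinates

/-! ### Characteristic ideals and comparison of presentations. -/

section CharIdeal

variable {R M N : Type*} [CommRing R] [AddCommGroup M] [Module R M] [AddCommGroup N] [Module R N]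

/-- Unwinds the bidual: functionals on the exterior power of the dual are alternating forms, and the
identification with `R` evaluates them on the coordinate functionals. -/
lemma mem_charIdeal {s : ℕ} {φ : (Fin s → R) →ₗ[R] M} {a : R} : a ∈ charIdeal φ ↔
    ∃ Ψ : Module.Dual R (LinearMap.ker φ) [⋀^Fin s]→ₗ[R] R,
      Ψ (fun i => (LinearMap.proj i).comp (LinearMap.ker φ).subtype) = a := by
  have key (F : ExteriorBidual R s (LinearMap.ker φ)) :
      (exteriorBidualFree s ∘ₗ exteriorBidualMap s (LinearMap.ker φ).subtype) F =
        F (exteriorPower.ιMulti R s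
          fun i => (LinearMap.proj i).comp (LinearMap.ker φ).subtype) := by
    change F (exteriorPower.map s _ (exteriorPower.ιMulti R s _)) = _
    rw [exteriorPower.map_apply_ιMulti]
    rfl
  rw [charIdeal, LinearMap.mem_range]
  constructor
  · rintro ⟨F, rfl⟩
    exact ⟨exteriorPower.alternatingMapLinearEquiv.symm F, (key F).symm⟩
  · rintro ⟨Ψ, rfl⟩
    refine ⟨exteriorPower.alternatingMapLinearEquiv Ψ, (key _).trans ?_⟩
    rw [exteriorPower.alternatingMapLinearEquiv_apply_ιMulti]

/-- The wedge product of an alternating form on `N` with the determinant on `R^κ`. -/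
lemma exists_alternatingMap_prod {ι κ : Type*} [Fintype ι] [DecidableEq ι] [Fintype κ]
    [DecidableEq κ] (Ψ : N [⋀^ι]→ₗ[R] R) :
    ∃ Θ : (N × (κ → R)) [⋀^ι ⊕ κ]→ₗ[R] R, ∀ n : ι → N,
      Θ (Sum.elim (fun i => (n i, 0)) fun l => (0, Pi.single l 1)) = Ψ n := by
  let a := Ψ.compLinearMap (LinearMap.fst R N (κ → R))
  let b := (Matrix.detRowAlternating (n := κ) (R := R)).compLinearMap (LinearMap.snd R N (κ → R))
  refine ⟨(LinearMap.mul' R R).compAlternatingMap (a.domCoprod b), fun n => ?_⟩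
  set v : ι ⊕ κ → N × (κ → R) := Sum.elim (fun i => (n i, 0)) fun l => (0, Pi.single l 1) with hv
  have hval (σ : Equiv.Perm (ι ⊕ κ)) : AlternatingMap.domCoprod.summand a b (Quotient.mk'' σ) v =
      Equiv.Perm.sign σ • (a (fun i => v (σ (Sum.inl i))) ⊗ₜ[R] b fun l => v (σ (Sum.inr l))) :=
    rfl
  -- Of the sum over shuffles only the trivial class survives: any other one puts some `(0, e_l)`
  -- into an argument of `Ψ`.
  have h1 : (a.domCoprod b) v = a (fun i => v (Sum.inl i)) ⊗ₜ[R] b fun l => v (Sum.inr l) := by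
    rw [AlternatingMap.domCoprod_apply, sum_apply]
    refine (Finset.sum_eq_single (Quotient.mk'' 1 : Equiv.Perm.ModSumCongr ι κ)
      (fun σ _ hσ => ?_) fun h => (h (Finset.mem_univ _)).elim).trans ?_
    rotate_left
    · rw [hval, Equiv.Perm.sign_one, one_smul]
      rfl
    · induction σ using Quotient.inductionOn' with | _ σ
      by_cases hmaps : Set.MapsTo σ (Set.range (Sum.inl : ι → ι ⊕ κ)) (Set.range Sum.inl)
      · refine absurd ?_ hσ
        refine Quotient.sound' ?_
        rw [QuotientGroup.leftRel_apply, mul_one, inv_mem_iff]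
        exact Equiv.Perm.mem_sumCongrHom_range_of_perm_mapsTo_inl hmaps
      · simp only [Set.MapsTo, Set.forall_mem_range, not_forall] at hmaps
        obtain ⟨i, hi⟩ := hmaps
        rw [hval]
        have h2 : a (fun i => v (σ (Sum.inl i))) = 0 := by
          rcases hx : σ (Sum.inl i) with i' | l
          · exact absurd ⟨i', hx.symm⟩ hi
          · refine Ψ.map_coord_zero i ?_
            change (v (σ (Sum.inl i))).1 = 0
            rw [hx]
            rfl
        rw [h2, TensorProduct.zero_tmul, smul_zero]
  rw [LinearMap.compAlternatingMap_apply, h1, LinearMap.mul'_apply]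
  have h2 : (b fun l => v (Sum.inr l)) = 1 := by
    change Matrix.det (Matrix.of fun l => Pi.single l 1) = 1
    have h3 : (Matrix.of fun l => Pi.single l 1 : Matrix κ κ R) = 1 := by
      ext l l'
      rw [Matrix.of_apply, Matrix.one_apply, Pi.single_apply]
      exact if_congr eq_comm rfl rfl
    rw [h3, Matrix.det_one]
  rw [h2, mul_one]
  rfl

variable {κ : Type*} [Fintype κ] [DecidableEq κ] {s : ℕ} (φ : (Fin s → R) →ₗ[R] M)
  (α : (κ → R) →ₗ[R] M) (A : Matrix κ κ R)

omit [Fintype κ] [DecidableEq κ] in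
lemma exists_matrix_map_mulVec_eq {κ ι : Type*} [Fintype κ] [DecidableEq κ] [Fintype ι]
    [DecidableEq ι] (φ : (ι → R) →ₗ[R] M) (α : (κ → R) →ₗ[R] M) (hα : Function.Surjective α) :
    ∃ B : Matrix κ ι R, ∀ x, α (B.mulVec x) = φ x := by
  choose b hb using fun i => hα (φ (Pi.single i 1))
  refine ⟨Matrix.of fun l i => b i l, fun x => ?_⟩
  have h : α ∘ₗ (Matrix.of fun l i => b i l).mulVecLin = φ := by
    refine LinearMap.pi_ext' fun i => LinearMap.ext_ring ?_
    rw [LinearMap.comp_apply, LinearMap.comp_apply, LinearMap.single_apply,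
      Matrix.mulVecLin_apply, Matrix.mulVec_single_one, LinearMap.comp_apply,
      LinearMap.single_apply, ← hb i]
    rfl
  exact LinearMap.congr_fun h x

variable {φ α A}

/-- This block matrix compares two presentations of the same module, as in Schanuel's lemma. -/
lemma det_fromBlocks_one_sub {ι : Type*} [Fintype ι] [DecidableEq ι] (A : Matrix κ κ R)
    (B : Matrix κ ι R) (D : Matrix ι κ R) :
    (Matrix.fromBlocks (1 - D * B) (D * A) (-B) A).det = A.det := by
  have h : Matrix.fromBlocks (1 - D * B) (D * A) (-B) A =
      Matrix.fromBlocks 1 D 0 1 * Matrix.fromBlocks 1 0 (-B) A := by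
    rw [Matrix.fromBlocks_multiply]
    simp [sub_eq_add_neg]
  rw [h, Matrix.det_mul, Matrix.det_fromBlocks_zero₂₁, Matrix.det_fromBlocks_zero₁₂]
  simp

/-- The columns of `P = (1 - DB | DA)` lie in `ker φ`. Applying `s` functionals to them and adding
the rows `(-B | A)` gives a determinant alternating in the functionals. On the coordinate
functionals it equals `det A`. -/
lemma det_mem_charIdeal (hφ : Function.Surjective φ) (hα : Function.Surjective α)
    (hA : ∀ x, α (A.mulVec x) = 0) : A.det ∈ charIdeal φ := by
  obtain ⟨B, hB⟩ := exists_matrix_map_mulVec_eq φ α hα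
  obtain ⟨D, hD⟩ := exists_matrix_map_mulVec_eq α φ hφ
  let P : Matrix (Fin s) (Fin s ⊕ κ) R := Matrix.fromCols (1 - D * B) (D * A)
  have hP (x) : P.mulVec x ∈ LinearMap.ker φ := by
    rw [LinearMap.mem_ker, Matrix.fromCols_mulVec, map_add, Matrix.sub_mulVec, map_sub,
      Matrix.one_mulVec, ← Matrix.mulVec_mulVec, ← Matrix.mulVec_mulVec, hD, hD, hA, hB, sub_self,
      add_zero]
  let u : (Fin s ⊕ κ → R) →ₗ[R] LinearMap.ker φ := P.mulVecLin.codRestrict _ hP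
  let row (f : Module.Dual R (LinearMap.ker φ)) : Fin s ⊕ κ → R := fun x => f (u (Pi.single x 1))
  let C : Matrix κ (Fin s ⊕ κ) R := Matrix.fromCols (-B) A
  let Y (f : Fin s → Module.Dual R (LinearMap.ker φ)) : Matrix (Fin s ⊕ κ) (Fin s ⊕ κ) R :=
    Matrix.fromRows (Matrix.of fun i => row (f i)) C
  have hY (f i x) : Y (Function.update f i x) = (Y f).updateRow (Sum.inl i) (row x) := by
    refine Matrix.ext fun l l' => ?_
    rcases l with l | l
    · rw [Matrix.updateRow_apply]
      simp only [Sum.inl.injEq]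
      split_ifs with h
      · subst h
        change row (Function.update f l x l) l' = _
        rw [Function.update_self]
      · change row (Function.update f i x l) l' = _
        rw [Function.update_of_ne h]
        rfl
    · rw [Matrix.updateRow_ne Sum.inr_ne_inl]
      rfl
  rw [mem_charIdeal]
  refine ⟨{ toFun := fun f => (Y f).det
            map_update_add' := ?_
            map_update_smul' := ?_
            map_eq_zero_of_eq' := ?_ }, ?_⟩
  · intro inst f i x y
    obtain rfl : inst = instDecidableEqFin s := Subsingleton.elim _ _
    rw [hY, hY, hY, ← Matrix.det_updateRow_add]
    rfl
  · intro inst f i r x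
    obtain rfl : inst = instDecidableEqFin s := Subsingleton.elim _ _
    rw [hY, hY, smul_eq_mul, ← Matrix.det_updateRow_smul]
    rfl
  · intro f i i' h hi
    refine Matrix.det_zero_of_row_eq (i := Sum.inl i) (j := Sum.inl i') (by simpa using hi) ?_
    change row (f i) = row (f i')
    rw [h]
  · rw [← det_fromBlocks_one_sub A B D]
    change Matrix.det (Matrix.fromRows _ C) = _
    rw [← Matrix.fromRows_fromCols_eq_fromBlocks]
    congr 2
    refine Matrix.ext fun i x => ?_
    change P.mulVec (Pi.single x 1) i = _
    rw [Matrix.mulVec_single_one]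
    rfl

/-- The characteristic ideal of a module with a square presentation. -/
lemma pow_mul_mem_span_det (hφ : Function.Surjective φ) (hα : Function.Surjective α)
    (hdet : A.det ∈ nonZeroDivisors R) {c : R}
    (hc : ∀ x, α x = 0 → ∃ y, A.mulVec y = c • x) {a : R} (ha : a ∈ charIdeal φ) :
    c ^ (s + Fintype.card κ) * a ∈ Ideal.span {A.det} := by
  obtain ⟨B, hB⟩ := exists_matrix_map_mulVec_eq φ α hα
  obtain ⟨D, hD⟩ := exists_matrix_map_mulVec_eq α φ hφ
  have hinj : Function.Injective A.mulVec := by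
    refine (injective_iff_map_eq_zero A.mulVecLin).2 fun x hx => ?_
    have h1 : A.adjugate.mulVec (A.mulVec x) = 0 := by
      rw [← Matrix.mulVecLin_apply A, hx, Matrix.mulVec_zero]
    rw [Matrix.mulVec_mulVec, Matrix.adjugate_mul, Matrix.smul_mulVec, Matrix.one_mulVec] at h1
    funext l
    have h2 := congrFun h1 l
    rw [Pi.smul_apply, smul_eq_mul, mul_comm] at h2
    exact (mul_right_mem_nonZeroDivisors_eq_zero_iff hdet).1 h2
  -- `g n` stands for `c A⁻¹ B n`; injectivity of `A` makes it linear in `n`. Likewise `E` below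
  -- stands for `c A⁻¹ (BD - 1)`.
  choose g hg using fun n : LinearMap.ker φ => hc (B.mulVec n) (by rw [hB, n.2])
  let gL : LinearMap.ker φ →ₗ[R] κ → R :=
    { toFun := g
      map_add' := fun x y => hinj (by
        rw [Matrix.mulVec_add, hg, hg, hg, Submodule.coe_add, Matrix.mulVec_add, smul_add])
      map_smul' := fun r x => hinj (by
        rw [RingHom.id_apply, Matrix.mulVec_smul, hg, hg, Submodule.coe_smul, Matrix.mulVec_smul,
          smul_comm]) }
  choose e he using fun l : κ => hc ((B * D).mulVec (Pi.single l 1) - Pi.single l 1) (by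
    rw [map_sub, ← Matrix.mulVec_mulVec, hB, hD, sub_self])
  let E : Matrix κ κ R := Matrix.of fun l l' => e l' l
  have hE : A * E = c • (B * D - 1) := by
    refine Matrix.ext fun l l' => ?_
    have h1 := congrFun (he l') l
    rw [Pi.smul_apply, Pi.sub_apply, Matrix.mulVec_single_one, Pi.single_apply] at h1
    rw [Matrix.smul_apply, Matrix.sub_apply, Matrix.one_apply]
    exact h1
  obtain ⟨Ψ, rfl⟩ := mem_charIdeal.1 ha
  obtain ⟨Θ, hΘ⟩ := exists_alternatingMap_prod (κ := κ) Ψ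
  -- `V₁` and `V₂` invert `W` up to `c`: `W V₁ n = (c n, 0)` and `W V₂ = (0, c)`. Dually, `L` sends
  -- the rows of `W` to `c` times the coordinate functionals and the standard basis.
  let W : Matrix (Fin s ⊕ κ) (Fin s ⊕ κ) R := Matrix.fromBlocks (1 - D * B) (D * A) (-B) A
  let V₁ : LinearMap.ker φ →ₗ[R] Fin s ⊕ κ → R :=
    { toFun := fun n => Sum.elim (c • (n : Fin s → R)) (gL n)
      map_add' := fun x y => by
        rw [map_add, Submodule.coe_add, smul_add, Sum.elim_add_add]
      map_smul' := fun r x => by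
        funext l
        rcases l with l | l
        · exact congrFun (smul_comm c r (x : Fin s → R)) l
        · exact congrFun (gL.map_smul r x) l }
  let V₂ : Matrix (Fin s ⊕ κ) κ R := Matrix.fromRows (-(c • D)) (-E)
  let L : (Fin s ⊕ κ → R) →ₗ[R] Module.Dual R (LinearMap.ker φ) × (κ → R) :=
    ((LinearMap.lcomp R R V₁).comp (dotProductBilin R R)).prod V₂.vecMulLinear
  have hW₁ (n : LinearMap.ker φ) : W.mulVec (V₁ n) = Sum.elim (c • (n : Fin s → R)) 0 := by
    have h : A.mulVec (gL n) = c • B.mulVec n := hg n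
    change W.mulVec (Sum.elim (c • (n : Fin s → R)) (gL n)) = _
    rw [Matrix.fromBlocks_mulVec, Sum.elim_comp_inl, Sum.elim_comp_inr, ← Matrix.mulVec_mulVec, h,
      Matrix.neg_mulVec, Matrix.mulVec_smul B, neg_add_cancel, Matrix.sub_mulVec,
      Matrix.one_mulVec, ← Matrix.mulVec_mulVec, Matrix.mulVec_smul B, sub_add_cancel]
  have hW₂ : W * V₂ = Matrix.fromRows 0 (c • 1) := by
    rw [Matrix.fromBlocks_mul_fromRows]
    have h1 : (1 - D * B) * -(c • D) + D * A * -E = 0 := by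
      rw [Matrix.mul_assoc, Matrix.mul_neg A, hE]
      simp only [Matrix.mul_neg, Matrix.mul_smul, Matrix.sub_mul, Matrix.mul_sub, Matrix.one_mul,
        Matrix.mul_one, Matrix.mul_assoc, smul_sub]
      abel
    have h2 : -B * -(c • D) + A * -E = c • 1 := by
      rw [Matrix.mul_neg A, hE]
      simp only [Matrix.neg_mul, Matrix.mul_neg, Matrix.mul_smul, smul_sub, smul_neg, neg_neg]
      abel
    rw [h1, h2]
  have hL (i) : L (W.row i) = c • Sum.elim (fun i => ((LinearMap.proj i).comp
      (LinearMap.ker φ).subtype, (0 : κ → R))) (fun l => (0, Pi.single l 1)) i := by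
    refine Prod.ext (LinearMap.ext fun n => ?_) (funext fun l => ?_)
    · change W.mulVec (V₁ n) i = _
      rw [hW₁]
      rcases i with i | i
      · rfl
      · exact (smul_zero c).symm
    · change (W * V₂) i l = _
      rw [hW₂]
      rcases i with i | i
      · exact (smul_zero c).symm
      · change c • (1 : Matrix κ κ R) i l = c • (Pi.single i 1 : κ → R) l
        rw [Matrix.one_apply, Pi.single_apply]
        exact congrArg _ (if_congr eq_comm rfl rfl)
  -- A top-degree alternating form on `R^(s+κ)` is a multiple of the determinant. At the rows of `W`
  -- the pullback of `Θ` is therefore a multiple of `det A`, and by the formula for `L` it is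
  -- `c^(s+κ)` times the value of `Ψ`.
  have h1 := congrArg (fun F => F W.row) ((Θ.compLinearMap L).eq_smul_basis_det (Pi.basisFun R _))
  simp only [AlternatingMap.compLinearMap_apply, Pi.basisFun_det, AlternatingMap.smul_apply] at h1
  have h2 : Matrix.detRowAlternating W.row = A.det := det_fromBlocks_one_sub A B D
  have h3 : (fun i => L (W.row i)) = _ := funext hL
  rw [h2, h3, AlternatingMap.map_smul_univ, hΘ] at h1
  rw [Ideal.mem_span_singleton']
  refine ⟨_, h1.symm.trans ?_⟩
  simp

end CharIdeal

/-! ### Determinants over almost idempotents, and the Frobenius polynomial. -/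

section Determinant

variable {R : Type*} [CommRing R] {κ : Type*} [Fintype κ] [DecidableEq κ]

/-- The matrices agree modulo the annihilator of `z`, hence so do their determinants. -/
lemma mul_det_eq_mul_det_of_smul_eq {z : R} {X Y : Matrix κ κ R} (h : z • X = z • Y) :
    z * X.det = z * Y.det := by
  let I : Ideal R := LinearMap.ker (LinearMap.mulLeft R z)
  have hI {x : R} : x ∈ I ↔ z * x = 0 := Iff.rfl
  have h1 : (Ideal.Quotient.mk I).mapMatrix X = (Ideal.Quotient.mk I).mapMatrix Y := by
    refine Matrix.ext fun i j => Ideal.Quotient.eq.2 (hI.2 ?_)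
    rw [mul_sub, sub_eq_zero]
    exact congrFun (congrFun h i) j
  have h2 := congrArg Matrix.det h1
  rw [← RingHom.map_det, ← RingHom.map_det, Ideal.Quotient.eq, hI, mul_sub, sub_eq_zero] at h2
  exact h2

/-- `N/n` would be an idempotent on whose component the matrix is `nX`, and on whose complement it
is `n`. Multiplying by `N` and by `n - N` separates the two without dividing; the results are added.
-/
lemma mul_det_smul_add_smul {N n : R} (hN : N * N = n * N) (X : Matrix κ κ R) :
    n * (N • X + (n - N) • (1 : Matrix κ κ R)).det =
      n ^ Fintype.card κ * (N * X.det + (n - N)) := by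
  set A := N • X + (n - N) • (1 : Matrix κ κ R)
  have h0 : N * (n - N) = 0 := by rw [mul_sub, hN]; ring
  have h1 : N * A.det = N * (n • X).det := mul_det_eq_mul_det_of_smul_eq (by
    rw [smul_add, smul_smul, smul_smul, smul_smul, h0, zero_smul, add_zero, hN, mul_comm])
  have h2 : (n - N) * A.det = (n - N) * (n • (1 : Matrix κ κ R)).det :=
    mul_det_eq_mul_det_of_smul_eq (by
      have h3 : (n - N) * (n - N) = (n - N) * n := by linear_combination -h0
      rw [smul_add, smul_smul, smul_smul, smul_smul, mul_comm, h0, zero_smul, zero_add, h3])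
  rw [Matrix.det_smul] at h1 h2
  rw [Matrix.det_one] at h2
  linear_combination h1 + h2

end Determinant

section FrobPoly

variable {O T : Type*} [CommRing O] [AddCommGroup T] [Module O T] {κ : Type*} [Fintype κ]
  [DecidableEq κ] (b : Module.Basis κ O T)

lemma det_one_sub_smul (f : T →ₗ[O] T) (r : O) :
    LinearMap.det ((1 : Module.End O T) - r • f) = (1 - r • LinearMap.toMatrix b b f).det := by
  rw [← LinearMap.det_toMatrix b, map_sub, map_smul, LinearMap.toMatrix_one]

lemma frobPoly_eq_charpolyRev (f : T →ₗ[O] T) :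
    frobPoly f = (LinearMap.toMatrix b b f).charpolyRev := by
  refine (det_one_sub_smul (Algebra.TensorProduct.basis O[X] b) (f.baseChange O[X])
    Polynomial.X).trans ?_
  rw [LinearMap.toMatrix_baseChange]
  rfl

lemma aeval_frobPoly {R : Type*} [CommRing R] [Algebra O R] (f : T →ₗ[O] T) (r : R) :
    Polynomial.aeval r (frobPoly f) =
      (1 - LinearMap.toMatrix (Algebra.TensorProduct.basis R b) (Algebra.TensorProduct.basis R b) (r • f.baseChange R)).det := by
  rw [frobPoly_eq_charpolyRev b, Matrix.charpolyRev, AlgHom.map_det, map_smul,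
    LinearMap.toMatrix_baseChange]
  congr 1
  ext i j
  simp [Matrix.one_apply, apply_ite, mul_comm r]

lemma frobPoly_ne_zero [Nontrivial O] [Module.Free O T] [Module.Finite O T] (f : T →ₗ[O] T) :
    frobPoly f ≠ 0 := by
  classical
  intro h
  have h1 := congrArg (Polynomial.eval 0) h
  rw [frobPoly_eq_charpolyRev (Module.Free.chooseBasis O T), Matrix.eval_charpolyRev,
    Polynomial.eval_zero] at h1
  exact one_ne_zero h1

lemma frobPoly_conj [Nontrivial O] [Module.Free O T] [Module.Finite O T] {G : Type*} [Group G]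
    (ρ : Representation O G T) (g h : G) : frobPoly (ρ (g * h * g⁻¹)) = frobPoly (ρ h) := by
  classical
  let b := Module.Free.chooseBasis O T
  rw [frobPoly_eq_charpolyRev b, frobPoly_eq_charpolyRev b, ← Matrix.reverse_charpoly,
    ← Matrix.reverse_charpoly, LinearMap.charpoly_toMatrix, LinearMap.charpoly_toMatrix]
  let e : T ≃ₗ[O] T := LinearEquiv.ofLinearMap (ρ g) (ρ g⁻¹)
    (by rw [← Module.End.mul_eq_comp, ← map_mul, mul_inv_cancel, map_one]; rfl)
    (by rw [← Module.End.mul_eq_comp, ← map_mul, inv_mul_cancel, map_one]; rfl)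
  have h1 : ρ (g * h * g⁻¹) = e.conj (ρ h) := by
    rw [map_mul, map_mul]
    rfl
  rw [h1, LinearEquiv.charpoly_conj]

/-- If a scalar-twisted endomorphism has an "eigenvector" then so does the characteristic
polynomial. -/
lemma aeval_charpoly_smul_eq_zero [Module.Free O T] [Module.Finite O T] {R : Type*} [CommRing R]
    [Algebra O R] (f : T →ₗ[O] T) {r : R} {x : R ⊗[O] T} (hx : f.baseChange R x = r • x) :
    Polynomial.aeval r f.charpoly • x = 0 := by
  have h1 (P : O[X]) : Polynomial.aeval r P • x = (Polynomial.aeval f P).baseChange R x := by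
    induction P using Polynomial.induction_on' with
    | add P Q hP hQ => rw [map_add, add_smul, hP, hQ, map_add, LinearMap.baseChange_add]; rfl
    | monomial n a =>
      rw [Polynomial.aeval_monomial, Polynomial.aeval_monomial]
      have h2 : ((f ^ n).baseChange R) x = r ^ n • x := by
        induction n with
        | zero => simp [Module.End.one_eq_id]
        | succ n ih =>
          rw [pow_succ, Module.End.mul_eq_comp, LinearMap.baseChange_comp, LinearMap.comp_apply, hx,
            map_smul, ih, smul_smul, pow_succ']
      rw [← Algebra.smul_def, ← Algebra.smul_def, LinearMap.baseChange_smul, LinearMap.smul_apply,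
        h2, smul_assoc]
  rw [h1, LinearMap.aeval_self_charpoly, LinearMap.baseChange_zero, LinearMap.zero_apply]

end FrobPoly

/-! ### The module `O[[Γ]] ⊗ T` carries a tame action. -/

section TensorCohomology

open IsLocalRing CompletedGroupAlgebra

variable {O : Type*} [CommRing O] {𝔪 : Ideal O} {Γ : Type*} [CommGroup Γ] [TopologicalSpace Γ]
  {T : Type*} [AddCommGroup T] [Module O T]

/-- The submodules of elements of `O[[Γ]] ⊗ T` whose coordinates at level `i.1` are divisible
by `𝔪 ^ i.2`. -/
def tensorSubmodule (𝔪 : Ideal O) (Γ : Type*) [CommGroup Γ] [TopologicalSpace Γ] (T : Type*)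
    [AddCommGroup T] [Module O T] [Module.Free O T] (i : OpenSubgroup Γ × ℕ) :
    Submodule (CompletedGroupAlgebra O Γ) (CompletedGroupAlgebra O Γ ⊗[O] T) :=
  coordSubmodule (Algebra.TensorProduct.basis _ (Module.Free.chooseBasis O T))
    (levelIdeal (𝔪 ^ i.2) i.1)

lemma groupElem_sub_one_mem_levelIdeal (𝔞 : Ideal O) {U : OpenSubgroup Γ} {g : Γ} (hg : g ∈ U) :
    groupElem O Γ g - 1 ∈ levelIdeal 𝔞 U := by
  rw [mem_levelIdeal, map_sub, level_groupElem, map_one, MonoidAlgebra.one_def,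
    (QuotientGroup.eq_one_iff g).2 hg, sub_self]
  exact fun _ => zero_mem _

lemma algebraMap_mem_levelIdeal {𝔞 : Ideal O} {a : O} (ha : a ∈ 𝔞) (U : OpenSubgroup Γ) :
    algebraMap O (CompletedGroupAlgebra O Γ) a ∈ levelIdeal 𝔞 U := by
  rw [mem_levelIdeal, AlgHom.commutes]
  intro g
  classical
  rw [MonoidAlgebra.coe_algebraMap, Function.comp_apply, MonoidAlgebra.coeff_single,
    Finsupp.single_apply]
  split_ifs
  exacts [ha, zero_mem _]

lemma tmul_mem_tensorSubmodule [Module.Free O T] (i : OpenSubgroup Γ × ℕ) (z : CompletedGroupAlgebra O Γ) {t : T}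
    (ht : t ∈ 𝔪 ^ i.2 • (⊤ : Submodule O T)) : z ⊗ₜ[O] t ∈ tensorSubmodule 𝔪 Γ T i := by
  induction ht using Submodule.smul_induction_on' with
  | smul a ha t _ =>
    rw [← TensorProduct.smul_tmul, ← algebraMap_smul (CompletedGroupAlgebra O Γ) a z]
    rw [smul_eq_mul, ← smul_eq_mul, ← TensorProduct.smul_tmul']
    exact smul_mem_coordSubmodule _ (algebraMap_mem_levelIdeal ha _) _
  | add x _ y _ hx hy => rw [TensorProduct.tmul_add]; exact add_mem hx hy

/-- A subgroup `H` of `Γ` acting on `O[[Γ]] ⊗ T` by `h (x ⊗ t) = [h]⁻¹ x ⊗ t`. -/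
def invRep (O : Type*) [CommRing O] (T : Type*) [AddCommGroup T] [Module O T] (H : Subgroup Γ) :
    Representation (CompletedGroupAlgebra O Γ) H (CompletedGroupAlgebra O Γ ⊗[O] T) where
  toFun h := groupElem O Γ (h : Γ)⁻¹ • LinearMap.id
  map_one' := by simp [Module.End.one_eq_id]
  map_mul' g h := by
    rw [Subgroup.coe_mul, mul_inv, map_mul, Module.End.mul_eq_comp, LinearMap.smul_comp,
      LinearMap.comp_smul, LinearMap.id_comp, smul_smul]

lemma invRep_apply (H : Subgroup Γ) (h : H) (x : CompletedGroupAlgebra O Γ ⊗[O] T) :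
    invRep O T H h x = groupElem O Γ (h : Γ)⁻¹ • x :=
  rfl

variable [Module.Free O T] {G : Type*} [Group G]
  {p : ℕ} {ρT : Representation O G T} {χ : G →* Γ}
  {ρ : Representation (CompletedGroupAlgebra O Γ) G (CompletedGroupAlgebra O Γ ⊗[O] T)}

lemma exists_open_sub_mem_tensorSubmodule [TopologicalSpace G]
    (hρ : ∀ g, ρ g = groupElem O Γ (χ g)⁻¹ • (ρT g).baseChange (CompletedGroupAlgebra O Γ))
    (hχ : Continuous χ)
    (hT : ∀ n : ℕ, ∃ V : Subgroup G, IsOpen (V : Set G) ∧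
      ∀ v ∈ V, ∀ t, ρT v t - t ∈ 𝔪 ^ n • (⊤ : Submodule O T)) (i : OpenSubgroup Γ × ℕ) :
    ∃ V : Subgroup G, IsOpen (V : Set G) ∧ ∀ v ∈ V, ∀ x, ρ v x - x ∈ tensorSubmodule 𝔪 Γ T i := by
  obtain ⟨V, hV, hVT⟩ := hT i.2
  refine ⟨V ⊓ (i.1 : Subgroup Γ).comap χ, hV.inter (i.1.isOpen.preimage hχ), fun v hv x => ?_⟩
  have h1 : (groupElem O Γ (χ v)⁻¹ - 1) ∈ levelIdeal (𝔪 ^ i.2) i.1 :=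
    groupElem_sub_one_mem_levelIdeal _ (inv_mem hv.2)
  have h2 : (ρT v).baseChange (CompletedGroupAlgebra O Γ) x - x ∈ tensorSubmodule 𝔪 Γ T i := by
    induction x using TensorProduct.induction_on with
    | zero => simp
    | tmul z t =>
      rw [LinearMap.baseChange_tmul, ← TensorProduct.tmul_sub]
      exact tmul_mem_tensorSubmodule i z (hVT v hv.1 t)
    | add x y hx hy =>
      rw [map_add, add_sub_add_comm]
      exact add_mem hx hy
  rw [hρ, LinearMap.smul_apply]
  have h3 := add_mem (smul_mem_coordSubmodule (Algebra.TensorProduct.basis _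
    (Module.Free.chooseBasis O T)) h1 ((ρT v).baseChange (CompletedGroupAlgebra O Γ) x)) h2
  rwa [sub_smul, one_smul, sub_add_sub_cancel] at h3

variable [IsTopologicalGroup Γ] [Module.Finite O T]

lemma exists_sum_invRep (H : Subgroup Γ) [Fintype H] (V : OpenSubgroup Γ)
    (hV : ∀ h ∈ H, h ∈ V → h = 1) :
    ∃ θ : CompletedGroupAlgebra O Γ ⊗[O] T →+ CompletedGroupAlgebra O Γ ⊗[O] T,
      ∀ x, ∑ h, invRep O T H h (θ (invRep O T H h⁻¹ x)) = x := by
  obtain ⟨θ, hθ⟩ := exists_sum_groupElem_mul (O := O) H.subtype V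
    fun h hh => Subtype.ext (hV h h.2 hh)
  let B := Algebra.TensorProduct.basis (CompletedGroupAlgebra O Γ) (Module.Free.chooseBasis O T)
  refine ⟨(B.equivFun.symm.toLinearMap.toAddMonoidHom.comp (AddMonoidHom.compLeft θ _)).comp
    B.equivFun.toLinearMap.toAddMonoidHom, fun x => B.equivFun.injective ?_⟩
  rw [map_sum]
  simp only [invRep_apply, map_smul]
  funext l
  rw [Finset.sum_apply]
  conv_rhs => rw [← hθ (B.equivFun x l)]
  refine Finset.sum_congr rfl fun h _ => ?_
  rw [Pi.smul_apply, smul_eq_mul, Subgroup.coe_inv, inv_inv]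
  congr 1
  refine (congrFun (B.equivFun.apply_symm_apply _) l).trans ?_
  change θ (B.equivFun (groupElem O Γ (h : Γ) • x) l) = _
  rw [map_smul]
  rfl

variable [CompactSpace Γ] [IsDomain O] [IsAdicComplete 𝔪 O] {N : ℕ} {I : Subgroup G} {σ : G}

/-- The equation makes `x` an eigenvector of the base change of `ρT σ` with eigenvalue `N [χ σ]`. By
Cayley–Hamilton `x` is killed by the characteristic polynomial at `N [χ σ]`. As `N ≠ 0`, this is a
nonzero polynomial in `[χ σ]`, hence a non-zero-divisor. -/
lemma eq_zero_of_apply_eq_nsmul (hp : p.Prime) (hpm : (p : O) ∈ 𝔪) (hN : (N : O) ≠ 0)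
    (h1 : ∀ V : OpenSubgroup Γ, ∃ a : ℕ, χ σ ^ p ^ a ∈ V)
    (h2 : ∀ b : ℕ, ∃ V : OpenSubgroup Γ, χ σ ^ p ^ b ∉ V)
    (hρ : ∀ g, ρ g = groupElem O Γ (χ g)⁻¹ • (ρT g).baseChange (CompletedGroupAlgebra O Γ))
    {x : CompletedGroupAlgebra O Γ ⊗[O] T} (hx : ρ σ x = N • x) : x = 0 := by
  have h3 : (ρT σ).baseChange (CompletedGroupAlgebra O Γ) x =
      (algebraMap O (CompletedGroupAlgebra O Γ) N * groupElem O Γ (χ σ)) • x := by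
    have h4 := congrArg (groupElem O Γ (χ σ) • ·) hx
    simp only [hρ, LinearMap.smul_apply, smul_smul, ← map_mul, mul_inv_cancel, map_one,
      one_smul] at h4
    rw [h4, map_natCast, mul_comm, ← smul_smul, Nat.cast_smul_eq_nsmul]
  have h4 := aeval_charpoly_smul_eq_zero _ h3
  have h5 : Polynomial.aeval (algebraMap O (CompletedGroupAlgebra O Γ) N * groupElem O Γ (χ σ))
      (ρT σ).charpoly = Polynomial.aeval (groupElem O Γ (χ σ))
        ((ρT σ).charpoly.comp (Polynomial.C (N : O) * Polynomial.X)) := by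
    rw [Polynomial.aeval_comp, map_mul, Polynomial.aeval_C, Polynomial.aeval_X]
  have h6 : (ρT σ).charpoly.comp (Polynomial.C (N : O) * Polynomial.X) ≠ 0 := by
    rw [Ne, Polynomial.comp_C_mul_X_eq_zero_iff (by simpa using hN)]
    exact (LinearMap.charpoly_monic _).ne_zero
  rw [h5] at h4
  let B := Algebra.TensorProduct.basis (CompletedGroupAlgebra O Γ) (Module.Free.chooseBasis O T)
  refine B.equivFun.map_eq_zero_iff.1 (funext fun l => ?_)
  refine eq_zero_of_aeval_groupElem_mul_eq_zero (𝔪 := 𝔪) hp hpm h1 h2 h6 ?_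
  have h7 := congrFun (congrArg B.equivFun h4) l
  rwa [map_smul, map_zero] at h7

variable [TopologicalSpace G] [IsTopologicalGroup G] [TopologicalSpace O] [IsTopologicalRing O]

omit [IsDomain O] [IsAdicComplete 𝔪 O] in
lemma continuous_tensor_cocycle_iff (hO : IsAdic 𝔪)
    (ρ : Representation (CompletedGroupAlgebra O Γ) G (CompletedGroupAlgebra O Γ ⊗[O] T))
    (c : G → CompletedGroupAlgebra O Γ ⊗[O] T) (hc : ∀ g h, c (g * h) = c g + ρ g (c h)) :
    @Continuous _ _ _ (moduleTopology (CompletedGroupAlgebra O Γ) _) c ↔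
      ∀ i, ∃ V : Subgroup G, IsOpen (V : Set G) ∧ ∀ v ∈ V, c v ∈ tensorSubmodule 𝔪 Γ T i := by
  have := isTopologicalRing (G := Γ) hO
  let _ := moduleTopology (CompletedGroupAlgebra O Γ) (CompletedGroupAlgebra O Γ ⊗[O] T)
  have : IsModuleTopology (CompletedGroupAlgebra O Γ) (CompletedGroupAlgebra O Γ ⊗[O] T) := ⟨rfl⟩
  have := IsModuleTopology.topologicalAddGroup (CompletedGroupAlgebra O Γ)
    (CompletedGroupAlgebra O Γ ⊗[O] T)
  exact continuous_cocycle_iff (W := tensorSubmodule 𝔪 Γ T)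
    (hasBasis_moduleTopology _ (hasBasis_nhds_zero hO)) ρ
    (fun i g x hx => map_mem_coordSubmodule _ (ρ g) hx) c hc

lemma exists_tameAction (hO : IsAdic 𝔪) (hp : p.Prime) (hpm : (p : O) ∈ 𝔪) (hN : (N : O) ≠ 0)
    (hχ : Continuous χ)
    (hρ : ∀ g, ρ g = groupElem O Γ (χ g)⁻¹ • (ρT g).baseChange (CompletedGroupAlgebra O Γ))
    (hT : ∀ n : ℕ, ∃ V : Subgroup G, IsOpen (V : Set G) ∧
      ∀ v ∈ V, ∀ t, ρT v t - t ∈ 𝔪 ^ n • (⊤ : Submodule O T))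
    (hTI : ∀ t ∈ I, ρT t = 1) (hI : I.Normal)
    (hgen : ∀ V : Subgroup G, IsOpen (V : Set G) → I ≤ V → ∀ g, ∃ a : ℕ, (σ ^ a)⁻¹ * g ∈ V)
    (hdvd : ∀ n : ℕ, 0 < n → ∃ V : Subgroup G, V.Normal ∧ IsOpen (V : Set G) ∧ I ≤ V ∧
      ∀ a : ℕ, σ ^ a ∈ V → n ∣ a)
    (htame : ∀ t ∈ I, ∀ V : Subgroup G, IsOpen (V : Set G) →
      ∃ m : ℕ, p.Coprime m ∧ (σ * t * σ⁻¹ * (t ^ N)⁻¹) ^ m ∈ V)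
    [Fintype (I.map χ)] (V₀ : OpenSubgroup Γ) (hV₀ : ∀ h ∈ I.map χ, h ∈ V₀ → h = 1)
    (h1 : ∀ V : OpenSubgroup Γ, ∃ a : ℕ, χ σ ^ p ^ a ∈ V)
    (h2 : ∀ b : ℕ, ∃ V : OpenSubgroup Γ, χ σ ^ p ^ b ∉ V) :
    ∃ θ, TameAction p N ρ I σ (tensorSubmodule 𝔪 Γ T) (χ.subgroupMap I)
      (invRep O T (I.map χ)) θ := by
  obtain ⟨θ, hθ⟩ := exists_sum_invRep (O := O) (T := T) (I.map χ) V₀ hV₀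
  let B := Algebra.TensorProduct.basis (CompletedGroupAlgebra O Γ) (Module.Free.chooseBasis O T)
  refine ⟨θ, ?_, ?_, ?_, ?_, ?_, ?_, hI, hgen, hdvd, ?_, hp.pos, ?_, ?_, ?_, hθ⟩
  · exact fun c hc => continuous_tensor_cocycle_iff hO ρ c hc
  · exact fun i g x hx => map_mem_coordSubmodule _ (ρ g) hx
  · exact exists_open_sub_mem_tensorSubmodule hρ hχ hT
  · intro x hx
    refine B.equivFun.map_eq_zero_iff.1 (funext fun l => ?_)
    exact eq_zero_of_forall_mem_levelIdeal (𝔪 := 𝔪) fun U n => hx (U, n) l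
  · refine fun i => ⟨i.2, fun x => ?_⟩
    have h3 : algebraMap O (CompletedGroupAlgebra O Γ) (p ^ i.2) ∈ levelIdeal (𝔪 ^ i.2) i.1 :=
      algebraMap_mem_levelIdeal (Ideal.pow_mem_pow hpm _) _
    have h4 := smul_mem_coordSubmodule B h3 x
    rwa [map_pow, map_natCast, ← Nat.cast_pow, Nat.cast_smul_eq_nsmul] at h4
  · intro y hy
    have h3 (l) : ∃ z, ∀ i, B.equivFun (y i) l - z ∈ levelIdeal (𝔪 ^ i.2) i.1 :=
      exists_sub_mem_levelIdeal _ fun i k hik hik' => by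
        have h4 : tensorSubmodule 𝔪 Γ T k ≤ tensorSubmodule 𝔪 Γ T i := fun x hx l =>
          levelIdeal_mono (Ideal.pow_le_pow_right hik') hik (hx l)
        have h5 := hy i k h4 l
        rwa [map_sub] at h5
    choose z hz using h3
    refine ⟨B.equivFun.symm z, fun i l => ?_⟩
    have h4 := hz l i
    change B.equivFun (y i - B.equivFun.symm z) l ∈ _
    rw [map_sub, LinearEquiv.apply_symm_apply]
    exact h4
  · intro t ht
    refine ⟨⟨σ * t * σ⁻¹ * (t ^ N)⁻¹, mul_mem (hI.conj_mem _ t.2 _)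
      (inv_mem (pow_mem t.2 N))⟩, ?_, ?_, fun V hV => htame t t.2 V hV⟩
    · have h3 : χ t = 1 := congrArg Subtype.val ht
      refine Subtype.ext ?_
      change χ (σ * t * σ⁻¹ * (t ^ N)⁻¹) = 1
      simp [h3]
    · simp
  · exact fun x hx => eq_zero_of_apply_eq_nsmul (𝔪 := 𝔪) hp hpm hN h1 h2 hρ hx
  · exact χ.subgroupMap_surjective I
  · intro t
    rw [hρ, hTI t t.2, Module.End.one_eq_id, LinearMap.baseChange_id]
    rfl

end TensorCohomology

/-! ### A square presentation of `H¹` up to powers of the order of `H`. -/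

section CharIdealH1

open CompletedGroupAlgebra

variable {O : Type*} [CommRing O] {𝔪 : Ideal O} {Γ : Type*} [CommGroup Γ] [TopologicalSpace Γ]
  {T : Type*} [AddCommGroup T] [Module O T]
  {G : Type*} [Group G] {p : ℕ} {ρT : Representation O G T} {χ : G →* Γ}
  {ρ : Representation (CompletedGroupAlgebra O Γ) G (CompletedGroupAlgebra O Γ ⊗[O] T)}

/-- The norm element `∑_{h ∈ H} [h]` of a finite subgroup. -/
def normElem (O : Type*) [CommRing O] (H : Subgroup Γ) [Fintype H] : CompletedGroupAlgebra O Γ :=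
  ∑ h : H, groupElem O Γ h

lemma groupElem_mul_normElem {H : Subgroup Γ} [Fintype H] {h : Γ} (hh : h ∈ H) :
    groupElem O Γ h * normElem O H = normElem O H := by
  rw [normElem, Finset.mul_sum]
  simp only [← map_mul]
  exact Equiv.sum_comp (Equiv.mulLeft (⟨h, hh⟩ : H)) fun g : H => groupElem O Γ (g : Γ)

lemma normElem_mul_self (H : Subgroup Γ) [Fintype H] :
    normElem O H * normElem O H = (Fintype.card H : CompletedGroupAlgebra O Γ) * normElem O H := by
  conv_lhs => enter [1]; rw [normElem]
  rw [Finset.sum_mul, Finset.sum_congr rfl fun h _ => groupElem_mul_normElem h.2, Finset.sum_const,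
    Finset.card_univ, nsmul_eq_mul]

lemma sum_invRep (H : Subgroup Γ) [Fintype H] (x : CompletedGroupAlgebra O Γ ⊗[O] T) :
    ∑ h, invRep O T H h x = normElem O H • x := by
  simp only [invRep_apply]
  rw [← Finset.sum_smul, normElem]
  congr 1
  exact Equiv.sum_comp (Equiv.inv H) fun g : H => groupElem O Γ (g : Γ)

variable [IsDomain O] [CharZero O]

lemma natCast_mul_eq_zero {n : ℕ} (hn : n ≠ 0) {x : CompletedGroupAlgebra O Γ}
    (hx : (n : CompletedGroupAlgebra O Γ) * x = 0) : x = 0 := by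
  refine eq_zero_of_smul_eq_zero (a := (n : O)) (Nat.cast_ne_zero.2 hn) ?_
  rwa [Algebra.smul_def, map_natCast]

variable [Module.Free O T] [Module.Finite O T] [IsTopologicalGroup Γ] [CompactSpace Γ]
  [IsHausdorff 𝔪 O]

/-- The characteristic ideal of the first cohomology group of a tame action on `O[[Γ]] ⊗ T`. -/
theorem exists_generator_charIdeal_H1 [TopologicalSpace G] [IsTopologicalGroup G] [CompactSpace G]
    [TopologicalSpace O] {N : ℕ} {I : Subgroup G} {σ : G} [Fintype (I.map χ)] {ι : Type*}
    {W : ι → Submodule (CompletedGroupAlgebra O Γ) (CompletedGroupAlgebra O Γ ⊗[O] T)}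
    {θ : CompletedGroupAlgebra O Γ ⊗[O] T →+ CompletedGroupAlgebra O Γ ⊗[O] T}
    (H : TameAction p N ρ I σ W (χ.subgroupMap I) (invRep O T (I.map χ)) θ)
    (hp : p.Prime) (hpm : (p : O) ∈ 𝔪)
    (hρ : ∀ g, ρ g = groupElem O Γ (χ g)⁻¹ • (ρT g).baseChange (CompletedGroupAlgebra O Γ))
    (h1 : ∀ V : OpenSubgroup Γ, ∃ a : ℕ, χ σ ^ p ^ a ∈ V)
    (h2 : ∀ b : ℕ, ∃ V : OpenSubgroup Γ, χ σ ^ p ^ b ∉ V) :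
    Module.Finite (CompletedGroupAlgebra O Γ) (H1 ρ) ∧
    ∃ (d : ℕ) (Δ : CompletedGroupAlgebra O Γ),
      Fintype.card (I.map χ) * Δ = Fintype.card (I.map χ) ^ d *
        (normElem O (I.map χ) * Polynomial.aeval (groupElem O Γ (χ σ)⁻¹) (frobPoly (ρT σ)) +
          (Fintype.card (I.map χ) - normElem O (I.map χ))) ∧
      ∀ (s : ℕ) (φ : (Fin s → CompletedGroupAlgebra O Γ) →ₗ[CompletedGroupAlgebra O Γ] H1 ρ),
        Function.Surjective φ → Δ ∈ charIdeal φ ∧ ∃ e : ℕ, ∀ a ∈ charIdeal φ,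
          (Fintype.card (I.map χ) : CompletedGroupAlgebra O Γ) ^ e * a ∈ Ideal.span {Δ} := by
  classical
  obtain ⟨α, hα, hα0⟩ := H.exists_surjective_H1
  simp only [sum_invRep] at hα0
  let b := Module.Free.chooseBasis O T
  let B := Algebra.TensorProduct.basis (CompletedGroupAlgebra O Γ) b
  set n := Fintype.card (I.map χ)
  have hn : n ≠ 0 := Fintype.card_ne_zero
  set ν := normElem O (I.map χ)
  have hν : ν * ν = n * ν := normElem_mul_self _
  set D := Polynomial.aeval (groupElem O Γ (χ σ)⁻¹) (frobPoly (ρT σ)) with hD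
  let X := 1 - LinearMap.toMatrix B B (ρ σ)
  have hX : X.det = D := by rw [hD, aeval_frobPoly b, ← hρ]
  -- `A` is `n` times the operator equal to `1 - ρ σ` on the component of `ν/n` and to the identity
  -- on the complement.
  let A := ν • X + ((n : CompletedGroupAlgebra O Γ) - ν) • (1 : Matrix _ _ _)
  have hAx (x) : A.mulVec (B.equivFun x) =
      B.equivFun (ν • (x - ρ σ x) + ((n : CompletedGroupAlgebra O Γ) - ν) • x) := by
    have h3 : (LinearMap.toMatrix B B (ρ σ)).mulVec (B.equivFun x) = B.equivFun (ρ σ x) :=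
      LinearMap.toMatrix_mulVec_repr B B (ρ σ) x
    rw [Matrix.add_mulVec, Matrix.smul_mulVec, Matrix.smul_mulVec, Matrix.sub_mulVec,
      Matrix.one_mulVec, h3]
    simp only [map_add, map_smul, map_sub]
  have hAdet := mul_det_smul_add_smul hν X
  rw [hX] at hAdet
  let β := α ∘ₗ B.equivFun.symm.toLinearMap
  have hβ (x) : β (B.equivFun x) = α x := congrArg α (B.equivFun.symm_apply_apply x)
  have hβs : Function.Surjective β := hα.comp B.equivFun.symm.surjective
  have hβA (v) : β (A.mulVec v) = 0 := by
    obtain ⟨x, rfl⟩ := B.equivFun.surjective v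
    rw [hAx, hβ, hα0]
    refine ⟨-(n : CompletedGroupAlgebra O Γ) • x, ?_⟩
    have h3 : ν * ((n : CompletedGroupAlgebra O Γ) - ν) = 0 := by rw [mul_sub, hν]; ring
    rw [smul_add, smul_smul, smul_smul, h3, zero_smul, add_zero, hν, map_smul, map_smul]
    module
  -- If `νx = (ρ σ - 1)νy`, then `-νy + (n - ν)x` is mapped by `A` to `n² x`: on the component of
  -- `ν/n` this uses the relation, and on the complement `A` is multiplication by `n`.
  have hβ0 (v) (hv : β v = 0) : ∃ y, A.mulVec y = ((n : CompletedGroupAlgebra O Γ) ^ 2) • v := by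
    obtain ⟨x, rfl⟩ := B.equivFun.surjective v
    rw [hβ, hα0] at hv
    obtain ⟨y, hy⟩ := hv
    rw [map_smul] at hy
    refine ⟨B.equivFun (-(ν • y) + ((n : CompletedGroupAlgebra O Γ) - ν) • x), ?_⟩
    rw [hAx, ← map_smul]
    congr 1
    simp only [map_add, map_neg, map_smul]
    have h5 : ν • (-(ν • y) + ((n : CompletedGroupAlgebra O Γ) - ν) • x -
          (-(ν • ρ σ y) + ((n : CompletedGroupAlgebra O Γ) - ν) • ρ σ x)) +
        ((n : CompletedGroupAlgebra O Γ) - ν) •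
          (-(ν • y) + ((n : CompletedGroupAlgebra O Γ) - ν) • x) =
        (ν * ν) • (ρ σ y - y) + (ν * n - ν * ν) • (x - ρ σ x) + (ν * ν - n * ν) • y +
          (n ^ 2 - n * ν - (n * ν - ν * ν)) • x := by
      module
    have h6 : ν * n - ν * ν = 0 := by rw [hν]; ring
    rw [h5, h6, hν, sub_self, zero_smul, zero_smul, add_zero, add_zero, sub_zero]
    have h7 : ((n : CompletedGroupAlgebra O Γ) * ν) • (ρ σ y - y) =
        ((n : CompletedGroupAlgebra O Γ) * ν) • x := by
      rw [mul_smul, mul_smul, hy, smul_sub]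
    rw [h7]
    module
  -- From `(νD + n - ν)x = 0`, multiplication by `ν` gives `nDνx = 0`. Since `D` is a nonzero
  -- polynomial in `[χ σ]⁻¹`, it follows that `νx = 0`, and then `nx = 0`.
  have hdet : A.det ∈ nonZeroDivisors (CompletedGroupAlgebra O Γ) := by
    rw [mem_nonZeroDivisors_iff_right]
    intro x hx
    have h3 : (n : CompletedGroupAlgebra O Γ) ^ Fintype.card (Module.Free.ChooseBasisIndex O T) *
        ((ν * D + (n - ν)) * x) = 0 := by
      rw [← mul_assoc, ← hAdet, mul_assoc, mul_comm _ x, hx, mul_zero]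
    rw [← Nat.cast_pow] at h3
    have h4 := natCast_mul_eq_zero (pow_ne_zero _ hn) h3
    have h5 : ν * x = 0 := by
      refine eq_zero_of_aeval_groupElem_mul_eq_zero (𝔪 := 𝔪) hp hpm (γ := (χ σ)⁻¹)
        (fun V => ?_) (fun V => ?_) (frobPoly_ne_zero (ρT σ))
        (natCast_mul_eq_zero hn ?_)
      · simpa only [inv_pow, inv_mem_iff] using h1 V
      · simpa only [inv_pow, inv_mem_iff] using h2 V
      · linear_combination ν * h4 - (D * x - x) * hν
    refine natCast_mul_eq_zero hn ?_
    linear_combination h4 - (D - 1) * h5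
  refine ⟨Module.Finite.of_surjective β hβs, _, A.det, hAdet, fun s φ hφ =>
    ⟨det_mem_charIdeal hφ hβs hβA, 2 * (s + Fintype.card (Module.Free.ChooseBasisIndex O T)), fun a ha => ?_⟩⟩
  rw [pow_mul]
  exact pow_mul_mem_span_det hφ hβs hdet hβ0 ha

end CharIdealH1

/-! ### Topology of `ℤ_p^r` and of infinite Galois groups. -/

section PadicGroups

variable {A : Type*} [Group A] [TopologicalSpace A] {p : ℕ} [Fact p.Prime] {r : ℕ}

lemma eq_one_of_pow_eq_one (e : A ≃ₜ* Multiplicative (Fin r → ℤ_[p])) {x : A} {n : ℕ} (hn : n ≠ 0)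
    (h : x ^ n = 1) : x = 1 := by
  have h1 : n • (e x).toAdd = 0 := by
    rw [← toAdd_pow, ← map_pow, h, map_one, toAdd_one]
  have h2 : (e x).toAdd = 0 := (smul_eq_zero.1 h1).resolve_left hn
  rw [← e.map_eq_one_iff]
  exact h2

lemma tendsto_pow_pow_one (e : A ≃ₜ* Multiplicative (Fin r → ℤ_[p])) (x : A) :
    Filter.Tendsto (fun a : ℕ => x ^ p ^ a) Filter.atTop (nhds 1) := by
  have h1 : Filter.Tendsto (fun a : ℕ => (p ^ a) • (e x).toAdd) Filter.atTop (nhds 0) := by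
    rw [tendsto_pi_nhds]
    intro i
    have h2 : Filter.Tendsto (fun a : ℕ => (p : ℤ_[p]) ^ a * (e x).toAdd i) Filter.atTop
        (nhds (0 * (e x).toAdd i)) := by
      refine Filter.Tendsto.mul_const _ (tendsto_pow_atTop_nhds_zero_of_norm_lt_one ?_)
      exact (PadicInt.norm_p (p := p)).trans_lt (inv_lt_one_of_one_lt₀ (by exact_mod_cast (Fact.out : p.Prime).one_lt))
    rw [zero_mul] at h2
    refine h2.congr fun a => ?_
    rw [Pi.smul_apply, nsmul_eq_mul, Nat.cast_pow]
  have h3 : Filter.Tendsto (fun a : ℕ => e (x ^ p ^ a)) Filter.atTop (nhds (e 1)) := by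
    rw [map_one]
    refine Filter.Tendsto.congr (fun a => ?_) h1
    rw [map_pow]
    rfl
  have h4 := (e.symm.continuous_toFun.tendsto _).comp h3
  have h5 : (e.symm (e 1)) = 1 := e.symm_apply_apply 1
  refine (h4.congr fun a => e.symm_apply_apply _).trans (le_of_eq ?_)
  exact congrArg nhds h5

/-- Multiplication by an integer prime to `p` preserves `p`-adic norms, so such powers of a
nontrivial element stay away from `1`. -/
lemma eq_one_of_coprime_pow_mem (e : A ≃ₜ* Multiplicative (Fin r → ℤ_[p])) {x : A}
    (h : ∀ V ∈ nhds (1 : A), ∃ m : ℕ, p.Coprime m ∧ x ^ m ∈ V) : x = 1 := by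
  rw [← e.map_eq_one_iff]
  refine funext fun i => ?_
  change (e x).toAdd i = 0
  by_contra hi
  have hc : Continuous fun y : A => (e y).toAdd i :=
    (continuous_apply i).comp (continuous_toAdd.comp e.continuous_toFun)
  have hV : {y : A | ‖(e y).toAdd i‖ < ‖(e x).toAdd i‖} ∈ nhds (1 : A) := by
    refine (isOpen_lt hc.norm continuous_const).mem_nhds ?_
    rw [Set.mem_ofPred_eq, map_one, toAdd_one, Pi.zero_apply, norm_zero]
    exact norm_pos_iff.2 hi
  obtain ⟨m, hm, hx⟩ := h _ hV
  rw [Set.mem_ofPred_eq, map_pow, toAdd_pow, Pi.smul_apply, nsmul_eq_mul, norm_mul,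
    PadicInt.norm_natCast_eq_one_iff.2 hm, one_mul] at hx
  exact hx.false

end PadicGroups

section InfiniteGalois

variable {k : Type*} [Field k] {L : Type*} [Field L] [Algebra k L]

lemma exists_openSubgroup_notMem [Algebra.IsAlgebraic k L] {γ : Gal(L/k)} (hγ : γ ≠ 1) :
    ∃ V : OpenSubgroup Gal(L/k), γ ∉ V := by
  have : ∃ x, γ x ≠ x := by
    by_contra! h
    exact hγ (AlgEquiv.ext h)
  obtain ⟨x, hx⟩ := this
  exact ⟨⟨MulAction.stabilizer _ x,
    stabilizer_isOpen_of_isIntegral x⟩, hx⟩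

lemma exists_openSubgroup_forall_eq_one [Algebra.IsAlgebraic k L] (H : Subgroup Gal(L/k))
    [Finite H] : ∃ V : OpenSubgroup Gal(L/k), ∀ h ∈ H, h ∈ V → h = 1 := by
  have h1 (h : H) : ∃ V : OpenSubgroup Gal(L/k), (h : Gal(L/k)) ∈ V → h.1 = 1 := by
    by_cases hh : h.1 = 1
    · exact ⟨⊤, fun _ => hh⟩
    · obtain ⟨V, hV⟩ := exists_openSubgroup_notMem hh
      exact ⟨V, fun h => absurd h hV⟩
  choose V hV using h1
  refine ⟨⟨⨅ h, (V h : Subgroup Gal(L/k)), ?_⟩, fun h hh hmem => hV ⟨h, hh⟩ ?_⟩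
  · change IsOpen ((⨅ h, (V h : Subgroup Gal(L/k)) : Subgroup Gal(L/k)) : Set Gal(L/k))
    rw [Subgroup.coe_iInf]
    exact isOpen_iInter_of_finite fun h => (V h).isOpen
  · exact Subgroup.mem_iInf.1 hmem ⟨h, hh⟩

lemma continuous_resGal {E L : IntermediateField k (AlgebraicClosure k)} (h : E ≤ L) [Normal k E] :
    Continuous (resGal h) := by
  refine continuous_of_continuousAt_one _ ?_
  rw [ContinuousAt, map_one, Filter.tendsto_def]
  intro s hs
  obtain ⟨t, ht⟩ := exists_finset_of_mem_nhds_one hs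
  have hopen : IsOpen (⋂ x ∈ t, {σ : Gal(L/k) |
      σ (IntermediateField.inclusion h x) = IntermediateField.inclusion h x}) :=
    isOpen_biInter_finset fun x _ => stabilizer_isOpen_of_isIntegral _
  refine Filter.mem_of_superset (hopen.mem_nhds ?_) fun σ hσ => ht _ fun x hx => ?_
  · simp
  · refine (IntermediateField.inclusion h).injective ((inclusion_resGal h σ x).trans ?_)
    exact Set.mem_iInter₂.1 hσ x hx

lemma resGal_resAbs {E L : IntermediateField k (AlgebraicClosure k)} (h : E ≤ L) [Normal k E]
    [Normal k L] (g : Gal(AlgebraicClosure k/k)) : resGal h (resAbs L g) = resAbs E g := by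
  ext x
  have := congrArg (fun y : L => (y : AlgebraicClosure k)) (inclusion_resGal h (resAbs L g) x)
  rw [AlgEquiv.restrictNormalHom_apply] at this
  rw [AlgEquiv.restrictNormalHom_apply]
  exact this

lemma resAbs_eq_one_iff {E : IntermediateField k (AlgebraicClosure k)} [Normal k E]
    {g : Gal(AlgebraicClosure k/k)} : resAbs E g = 1 ↔ g ∈ E.fixingSubgroup := by
  rw [← MonoidHom.mem_ker, IntermediateField.restrictNormalHom_ker]

end InfiniteGalois

section ContinuousAction

variable {O : Type*} [CommRing O] {𝔪 : Ideal O} [TopologicalSpace O] [IsTopologicalRing O]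
  {T : Type*} [AddCommGroup T] [Module O T] [Module.Free O T] [Module.Finite O T]
  [TopologicalSpace T] [IsModuleTopology O T] {G : Type*} [Group G] [TopologicalSpace G]
  [IsTopologicalGroup G]

/-- Continuity gives a neighbourhood for each vector; by linearity a finite basis suffices, so it
can be chosen uniformly in `t`. -/
lemma exists_open_sub_mem (hO : IsAdic 𝔪) (ρ : Representation O G T)
    (hρ : Continuous fun x : G × T => ρ x.1 x.2) (n : ℕ) :
    ∃ V : Subgroup G, IsOpen (V : Set G) ∧
      ∀ v ∈ V, ∀ t, ρ v t - t ∈ 𝔪 ^ n • (⊤ : Submodule O T) := by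
  have := IsModuleTopology.topologicalAddGroup O T
  let b := Module.Free.chooseBasis O T
  let N := coordSubmodule b (𝔪 ^ n)
  have hN : (N : Set T) ∈ nhds (0 : T) := by
    have h := hasBasis_moduleTopology b hO.hasBasis_nhds_zero
    rw [← eq_moduleTopology O T] at h
    exact h.mem_of_mem trivial
  let V : Subgroup G :=
    { carrier := {g | ∀ t, ρ g t - t ∈ N}
      one_mem' := fun t => by simp
      mul_mem' := fun {g h} hg hh t => by
        rw [map_mul, Module.End.mul_apply, ← sub_add_sub_cancel _ (ρ h t)]
        exact add_mem (hg _) (hh t)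
      inv_mem' := fun {g} hg t => by
        have h := map_mem_coordSubmodule b (ρ g⁻¹) (hg t)
        rw [map_sub, ← Module.End.mul_apply, ← map_mul, inv_mul_cancel, map_one,
          Module.End.one_apply] at h
        rw [← neg_sub]
        exact neg_mem h }
  refine ⟨V, Subgroup.isOpen_of_mem_nhds V (g := 1) ?_, fun v hv t => ?_⟩
  · have h1 (l) : {g | ρ g (b l) - b l ∈ N} ∈ nhds (1 : G) := by
      have hc : Continuous fun g : G => ρ g (b l) - b l :=
        (hρ.comp (continuous_id.prodMk continuous_const)).sub continuous_const
      refine hc.continuousAt.preimage_mem_nhds (t := (N : Set T)) ?_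
      simpa using hN
    refine Filter.mem_of_superset (Filter.iInter_mem.2 h1) fun g hg t => ?_
    rw [Set.mem_iInter] at hg
    rw [← b.sum_repr t, map_sum, ← Finset.sum_sub_distrib]
    refine sum_mem fun l _ => ?_
    rw [map_smul, ← smul_sub]
    exact N.smul_mem _ (hg l)
  · rw [← b.sum_repr (ρ v t - t)]
    exact sum_mem fun l _ => Submodule.smul_mem_smul (hv t l) trivial

end ContinuousAction

/-! ### Inertia and Frobenius in a `ℤ_p^r`-extension. -/

section Unramified

open NumberField IsDedekindDomain
open scoped Pointwise

variable {k : Type*} [Field k] [NumberField k]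

omit [NumberField k] in
lemma inertiaAt_le_fixingSubgroup_maxUnramifiedOutside {S : Finset (HeightOneSpectrum (𝓞 k))}
    {q : HeightOneSpectrum (𝓞 k)} (hq : q ∉ S) {Q : Ideal (𝓞 (AlgebraicClosure k))}
    (hQ : Q ∈ PrimesAbove q) : inertiaAt Q ≤ (maxUnramifiedOutside S).fixingSubgroup := by
  rw [← IntermediateField.le_iff_le]
  exact sSup_le fun L hL => (IntermediateField.le_iff_le _ _).2 (hL q hq Q hQ)

variable {q : HeightOneSpectrum (𝓞 k)}
  {j : AlgebraicClosure k →ₐ[k] AlgebraicClosure (q.adicCompletion k)}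
  {σ t : Gal(AlgebraicClosure (q.adicCompletion k)/q.adicCompletion k)}
  (L : IntermediateField k (AlgebraicClosure k)) [IsAbelianGalois k L]

lemma continuous_resAbs_resLocal : Continuous fun g => resAbs L (resLocal j g) :=
  (InfiniteGalois.restrictNormalHom_continuous L).comp (continuous_resLocal q j)

variable {p : ℕ} [hp : Fact p.Prime] {r : ℕ} {L} (hpq : (p : 𝓞 k) ∉ q.asIdeal)
  (e : Gal(L/k) ≃ₜ* Multiplicative (Fin r → ℤ_[p]))
  (hσ : IsFrobenius (primeOfEmbedding q j) (resLocal j σ))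

include hpq hσ e

/-- A `ℤ_p^r`-extension is unramified at the primes which do not divide `p`. -/
lemma resAbs_eq_one_of_mem_localInertia (ht : t ∈ localInertia q j) :
    resAbs L (resLocal j t) = 1 := by
  set N := Nat.card (𝓞 k ⧸ q.asIdeal)
  have hw := isWild_of_mem_localInertia hσ ht
  have h1 : resAbs L (resLocal j (σ * t * σ⁻¹ * (t ^ N)⁻¹)) = 1 := by
    refine eq_one_of_coprime_pow_mem e fun V hV => ?_
    obtain ⟨m, hm, hm'⟩ := hw.exists_pow_mem hp.out hpq
      ((continuous_resAbs_resLocal L).continuousAt.preimage_mem_nhds (x := 1) (t := V) (by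
        rwa [map_one, map_one]))
    refine ⟨m, hm, ?_⟩
    rw [← map_pow, ← map_pow]
    exact hm'
  -- In the abelian group `Gal(L/k)` conjugation by `σ` disappears, so the tame relation becomes `t
  -- = t^N`; there is no torsion and `N > 1`.
  have h2 : resAbs L (resLocal j t) ^ (N - 1) = 1 := by
    have hN : N = N - 1 + 1 := by
      have := finite_residueField (q := q)
      exact (Nat.succ_pred_eq_of_pos Nat.card_pos).symm
    rw [map_mul, map_mul, map_mul, map_mul, map_mul, map_mul, mul_comm' (resAbs L (resLocal j σ)),
      map_inv, map_inv, mul_inv_cancel_right, map_inv, map_inv, mul_inv_eq_one, map_pow, map_pow,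
      hN, pow_succ, eq_comm, mul_eq_right] at h1
    exact h1
  refine eq_one_of_pow_eq_one e ?_ h2
  have := finite_residueField (q := q)
  have : 1 < N := Finite.one_lt_card
  omega

/-- A Frobenius lift at a prime that does not split completely in a `ℤ_p^r`-extension. -/
lemma resAbs_ne_one_of_not_splitsCompletely (hs : ¬ SplitsCompletely q L) :
    resAbs L (resLocal j σ) ≠ 1 := by
  refine fun h => hs fun Q hQ g hg => ?_
  obtain ⟨τ, hτ⟩ := exists_smul_eq_of_mem_primesAbove hQ (primeOfEmbedding_mem q j)
  have hg' : τ * g * τ⁻¹ ∈ MulAction.stabilizer Gal(AlgebraicClosure k/k)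
      (primeOfEmbedding q j) := by
    rw [MulAction.mem_stabilizer_iff] at hg ⊢
    rw [hτ, mul_smul, inv_smul_smul, mul_smul, hg]
  obtain ⟨s, hs⟩ := exists_resLocal_eq q j hg'
  rw [← resAbs_eq_one_iff, ← conj_eq_one_iff (a := resAbs L τ), ← map_inv, ← map_mul, ← map_mul,
    ← hs]
  by_contra hne
  -- Inertia acts trivially on `L`. If the Frobenius did too, then so would the whole decomposition
  -- group, which they generate topologically.
  obtain ⟨V, hV⟩ := exists_openSubgroup_notMem hne
  obtain ⟨a, ha⟩ := exists_frobenius_pow_inv_mul_mem hσ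
    (W := V.1.comap ((resAbs L).comp (resLocal j)))
    (V.isOpen'.preimage (continuous_resAbs_resLocal L)) (fun t ht => by
      rw [Subgroup.mem_comap, MonoidHom.comp_apply,
        resAbs_eq_one_of_mem_localInertia hpq e hσ ht]
      exact one_mem _) s
  rw [Subgroup.mem_comap, MonoidHom.comp_apply, map_mul, map_mul, map_inv, map_inv, map_pow,
    map_pow, h, one_pow, inv_one, one_mul] at ha
  exact hV ha

end Unramified

/-! ### The Galois group of `k_∞K` over `k`. -/

section Compositum

variable {k : Type*} [Field k] (kinf K : IntermediateField k (AlgebraicClosure k))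
  [IsAbelianGalois k kinf] [IsAbelianGalois k K] [FiniteDimensional k K]

lemma card_dvd_finrank_of_le_galOver {H : Subgroup Gal(↥(kinf ⊔ K)/k)}
    (hH : H ≤ galOver kinf K) : Nat.card H ∣ Module.finrank k K := by
  rw [← IsGalois.card_aut_eq_finrank]
  refine Subgroup.card_dvd_of_injective
    ((resGal (le_sup_right : K ≤ kinf ⊔ K)).comp H.subtype) fun γ δ h => ?_
  exact Subtype.ext (resGal_ext ((hH γ.2).trans (hH δ.2).symm) h)

variable {kinf K} {p : ℕ} [hp : Fact p.Prime] {r : ℕ}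

/-- `Gal(k_∞K/k)` embeds homeomorphically into the product of `ℤ_p^r` with a finite `p`-group, where
`p^a`-th powers tend to the identity. -/
lemma exists_pow_pow_mem (e : Gal(kinf/k) ≃ₜ* Multiplicative (Fin r → ℤ_[p])) {m : ℕ}
    (hm : Module.finrank k K = p ^ m) (γ : Gal(↥(kinf ⊔ K)/k))
    (V : OpenSubgroup Gal(↥(kinf ⊔ K)/k)) : ∃ a : ℕ, γ ^ p ^ a ∈ V := by
  let f : Gal(↥(kinf ⊔ K)/k) → Gal(kinf/k) × Gal(K/k) := fun γ =>
    (resGal le_sup_left γ, resGal le_sup_right γ)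
  have hf : Topology.IsClosedEmbedding f :=
    ((continuous_resGal _).prodMk (continuous_resGal _)).isClosedEmbedding fun γ δ h =>
      resGal_ext (congrArg Prod.fst h) (congrArg Prod.snd h)
  have h1 : Filter.Tendsto (fun a : ℕ => γ ^ p ^ a) Filter.atTop (nhds 1) := by
    rw [hf.isInducing.tendsto_nhds_iff]
    refine Filter.Tendsto.prodMk_nhds ?_ ?_
    · simp only [map_pow, map_one]
      exact tendsto_pow_pow_one e _
    · refine tendsto_const_nhds.congr' ?_
      filter_upwards [Filter.eventually_ge_atTop m] with a ha
      have h2 : resGal (le_sup_right : K ≤ kinf ⊔ K) γ ^ p ^ m = 1 := by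
        rw [← hm, ← IsGalois.card_aut_eq_finrank]
        exact pow_card_eq_one'
      rw [map_one, map_pow, ← Nat.sub_add_cancel ha, add_comm, pow_add, pow_mul, h2, one_pow]
  exact (h1.eventually (V.isOpen.mem_nhds V.one_mem)).exists

end Compositum

/-! ### From abstract tame actions to the local cohomology of the Iwasawa representation. -/

section GeneratesUpTo

variable {R : Type*} [CommRing R]

/-- `Δ` generates the ideal `J` up to powers of `n`. -/
def GeneratesUpTo (n : ℕ) (Δ : R) (J : Ideal R) : Prop :=
  Δ ∈ J ∧ ∃ e : ℕ, ∀ a ∈ J, (n : R) ^ e * a ∈ Ideal.span {Δ}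

lemma GeneratesUpTo.map_eq {n : ℕ} {Δ : R} {J : Ideal R} (h : GeneratesUpTo n Δ J) {S : Type*}
    [CommRing S] [Algebra R S] (hn : IsUnit (n : S)) :
    J.map (algebraMap R S) = Ideal.span {algebraMap R S Δ} := by
  obtain ⟨hΔ, e, he⟩ := h
  refine le_antisymm (Ideal.map_le_iff_le_comap.2 fun a ha => ?_)
    ((Ideal.span_singleton_le_iff_mem _).2 (Ideal.mem_map_of_mem _ hΔ))
  obtain ⟨c, hc⟩ := Ideal.mem_span_singleton.1 (he a ha)
  rw [Ideal.mem_comap, ← Ideal.unit_mul_mem_iff_mem _ (hn.pow e), ← map_natCast (algebraMap R S) n, ← map_pow, ← map_mul, hc, map_mul]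
  exact Ideal.mul_mem_right _ _ (Ideal.mem_span_singleton_self _)

end GeneratesUpTo

section TameCohomology

variable {O : Type*} [CommRing O] [IsDomain O] [CharZero O] {𝔪 : Ideal O} [IsAdicComplete 𝔪 O]
  [TopologicalSpace O] [IsTopologicalRing O] {Γ : Type*} [CommGroup Γ] [TopologicalSpace Γ]
  [IsTopologicalGroup Γ] [CompactSpace Γ]
  {T : Type*} [AddCommGroup T] [Module O T] [Module.Free O T] [Module.Finite O T]
  {G : Type*} [Group G] [TopologicalSpace G] [IsTopologicalGroup G] [CompactSpace G]
  {p N : ℕ} {ρT : Representation O G T} {χ : G →* Γ} {I : Subgroup G} {σ : G}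
  {ρ : Representation (CompletedGroupAlgebra O Γ) G (CompletedGroupAlgebra O Γ ⊗[O] T)}

/-- `H`, `γ` and `P` are variables tied by equations, so that data attached to a conjugate Frobenius
can be substituted. -/
theorem exists_generator_charIdeal_of_tame (hO : IsAdic 𝔪) (hp : p.Prime) (hpm : (p : O) ∈ 𝔪)
    (hN : (N : O) ≠ 0) (hχ : Continuous χ)
    (hρ : ∀ g, ρ g = groupElem O Γ (χ g)⁻¹ • (ρT g).baseChange (CompletedGroupAlgebra O Γ))
    (hT : ∀ n : ℕ, ∃ V : Subgroup G, IsOpen (V : Set G) ∧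
      ∀ v ∈ V, ∀ t, ρT v t - t ∈ 𝔪 ^ n • (⊤ : Submodule O T))
    (hTI : ∀ t ∈ I, ρT t = 1) (hI : I.Normal)
    (hgen : ∀ V : Subgroup G, IsOpen (V : Set G) → I ≤ V → ∀ g, ∃ a : ℕ, (σ ^ a)⁻¹ * g ∈ V)
    (hdvd : ∀ n : ℕ, 0 < n → ∃ V : Subgroup G, V.Normal ∧ IsOpen (V : Set G) ∧ I ≤ V ∧
      ∀ a : ℕ, σ ^ a ∈ V → n ∣ a)
    (htame : ∀ t ∈ I, ∀ V : Subgroup G, IsOpen (V : Set G) →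
      ∃ m : ℕ, p.Coprime m ∧ (σ * t * σ⁻¹ * (t ^ N)⁻¹) ^ m ∈ V)
    (H : Subgroup Γ) [Fintype H] (hH : I.map χ = H)
    (hV₀ : ∃ V₀ : OpenSubgroup Γ, ∀ h ∈ H, h ∈ V₀ → h = 1) {γ : Γ} (hγ : χ σ = γ) {P : O[X]}
    (hP : frobPoly (ρT σ) = P) (h1 : ∀ V : OpenSubgroup Γ, ∃ a, γ ^ p ^ a ∈ V)
    (h2 : ∀ b, ∃ V : OpenSubgroup Γ, γ ^ p ^ b ∉ V) :
    Module.Finite (CompletedGroupAlgebra O Γ) (H1 ρ) ∧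
    ∃ (d : ℕ) (Δ : CompletedGroupAlgebra O Γ),
      Fintype.card H * Δ = Fintype.card H ^ d *
        (normElem O H * Polynomial.aeval (groupElem O Γ γ⁻¹) P +
          (Fintype.card H - normElem O H)) ∧
      ∀ (s : ℕ) (φ : (Fin s → CompletedGroupAlgebra O Γ) →ₗ[CompletedGroupAlgebra O Γ] H1 ρ),
        Function.Surjective φ → GeneratesUpTo (Fintype.card H) Δ (charIdeal φ) := by
  subst hH hγ hP
  obtain ⟨V₀, hV₀⟩ := hV₀
  obtain ⟨θ, hθ⟩ := exists_tameAction hO hp hpm hN hχ hρ hT hTI hI hgen hdvd htame V₀ hV₀ h1 h2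
  exact exists_generator_charIdeal_H1 hθ hp hpm hρ h1 h2

end TameCohomology

section IwasawaRep

open scoped IsMulCommutative

variable {O : Type*} [CommRing O] {T : Type*} [AddCommGroup T] [Module O T]

lemma resAbs_conj {k : Type*} [Field k] (L : IntermediateField k (AlgebraicClosure k))
    [IsAbelianGalois k L] (τ g : Gal(AlgebraicClosure k/k)) :
    resAbs L (τ * g * τ⁻¹) = resAbs L g := by
  rw [map_mul, map_mul, mul_right_comm, ← map_mul, mul_inv_cancel, map_one, one_mul]

lemma iwasawaRep_comp_apply {k : Type*} [Field k] {G : Type*} [Group G]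
    (f : G →* Gal(AlgebraicClosure k/k)) (ρ : Representation O Gal(AlgebraicClosure k/k) T)
    (L : IntermediateField k (AlgebraicClosure k)) [IsAbelianGalois k L] (g : G) :
    (iwasawaRep ρ L).comp f g = groupElem O Gal(L/k) ((resAbs L).comp f g)⁻¹ •
      (ρ.comp f g).baseChange (CompletedGroupAlgebra O Gal(L/k)) :=
  rfl

variable [IsDomain O] [CharZero O] {𝔪 : Ideal O} [IsAdicComplete 𝔪 O]
  [TopologicalSpace O] [IsTopologicalRing O] [Module.Free O T] [Module.Finite O T]
  {k : Type*} [Field k] {G : Type*} [Group G] [TopologicalSpace G]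
  [IsTopologicalGroup G] [CompactSpace G] {p N : ℕ}
  {ρ : Representation O Gal(AlgebraicClosure k/k) T} {f : G →* Gal(AlgebraicClosure k/k)}
  {L : IntermediateField k (AlgebraicClosure k)} [IsAbelianGalois k L] {I : Subgroup G} {σ : G}

theorem exists_generator_charIdeal_iwasawaRep_comp (hO : IsAdic 𝔪) (hp : p.Prime)
    (hpm : (p : O) ∈ 𝔪) (hN : (N : O) ≠ 0) (hf : Continuous f)
    (hT : ∀ n : ℕ, ∃ V : Subgroup G, IsOpen (V : Set G) ∧
      ∀ v ∈ V, ∀ t, ρ (f v) t - t ∈ 𝔪 ^ n • (⊤ : Submodule O T))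
    (hTI : ∀ t ∈ I, ρ (f t) = 1) (hI : I.Normal)
    (hgen : ∀ V : Subgroup G, IsOpen (V : Set G) → I ≤ V → ∀ g, ∃ a : ℕ, (σ ^ a)⁻¹ * g ∈ V)
    (hdvd : ∀ n : ℕ, 0 < n → ∃ V : Subgroup G, V.Normal ∧ IsOpen (V : Set G) ∧ I ≤ V ∧
      ∀ a : ℕ, σ ^ a ∈ V → n ∣ a)
    (htame : ∀ t ∈ I, ∀ V : Subgroup G, IsOpen (V : Set G) →
      ∃ m : ℕ, p.Coprime m ∧ (σ * t * σ⁻¹ * (t ^ N)⁻¹) ^ m ∈ V)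
    (H : Subgroup Gal(L/k)) [Fintype H] (hH : I.map ((resAbs L).comp f) = H)
    {γ : Gal(L/k)} (hγ : resAbs L (f σ) = γ) {P : O[X]} (hP : frobPoly (ρ (f σ)) = P)
    (h1 : ∀ V : OpenSubgroup Gal(L/k), ∃ a, γ ^ p ^ a ∈ V) (h2 : ∀ b, γ ^ p ^ b ≠ 1) :
    Module.Finite (IwasawaAlgebra O L) (H1 ((iwasawaRep ρ L).comp f)) ∧
    ∃ (d : ℕ) (Δ : IwasawaAlgebra O L),
      Fintype.card H * Δ = Fintype.card H ^ d *
        (normElem O H * Polynomial.aeval (galElem O L γ⁻¹) P + (Fintype.card H - normElem O H)) ∧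
      ∀ (s : ℕ) (φ : (Fin s → IwasawaAlgebra O L) →ₗ[IwasawaAlgebra O L]
          H1 ((iwasawaRep ρ L).comp f)),
        Function.Surjective φ → GeneratesUpTo (Fintype.card H) Δ (charIdeal φ) := by
  have hfin : Finite H := Finite.of_fintype H
  have hV₀ := exists_openSubgroup_forall_eq_one H
  exact exists_generator_charIdeal_of_tame (𝔪 := 𝔪) (ρT := ρ.comp f) hO hp hpm hN
    ((InfiniteGalois.restrictNormalHom_continuous L).comp hf)
    (iwasawaRep_comp_apply f ρ L) hT hTI hI hgen hdvd htame H hH hV₀ hγ hP h1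
    fun b => exists_openSubgroup_notMem (h2 b)

end IwasawaRep

section LocalCohomology

open NumberField IsDedekindDomain
open scoped Pointwise IsMulCommutative

variable {k : Type*} [Field k] [NumberField k] {q : HeightOneSpectrum (𝓞 k)}
  {j : AlgebraicClosure k →ₐ[k] AlgebraicClosure (q.adicCompletion k)}
  {Q : Ideal (𝓞 (AlgebraicClosure k))} {Fr : Gal(AlgebraicClosure k/k)}

/-- `Q` and `Fr` need not be compatible with the embedding `j`. Conjugation by `τ` aligns them, and
is invisible both in abelian quotients and in the Frobenius polynomial. -/
lemma exists_resLocal_eq_conj (hQ : Q ∈ PrimesAbove q) (hFr : IsFrobenius Q Fr) :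
    ∃ τ σ, primeOfEmbedding q j = τ • Q ∧ resLocal j σ = τ * Fr * τ⁻¹ ∧
      IsFrobenius (primeOfEmbedding q j) (resLocal j σ) := by
  obtain ⟨τ, hτ⟩ := exists_smul_eq_of_mem_primesAbove hQ (primeOfEmbedding_mem q j)
  have h1 : IsFrobenius (primeOfEmbedding q j) (τ * Fr * τ⁻¹) := hτ ▸ hFr.conj τ
  have := (primeOfEmbedding_mem q j).1
  obtain ⟨σ, hσ⟩ := exists_resLocal_eq q j h1.mem_stabilizer
  exact ⟨τ, σ, hτ, hσ, hσ ▸ h1⟩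

lemma map_localInertia (L : IntermediateField k (AlgebraicClosure k)) [IsAbelianGalois k L]
    {τ : Gal(AlgebraicClosure k/k)} (hτ : primeOfEmbedding q j = τ • Q) :
    (localInertia q j).map ((resAbs L).comp (resLocal j)) = (inertiaAt Q).map (resAbs L) := by
  ext γ
  constructor
  · rintro ⟨t, ht, rfl⟩
    refine ⟨τ⁻¹ * resLocal j t * τ, ?_, ?_⟩
    · rw [SetLike.mem_coe, ← inertiaAt_smul, ← hτ]
      exact ht
    · rw [← inv_inv τ, inv_inv τ⁻¹]
      exact resAbs_conj L τ⁻¹ _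
  · rintro ⟨g, hg, rfl⟩
    obtain ⟨t, ht, htg⟩ := exists_resLocal_of_mem_inertiaAt (q := q) (j := j)
      (g := τ * g * τ⁻¹) (by
        rw [hτ, inertiaAt_smul]
        simpa [mul_assoc] using hg)
    refine ⟨t, ht, ?_⟩
    rw [MonoidHom.comp_apply, htg, resAbs_conj]

lemma map_localInertia_le_galOver {kinf K : IntermediateField k (AlgebraicClosure k)}
    [IsAbelianGalois k kinf] [IsAbelianGalois k K] {p : ℕ} [Fact p.Prime] {r : ℕ}
    (hpq : (p : 𝓞 k) ∉ q.asIdeal) (e : Gal(kinf/k) ≃ₜ* Multiplicative (Fin r → ℤ_[p]))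
    {σ} (hσ : IsFrobenius (primeOfEmbedding q j) (resLocal j σ)) :
    (localInertia q j).map ((resAbs (kinf ⊔ K)).comp (resLocal j)) ≤ galOver kinf K := by
  rintro _ ⟨t, ht, rfl⟩
  rw [MonoidHom.mem_ker, MonoidHom.comp_apply, resGal_resAbs]
  exact resAbs_eq_one_of_mem_localInertia hpq e hσ ht

variable {p : ℕ} [hp : Fact p.Prime] {O : Type*} [CommRing O] [IsDomain O] [CharZero O]
  {𝔪 : Ideal O} [IsAdicComplete 𝔪 O] [TopologicalSpace O] [IsTopologicalRing O]
  {T : Type*} [AddCommGroup T] [Module O T] [Module.Free O T] [Module.Finite O T]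
  [TopologicalSpace T] [IsModuleTopology O T]
  {ρ : Representation O Gal(AlgebraicClosure k/k) T}
  {L : IntermediateField k (AlgebraicClosure k)} [IsAbelianGalois k L]

theorem exists_generator_charIdeal_iwasawaRep (hO : IsAdic 𝔪) (hpm : (p : O) ∈ 𝔪)
    (hρ : Continuous fun x : Gal(AlgebraicClosure k/k) × T => ρ x.1 x.2)
    (hρQ : ∀ Q ∈ PrimesAbove q, ∀ g ∈ inertiaAt Q, ρ g = 1)
    (hpq : (p : 𝓞 k) ∉ q.asIdeal) (hQ : Q ∈ PrimesAbove q)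
    (hFr : IsFrobenius Q Fr) (H : Subgroup Gal(L/k)) [Fintype H]
    (hH : (inertiaAt Q).map (resAbs L) = H)
    (h1 : ∀ V : OpenSubgroup Gal(L/k), ∃ a, resAbs L Fr ^ p ^ a ∈ V)
    (h2 : ∀ b, resAbs L Fr ^ p ^ b ≠ 1) :
    Module.Finite (IwasawaAlgebra O L) (H1 ((iwasawaRep ρ L).comp (resLocal j))) ∧
    ∃ (d : ℕ) (Δ : IwasawaAlgebra O L),
      Fintype.card H * Δ = Fintype.card H ^ d *
        (normElem O H * Polynomial.aeval (galElem O L (resAbs L Fr)⁻¹)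
          (frobPoly (ρ Fr)) + (Fintype.card H - normElem O H)) ∧
      ∀ (s : ℕ) (φ : (Fin s → IwasawaAlgebra O L) →ₗ[IwasawaAlgebra O L]
          H1 ((iwasawaRep ρ L).comp (resLocal j))),
        Function.Surjective φ → GeneratesUpTo (Fintype.card H) Δ (charIdeal φ) := by
  refine (exists_resLocal_eq_conj (j := j) hQ hFr).elim fun τ h => h.elim fun σ ⟨hτ, hστ, hσ⟩ => ?_
  have hχσ : (resAbs L).comp (resLocal j) σ = resAbs L Fr := by
    rw [MonoidHom.comp_apply, hστ, resAbs_conj]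
  have hP : frobPoly ((ρ.comp (resLocal j)) σ) = frobPoly (ρ Fr) := by
    rw [MonoidHom.comp_apply, hστ, frobPoly_conj]
  rw [← map_localInertia L hτ] at hH
  have hN : (Nat.card (𝓞 k ⧸ q.asIdeal) : O) ≠ 0 := by
    have := finite_residueField (q := q)
    exact Nat.cast_ne_zero.2 Nat.card_pos.ne'
  have hI : (localInertia q j).Normal := ker_residueHom (q := q) (j := j) ▸ MonoidHom.normal_ker _
  exact exists_generator_charIdeal_iwasawaRep_comp hO hp.out hpm hN (continuous_resLocal q j)
    (fun n => by
      obtain ⟨V, hV, hV'⟩ := exists_open_sub_mem hO ρ hρ n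
      exact ⟨V.comap (resLocal j), hV.preimage (continuous_resLocal q j), fun v hv => hV' _ hv⟩)
    (fun t ht => hρQ _ (primeOfEmbedding_mem q j) _ ht) hI
    (fun V hV hI g => exists_frobenius_pow_inv_mul_mem hσ hV hI g)
    (fun n hn => exists_open_normal_frobenius_dvd hσ hn)
    (fun t ht V hV => (isWild_of_mem_localInertia hσ ht).exists_pow_mem hp.out hpq
      (hV.mem_nhds V.one_mem)) H hH hχσ hP h1 h2

end LocalCohomology

section Localization

lemma isUnit_natCast_localization_away {R : Type*} [CommRing R] {p n m : ℕ} (hn : n ∣ p ^ m) :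
    IsUnit (n : Localization.Away (p : R)) := by
  have h1 : IsUnit (algebraMap R (Localization.Away (p : R)) p) :=
    IsLocalization.Away.algebraMap_isUnit _
  rw [map_natCast] at h1
  refine isUnit_of_dvd_unit ?_ (h1.pow m)
  exact_mod_cast Nat.cast_dvd_cast (α := Localization.Away (p : R)) hn

lemma invToQpBar_algebraMap {k : Type*} [Field k] {L : IntermediateField k (AlgebraicClosure k)}
    [IsAbelianGalois k L] {p : ℕ} [Fact p.Prime] {O : Type*} [CommRing O]
    [Algebra O (PadicAlgCl p)] (x : IwasawaAlgebra O L) :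
    invToQpBar O p L (algebraMap _ _ x) = toQpBar O p L x :=
  IsLocalization.Away.lift_eq _ _ _

end Localization

/-! ### Characters of `Gal(K/k)` and the local factor. -/

section CharacterSums

variable {B F : Type*} [CommGroup B] [Finite B] [Field F]

lemma sum_characters_apply [HasEnoughRootsOfUnity F (Monoid.exponent B)]
    [Fintype (B →* Fˣ)] (b : B) [Decidable (b = 1)] :
    ∑ ψ : B →* Fˣ, (ψ b : F) = if b = 1 then (Nat.card B : F) else 0 := by
  split_ifs with hb
  · subst hb
    simp only [map_one, Units.val_one, Finset.sum_const, Finset.card_univ, nsmul_eq_mul, mul_one]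
    rw [← CommGroup.card_monoidHom_of_hasEnoughRootsOfUnity B F, Nat.card_eq_fintype_card]
  · obtain ⟨φ, hφ⟩ := CommGroup.exists_apply_ne_one_of_hasEnoughRootsOfUnity B F hb
    have h1 : (φ b : F) * ∑ ψ : B →* Fˣ, (ψ b : F) = ∑ ψ : B →* Fˣ, (ψ b : F) := by
      rw [Finset.mul_sum]
      refine (Finset.sum_congr rfl fun ψ _ => ?_).trans
        (Equiv.sum_comp (Equiv.mulLeft φ) fun ψ : B →* Fˣ => (ψ b : F))
      rw [Equiv.coe_mulLeft, MonoidHom.mul_apply, Units.val_mul]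
    have h2 : ((φ b : F) - 1) * ∑ ψ : B →* Fˣ, (ψ b : F) = 0 := by rw [sub_mul, h1]; ring
    exact (mul_eq_zero.1 h2).resolve_left fun h => hφ (Units.ext (sub_eq_zero.1 h))

end CharacterSums

section Idempotents

open scoped IsMulCommutative

variable {k : Type*} [Field k] {kinf K : IntermediateField k (AlgebraicClosure k)}
  [IsAbelianGalois k kinf] [IsAbelianGalois k K] [FiniteDimensional k K]
  {p : ℕ} [Fact p.Prime] {O : Type*} [CommRing O] [Algebra O (PadicAlgCl p)]

omit [FiniteDimensional k K] in
lemma charIdempotent_eq_sum [Fintype (galOver kinf K)] (ψ : Gal(K/k) →* (PadicAlgCl p)ˣ) :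
    charIdempotent O p kinf K ψ = (Module.finrank k K : PadicAlgCl p)⁻¹ •
      ∑ γ : galOver kinf K, (ψ (resGal (le_sup_right : K ≤ kinf ⊔ K) γ.1) : PadicAlgCl p) ⊗ₜ[O]
        galElem O (kinf ⊔ K) γ.1⁻¹ := by
  rw [charIdempotent, finsum_eq_sum_of_fintype]

-- By orthogonality of characters only the term of `γ = 1` survives. Consequently an element of `Λ_K
-- ⊗ ℚ̄_p` is determined by its products with the idempotents.
variable (kinf K p O) in
lemma sum_charIdempotent [Fintype (Gal(K/k) →* (PadicAlgCl p)ˣ)] :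
    ∑ ψ, charIdempotent O p kinf K ψ = 1 := by
  classical
  have := finite_galOver kinf K
  have : Fintype (galOver kinf K) := Fintype.ofFinite _
  have : NeZero (Monoid.exponent Gal(K/k)) := ⟨Monoid.exponent_ne_zero_of_finite⟩
  have hroots : HasEnoughRootsOfUnity (PadicAlgCl p) (Monoid.exponent Gal(K/k)) := inferInstance
  simp only [charIdempotent_eq_sum]
  rw [← Finset.smul_sum, Finset.sum_comm]
  simp only [← TensorProduct.sum_tmul, sum_characters_apply]
  rw [Finset.sum_eq_single 1]
  · rw [Subgroup.coe_one, map_one, if_pos rfl, inv_one, map_one, TensorProduct.smul_tmul',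
      IsGalois.card_aut_eq_finrank, smul_eq_mul, inv_mul_cancel₀]
    · rfl
    · exact Nat.cast_ne_zero.2 Module.finrank_pos.ne'
  · intro γ _ hγ
    rw [if_neg, TensorProduct.zero_tmul]
    refine fun h => hγ (Subtype.ext (resGal_ext (γ.2.trans (map_one _).symm) ?_))
    exact h.trans (map_one _).symm
  · exact fun h => absurd (Finset.mem_univ _) h

lemma toQpBar_galElem_mul_charIdempotent (ψ : Gal(K/k) →* (PadicAlgCl p)ˣ)
    {h : Gal(↥(kinf ⊔ K)/k)} (hh : h ∈ galOver kinf K) :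
    toQpBar O p (kinf ⊔ K) (galElem O (kinf ⊔ K) h) * charIdempotent O p kinf K ψ =
      (ψ (resGal le_sup_right h) : PadicAlgCl p) • charIdempotent O p kinf K ψ := by
  have := finite_galOver kinf K
  have : Fintype (galOver kinf K) := Fintype.ofFinite _
  rw [charIdempotent_eq_sum, mul_smul_comm, smul_comm]
  congr 1
  rw [Finset.mul_sum, Finset.smul_sum]
  refine (Equiv.sum_comp (Equiv.mulLeft (⟨h, hh⟩ : galOver kinf K)) _).symm.trans
    (Finset.sum_congr rfl fun γ _ => ?_)
  rw [TensorProduct.smul_tmul', smul_eq_mul, ← Units.val_mul, ← map_mul, ← map_mul]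
  change ((1 : PadicAlgCl p) ⊗ₜ[O] _) * _ = _
  rw [Algebra.TensorProduct.tmul_mul_tmul, one_mul, ← map_mul]
  congr 2
  rw [Equiv.coe_mulLeft, Subgroup.coe_mul, mul_inv_rev]
  rw [mul_comm', mul_assoc, inv_mul_cancel, mul_one]

section NormElem

variable {H : Subgroup Gal(↥(kinf ⊔ K)/k)} [Fintype H] (hH : H ≤ galOver kinf K)
  {ψ : Gal(K/k) →* (PadicAlgCl p)ˣ}

include hH

lemma toQpBar_normElem_mul_charIdempotent :
    toQpBar O p (kinf ⊔ K) (normElem O H) * charIdempotent O p kinf K ψ =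
      (∑ h : H, (ψ (resGal le_sup_right h.1) : PadicAlgCl p)) • charIdempotent O p kinf K ψ := by
  rw [normElem, map_sum, Finset.sum_mul, Finset.sum_smul]
  exact Finset.sum_congr rfl fun h _ => toQpBar_galElem_mul_charIdempotent ψ (hH h.2)

lemma toQpBar_normElem_mul_charIdempotent_of_le
    (hψ : ∀ h ∈ H, ψ (resGal le_sup_right h) = 1) :
    toQpBar O p (kinf ⊔ K) (normElem O H) * charIdempotent O p kinf K ψ =
      (Fintype.card H : PadicAlgCl p) • charIdempotent O p kinf K ψ := by
  rw [toQpBar_normElem_mul_charIdempotent hH]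
  congr 1
  rw [Finset.sum_congr rfl fun h _ => by rw [hψ h.1 h.2, Units.val_one], Finset.sum_const,
    Finset.card_univ, nsmul_eq_mul, mul_one]

lemma toQpBar_normElem_mul_charIdempotent_of_ne {h : Gal(↥(kinf ⊔ K)/k)} (hh : h ∈ H)
    (hψ : ψ (resGal le_sup_right h) ≠ 1) :
    toQpBar O p (kinf ⊔ K) (normElem O H) * charIdempotent O p kinf K ψ = 0 := by
  have h1 : (ψ (resGal le_sup_right h) : PadicAlgCl p) •
      (toQpBar O p (kinf ⊔ K) (normElem O H) * charIdempotent O p kinf K ψ) =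
      toQpBar O p (kinf ⊔ K) (normElem O H) * charIdempotent O p kinf K ψ := by
    rw [← mul_smul_comm, ← toQpBar_galElem_mul_charIdempotent ψ (hH hh), mul_left_comm, ← mul_assoc,
      ← map_mul]
    congr 2
    exact groupElem_mul_normElem hh
  have h2 : ((ψ (resGal le_sup_right h) : PadicAlgCl p) - 1) •
      (toQpBar O p (kinf ⊔ K) (normElem O H) * charIdempotent O p kinf K ψ) = 0 := by
    rw [sub_smul, one_smul, h1, sub_self]
  exact (smul_eq_zero.1 h2).resolve_left fun h3 => hψ (Units.ext (sub_eq_zero.1 h3))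

end NormElem

open NumberField

variable {T : Type*} [AddCommGroup T] [Module O T]
  {ρ : Representation O Gal(AlgebraicClosure k/k) T} {Q : Ideal (𝓞 (AlgebraicClosure k))}
  {Fr : Gal(AlgebraicClosure k/k)} {F : IwasawaAlgebraQpBar O p (kinf ⊔ K)}

/-- The norm element multiplies `e_ψ` by `n` if `ψ` is trivial on inertia and kills it otherwise, so
`νP + (n - ν)` acts as `nP` or as `n`; then cancel the unit `n`. -/
lemma isLocalFactor_of_card_mul_eq {H : Subgroup Gal(↥(kinf ⊔ K)/k)} [Fintype H]
    (hH : H ≤ galOver kinf K) (hHQ : (inertiaAt Q).map (resAbs (kinf ⊔ K)) = H)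
    (hF : Fintype.card H * F = toQpBar O p (kinf ⊔ K) (normElem O H *
      Polynomial.aeval (galElem O (kinf ⊔ K) (resAbs (kinf ⊔ K) Fr)⁻¹) (frobPoly (ρ Fr)) +
        (Fintype.card H - normElem O H))) : IsLocalFactor p kinf K ρ Q Fr F := by
  intro ψ
  have hn : IsUnit (Fintype.card H : IwasawaAlgebraQpBar O p (kinf ⊔ K)) := by
    have h : IsUnit (Fintype.card H : PadicAlgCl p) :=
      (Nat.cast_ne_zero.2 Fintype.card_ne_zero).isUnit
    have := h.map (algebraMap (PadicAlgCl p) (IwasawaAlgebraQpBar O p (kinf ⊔ K)))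
    rwa [map_natCast] at this
  have hψ : (inertiaAt Q).map (resAbs K) ≤ ψ.ker ↔
      ∀ h ∈ H, ψ (resGal (le_sup_right : K ≤ kinf ⊔ K) h) = 1 := by
    subst hHQ
    constructor
    · rintro hle _ ⟨g, hg, rfl⟩
      rw [resGal_resAbs]
      exact hle ⟨g, hg, rfl⟩
    · rintro h _ ⟨g, hg, rfl⟩
      have := h _ ⟨g, hg, rfl⟩
      rwa [resGal_resAbs] at this
  refine hn.mul_left_cancel ?_
  rw [← mul_assoc, hF]
  set D := Polynomial.aeval (galElem O (kinf ⊔ K) (resAbs (kinf ⊔ K) Fr)⁻¹) (frobPoly (ρ Fr))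
  rw [map_add, map_mul, map_sub, map_natCast]
  split_ifs with hQ
  · have h1 := toQpBar_normElem_mul_charIdempotent_of_le (O := O) hH (hψ.1 hQ)
    rw [Nat.cast_smul_eq_nsmul, nsmul_eq_mul] at h1
    linear_combination (toQpBar O p (kinf ⊔ K) D - 1) * h1
  · rw [hψ] at hQ
    push Not at hQ
    obtain ⟨h, hh, hne⟩ := hQ
    have h1 := toQpBar_normElem_mul_charIdempotent_of_ne (O := O) hH hh hne
    linear_combination (toQpBar O p (kinf ⊔ K) D - 1) * h1

lemma IsLocalFactor.unique {F' : IwasawaAlgebraQpBar O p (kinf ⊔ K)}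
    (h : IsLocalFactor p kinf K ρ Q Fr F) (h' : IsLocalFactor p kinf K ρ Q Fr F') : F = F' := by
  have : Finite (Gal(K/k) →* (PadicAlgCl p)ˣ) := by
    have : NeZero (Monoid.exponent Gal(K/k)) := ⟨Monoid.exponent_ne_zero_of_finite⟩
    exact .of_equiv _ (CommGroup.monoidHom_mulEquiv_of_hasEnoughRootsOfUnity Gal(K/k)
      (PadicAlgCl p)).some.symm.toEquiv
  have : Fintype (Gal(K/k) →* (PadicAlgCl p)ˣ) := Fintype.ofFinite _
  rw [← mul_one F, ← mul_one F', ← sum_charIdempotent kinf K p O, Finset.mul_sum, Finset.mul_sum]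
  exact Finset.sum_congr rfl fun ψ _ => (h ψ).trans (h' ψ).symm

end Idempotents

section Compositum

open NumberField IsDedekindDomain
open scoped Pointwise

variable {k : Type*} [Field k] [NumberField k] {q : HeightOneSpectrum (𝓞 k)}
  (j : AlgebraicClosure k →ₐ[k] AlgebraicClosure (q.adicCompletion k))
  {Q : Ideal (𝓞 (AlgebraicClosure k))} {Fr : Gal(AlgebraicClosure k/k)}
  {kinf K : IntermediateField k (AlgebraicClosure k)} [IsAbelianGalois k kinf]
  [IsAbelianGalois k K] {p : ℕ} [hp : Fact p.Prime] {r : ℕ} (hpq : (p : 𝓞 k) ∉ q.asIdeal)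
  (e : Gal(kinf/k) ≃ₜ* Multiplicative (Fin r → ℤ_[p])) (hQ : Q ∈ PrimesAbove q)
  (hFr : IsFrobenius Q Fr)

include j hpq e hQ hFr

lemma map_inertiaAt_le_galOver : (inertiaAt Q).map (resAbs (kinf ⊔ K)) ≤ galOver kinf K := by
  obtain ⟨τ, σ, hτ, -, hσ⟩ := exists_resLocal_eq_conj (j := j) hQ hFr
  rw [← map_localInertia (kinf ⊔ K) hτ]
  exact map_localInertia_le_galOver hpq e hσ

/-- The restriction to the torsion-free group `Gal(k_∞/k)` is already nontrivial. -/
lemma resAbs_sup_pow_ne_one (hs : ¬ SplitsCompletely q kinf) (b : ℕ) :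
    resAbs (kinf ⊔ K) Fr ^ p ^ b ≠ 1 := by
  obtain ⟨τ, σ, hτ, hστ, hσ⟩ := exists_resLocal_eq_conj (j := j) hQ hFr
  refine fun h => resAbs_ne_one_of_not_splitsCompletely hpq e hσ hs
    (eq_one_of_pow_eq_one e (pow_ne_zero b hp.out.ne_zero) ?_)
  rw [hστ, resAbs_conj, ← resGal_resAbs (le_sup_left : kinf ≤ kinf ⊔ K), ← map_pow]
  exact (congrArg _ h).trans (map_one _)

end Compositum
-- The local factor over `Λ_K[1/p]` and the main theorem.
section LocalFactor

open scoped IsMulCommutative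

variable {k : Type*} [Field k] {kinf K : IntermediateField k (AlgebraicClosure k)}
  [IsAbelianGalois k kinf] [IsAbelianGalois k K] [FiniteDimensional k K]
  {p : ℕ} [Fact p.Prime] {O : Type*} [CommRing O] [Algebra O (PadicAlgCl p)]
  {T : Type*} [AddCommGroup T] [Module O T] (ρ : Representation O Gal(AlgebraicClosure k/k) T)
  {Q : Ideal (NumberField.RingOfIntegers (AlgebraicClosure k))} (Fr : Gal(AlgebraicClosure k/k))

/-- The order `n` of `H` divides a power of `p`, hence is a unit in `Λ_K[1/p]`. There `f = (νP + n -
ν)/n`, and the generator is `Δ = n^d f`, a unit multiple of `f`. -/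
lemma exists_isLocalFactor {H : Subgroup Gal(↥(kinf ⊔ K)/k)} [Fintype H]
    (hH : H ≤ galOver kinf K) (hHQ : (inertiaAt Q).map (resAbs (kinf ⊔ K)) = H) {m : ℕ}
    (hm : Module.finrank k K = p ^ m) :
    ∃ f : IwasawaAlgebraInv O p (kinf ⊔ K),
      IsLocalFactor p kinf K ρ Q Fr (invToQpBar O p (kinf ⊔ K) f) ∧
      ∀ (d : ℕ) (Δ : IwasawaAlgebra O (kinf ⊔ K)),
        Fintype.card H * Δ = Fintype.card H ^ d * (normElem O H *
          Polynomial.aeval (galElem O (kinf ⊔ K) (resAbs (kinf ⊔ K) Fr)⁻¹) (frobPoly (ρ Fr)) +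
            (Fintype.card H - normElem O H)) →
        ∀ J, GeneratesUpTo (Fintype.card H) Δ J →
          J.map (algebraMap _ (IwasawaAlgebraInv O p (kinf ⊔ K))) = Ideal.span {f} := by
  have hcard : Fintype.card H ∣ p ^ m := by
    rw [← hm, Fintype.card_eq_nat_card]
    exact card_dvd_finrank_of_le_galOver kinf K hH
  obtain ⟨u, hu⟩ := isUnit_natCast_localization_away (R := IwasawaAlgebra O (kinf ⊔ K)) hcard
  set x := normElem O H * Polynomial.aeval (galElem O (kinf ⊔ K) (resAbs (kinf ⊔ K) Fr)⁻¹)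
    (frobPoly (ρ Fr)) + (Fintype.card H - normElem O H) with hx
  obtain ⟨f, hnf⟩ : ∃ f : IwasawaAlgebraInv O p (kinf ⊔ K),
      Fintype.card H * f = algebraMap _ _ x :=
    ⟨↑u⁻¹ * algebraMap _ _ x, by rw [← hu, Units.mul_inv_cancel_left]⟩
  refine ⟨f, isLocalFactor_of_card_mul_eq hH hHQ ?_, fun d Δ hΔ J hJ => ?_⟩
  · rw [← hx, ← invToQpBar_algebraMap, ← hnf, map_mul, map_natCast]
  rw [hJ.map_eq ⟨u, hu⟩]
  have hΔf : algebraMap _ (IwasawaAlgebraInv O p (kinf ⊔ K)) Δ = ↑(u ^ d) * f := by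
    refine u.isUnit.mul_left_cancel ?_
    have := congrArg (algebraMap _ (IwasawaAlgebraInv O p (kinf ⊔ K))) hΔ
    rw [map_mul, map_mul, map_pow, map_natCast, ← hnf] at this
    rw [Units.val_pow_eq_pow_val, hu, this]
    ring
  rw [hΔf]
  exact Ideal.span_singleton_mul_left_unit (u ^ d).isUnit f

end LocalFactor

end IwasawaLocal

end

open IwasawaLocal NumberField IsDedekindDomain in
theorem mainTheorem5
    -- the odd prime, the number field and the finite set of places (`S` is the set of finite
    -- places; the infinite places are tacitly included)
    (p : ℕ) [Fact p.Prime] (hp : p ≠ 2)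
    (k : Type*) [Field k] [NumberField k] (hcl : p.Coprime (classNumber k))
    (S : Finset (HeightOneSpectrum (𝓞 k)))
    (hS : ∀ v : HeightOneSpectrum (𝓞 k), (p : 𝓞 k) ∈ v.asIdeal → v ∈ S)
    -- the coefficient ring
    (O : Type*) [CommRing O] [IsDomain O] [IsDiscreteValuationRing O]
    [IsAdicComplete (IsLocalRing.maximalIdeal O) O] [CharP (IsLocalRing.ResidueField O) p]
    [TopologicalSpace O] [IsTopologicalRing O] (hO : IsAdic (IsLocalRing.maximalIdeal O))
    [Algebra O (PadicAlgCl p)] [FaithfulSMul O (PadicAlgCl p)]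
    -- the Galois representation `T` of `G_{k,S}`
    (T : Type*) [AddCommGroup T] [Module O T] [Module.Free O T] [Module.Finite O T]
    [TopologicalSpace T] [IsModuleTopology O T]
    (ρ : Representation O Gal(AlgebraicClosure k/k) T)
    (hρcont : Continuous fun x : Gal(AlgebraicClosure k/k) × T => ρ x.1 x.2)
    (hρS : ∀ g ∈ (maxUnramifiedOutside S).fixingSubgroup, ρ g = 1)
    (hH0 : ∀ t : T, (∀ g, ρ g t - t ∈ IsLocalRing.maximalIdeal O • (⊤ : Submodule O T)) →
      t ∈ IsLocalRing.maximalIdeal O • (⊤ : Submodule O T))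
    -- the `ℤ_p^r`-extension `k_∞ / k`
    (kinf : IntermediateField k (AlgebraicClosure k)) [IsAbelianGalois k kinf]
    (r : ℕ) (hr : 1 ≤ r) (hkinf : Nonempty (Gal(kinf/k) ≃ₜ* Multiplicative (Fin r → ℤ_[p])))
    (hsplit : ∀ v : HeightOneSpectrum (𝓞 k), ¬ SplitsCompletely v kinf)
    -- the pro-`p` abelian extension `𝒦 / k`, unramified at `S`, and a finite subextension `K / k`
    (Kcal : IntermediateField k (AlgebraicClosure k)) [IsAbelianGalois k Kcal]
    (hKcalp : ∀ E : IntermediateField k (AlgebraicClosure k), E ≤ Kcal → FiniteDimensional k E →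
      ∃ n : ℕ, Module.finrank k E = p ^ n)
    (hKcalS : ∀ v ∈ S, UnramifiedAt v Kcal)
    (K : IntermediateField k (AlgebraicClosure k)) (hK : K ≤ Kcal) [FiniteDimensional k K]
    [IsAbelianGalois k K]
    -- the prime `q ∉ S`, an embedding `k̄ → k̄_q`, and a lift `Fr` of the arithmetic Frobenius
    (q : HeightOneSpectrum (𝓞 k)) (hq : q ∉ S)
    (j : AlgebraicClosure k →ₐ[k] AlgebraicClosure (q.adicCompletion k))
    (Q : Ideal (𝓞 (AlgebraicClosure k))) (hQ : Q ∈ PrimesAbove q)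
    (Fr : Gal(AlgebraicClosure k/k)) (hFr : IsFrobenius Q Fr) :
    -- `H¹(G_{k_q}, 𝕋_K)` is a finitely generated `Λ_K`-module
    Module.Finite (IwasawaAlgebra O (kinf ⊔ K))
      (H1 ((iwasawaRep ρ (kinf ⊔ K)).comp (resLocal j))) ∧
    -- the element `f_{K,q}` of `Λ_K ⊗ ℚ̄_p` is well defined
    (∃! F : IwasawaAlgebraQpBar O p (kinf ⊔ K), IsLocalFactor p kinf K ρ Q Fr F) ∧
    -- it lies in `Λ_K[1/p]`, where it generates the characteristic ideal (computed from any
    -- presentation `0 → N → Λ_K^s → H¹(G_{k_q}, 𝕋_K) → 0`)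
    ∃ f : IwasawaAlgebraInv O p (kinf ⊔ K),
      IsLocalFactor p kinf K ρ Q Fr (invToQpBar O p (kinf ⊔ K) f) ∧
      ∀ (s : ℕ), 1 ≤ s →
        ∀ φ : (Fin s → IwasawaAlgebra O (kinf ⊔ K)) →ₗ[IwasawaAlgebra O (kinf ⊔ K)]
            H1 ((iwasawaRep ρ (kinf ⊔ K)).comp (resLocal j)),
          Function.Surjective φ →
            (charIdeal φ).map (algebraMap (IwasawaAlgebra O (kinf ⊔ K))
                (IwasawaAlgebraInv O p (kinf ⊔ K))) = Ideal.span {f} := by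
  have hpm : (p : O) ∈ IsLocalRing.maximalIdeal O := by
    rw [← IsLocalRing.residue_eq_zero_iff, map_natCast]
    exact CharP.cast_eq_zero _ p
  have : CharZero O := (algebraMap O (PadicAlgCl p)).charZero
  have hpq : (p : 𝓞 k) ∉ q.asIdeal := fun h => hq (hS q h)
  refine hkinf.elim fun e => (hKcalp K hK inferInstance).elim fun m hm => ?_
  have hH : (inertiaAt Q).map (resAbs (kinf ⊔ K)) ≤ galOver kinf K :=
    map_inertiaAt_le_galOver j hpq e hQ hFr
  have := finite_galOver kinf K
  have : Finite ((inertiaAt Q).map (resAbs (kinf ⊔ K))) :=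
    Finite.of_injective _ (Subgroup.inclusion_injective hH)
  have : Fintype ((inertiaAt Q).map (resAbs (kinf ⊔ K))) := Fintype.ofFinite _
  have key := exists_generator_charIdeal_iwasawaRep (j := j) (L := kinf ⊔ K) hO hpm hρcont
    (fun Q hQ g hg => hρS g (inertiaAt_le_fixingSubgroup_maxUnramifiedOutside hq hQ hg)) hpq hQ hFr
    _ rfl (exists_pow_pow_mem e hm _) (resAbs_sup_pow_ne_one j hpq e hQ hFr (hsplit q))
  exact (exists_isLocalFactor ρ Fr hH rfl hm).elim fun f hf =>
    ⟨key.1, ⟨_, hf.1, fun F hF => hF.unique hf.1⟩, f, hf.1, fun s _ φ hφ =>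
      key.2.elim fun d h => h.elim fun Δ h => hf.2 d Δ h.1 _ (h.2 s φ hφ)⟩
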